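/- Let $\mathcal K$ be a finite dimensional complex Hilbert space, $\mathfrak h$ a complex Hilbert space, $\Upsilon\in B(\mathcal K)$, $\nu\in B(\mathcal K,\mathcal K\otimes\mathfrak h)$ with \[-i\Upsilon+i\Upsilon^*=-\nu^*\nu ,\] and let $M(A)=-i(\Upsilon A-A\Upsilon^*)+\nu^*(A\otimes 1)\nu$ for $A\in B(\mathcal K)$ (a Lindblad form of the generator of a Markov completely positive semigroup $e^{tM}$ on $B(\mathcal K)$). Put $\mathcal Z_{\rm R}=\mathfrak h\otimes L^2(\mathbb R)=L^2(\mathbb R;\mathfrak h)$, $\mathcal Z=\mathcal K\otimes\Gamma_{\rm s}(\mathcal Z_{\rm R})$, where $\Gamma_{\rm s}(\mathcal Z_{\rm R})=\bigoplus_{n\ge0}\otimes_{\rm s}^n\mathcal Z_{\rm R}$ is the bosonic Fock space with vacuum $\Omega$, and let $I_{\mathcal K}:\mathcal K\to\mathcal Z$, $I_{\mathcal K}\psi=\psi\otimes\Omega$. Let $Z_{\rm R}$ be the operator of multiplication by the variable $x$ on $\mathcal Z_{\rm R}$, and let $\mathcal D$ be the tensor product of $\mathcal K$ with the algebraic bosonic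 Fock space over $L^2(\mathbb R;\mathfrak h)\cap L^1(\mathbb R;\mathfrak h)$. For $s\in\mathbb R$ and $b\in\mathfrak h$ let $a(e^{isZ_{\rm R}}b\otimes|1))$ be the annihilation operator of the functional $f\mapsto\int e^{-isx}(b|f(x))\,dx$, i.e. $\sqrt n$ times the contraction of the first tensor factor with this functional on the $n$-particle sector, and let $a^*(e^{isZ_{\rm R}}b\otimes|1))$ be its adjoint in the sense of sesquilinear forms. For an orthonormal basis $(b_j)$ of $\mathfrak h$ write $\nu=\sum_j\nu_j\otimes|b_j)$, $\nu_j^+=\nu_j$, $\nu_j^-=\nu_j^*$. For $t\ge0$ let $U_t$ be the sesquilinear form on $\mathcal D$ \[ U_t=e^{-it\,d\Gamma(Z_{\rm R})}\sum_{n=0}^\infty\ \int\limits_{t\ge t_n\ge\dots\ge t_1\ge0}dt_n\cdots dt_1\,(2\pi)^{-n/2}\sum_{j_1,\dots,j_n}\sum_{\epsilon_1,\dots,\epsilon_n\in\{+,-\}}(-i)^n e^{-i(t-t_n)\Upsilon}\nu_{j_n}^{\epsilon_n}e^{-i(t_n-t_{n-1})\Upsilon}\cdots\nu_{j_1}^{\epsilon_1}e^{-it_1\Upsilon}\prod_{k:\epsilon_k=+}a^*(e^{it_kZ_{\rm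 R}}b_{j_k}\otimes|1))\prod_{k:\epsilon_k=-}a(e^{it_kZ_{\rm R}}b_{j_k}\otimes|1)), \] and let $U_{-t}=U_t^*$. Then all sums and integrals defining $U_t$ converge absolutely, and $(U_t)_{t\in\mathbb R}$ extends to a strongly continuous unitary group on $\mathcal Z$, denoted by the same symbol and independent of the choice of the basis $(b_j)$, such that for all $t\ge0$ and $A\in B(\mathcal K)$ \[I_{\mathcal K}^*U_tI_{\mathcal K}=e^{-it\Upsilon},\qquad I_{\mathcal K}^*U_t\,(A\otimes1)\,U_{-t}I_{\mathcal K}=e^{tM}(A).\] Thus $U_t$ is a unitary dilation of the contraction semigroup $e^{-it\Upsilon}$, and $U_t\,\cdot\,U_t^*$ is a dilation of $e^{tM}$. -/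

import Mathlib

open MeasureTheory UniformSpace
open scoped TensorProduct InnerProductSpace ENNReal

noncomputable section

namespace Langevin

section TensorPowers

/-- The algebraic tensor power `V ⊗ ⋯ ⊗ V` (`n` factors). This is a copy of Mathlib's tensor
power, on which the Hilbert space norm (and not the projective one) is installed below. -/
def TPow (V : Type*) [AddCommGroup V] [Module ℂ V] (n : ℕ) : Type _ := ⨂[ℂ]^n V

variable {V W : Type*} [AddCommGroup V] [Module ℂ V] [AddCommGroup W] [Module ℂ W]

instance (n : ℕ) : AddCommGroup (TPow V n) := inferInstanceAs (AddCommGroup (⨂[ℂ]^n V))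

instance (n : ℕ) : Module ℂ (TPow V n) := inferInstanceAs (Module ℂ (⨂[ℂ]^n V))

namespace TPow

/-- The tensor `v₁ ⊗ ⋯ ⊗ vₙ`. -/
def tprod (n : ℕ) : MultilinearMap ℂ (fun _ : Fin n => V) (TPow V n) :=
  (PiTensorProduct.tprod ℂ : MultilinearMap ℂ (fun _ : Fin n => V) (⨂[ℂ]^n V))

/-- The linear map on the tensor power given by a multilinear map. -/
def lift {n : ℕ} (φ : MultilinearMap ℂ (fun _ : Fin n => V) W) : TPow V n →ₗ[ℂ] W :=
  (PiTensorProduct.lift φ : (⨂[ℂ]^n V) →ₗ[ℂ] W)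

@[simp]
theorem lift_tprod {n : ℕ} (φ : MultilinearMap ℂ (fun _ : Fin n => V) W) (v : Fin n → V) :
    lift φ (tprod n v) = φ v :=
  PiTensorProduct.lift.tprod v

theorem ext {n : ℕ} {φ ψ : TPow V n →ₗ[ℂ] W} (h : ∀ v, φ (tprod n v) = ψ (tprod n v)) : φ = ψ :=
  PiTensorProduct.ext (R := ℂ) (s := fun _ : Fin n => V) (MultilinearMap.ext h)

/-- The map `q ⊗ ⋯ ⊗ q`. -/
def map (q : V →ₗ[ℂ] W) (n : ℕ) : TPow V n →ₗ[ℂ] TPow W n :=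
  lift ((tprod n).compLinearMap fun _ => q)

/-- Permutation of the tensor factors. -/
def perm {n : ℕ} (σ : Equiv.Perm (Fin n)) : TPow V n →ₗ[ℂ] TPow V n :=
  lift ((tprod n).domDomCongr σ)

/-- The contraction `ℓ ⊗ 1 ⊗ ⋯ ⊗ 1` of the first tensor factor with a linear functional. -/
def contract (ℓ : V →ₗ[ℂ] ℂ) (n : ℕ) : TPow V (n + 1) →ₗ[ℂ] TPow V n :=
  lift (LinearMap.uncurryLeft (ℓ.smulRight (tprod n)))

@[simp]
theorem map_tprod (q : V →ₗ[ℂ] W) (n : ℕ) (v : Fin n → V) :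
    map q n (tprod n v) = tprod n (fun i => q (v i)) := by
  simp [map]

@[simp]
theorem perm_tprod {n : ℕ} (σ : Equiv.Perm (Fin n)) (v : Fin n → V) :
    perm σ (tprod n v) = tprod n (fun i => v (σ i)) := by
  simp [perm]

@[simp]
theorem contract_tprod (ℓ : V →ₗ[ℂ] ℂ) (n : ℕ) (v : Fin (n + 1) → V) :
    contract ℓ n (tprod (n + 1) v) = ℓ (v 0) • tprod n (fun i => v i.succ) := by
  simp only [contract, lift_tprod, LinearMap.uncurryLeft_apply]
  rfl

theorem perm_comp_map {n : ℕ} (q : V →ₗ[ℂ] W) (σ : Equiv.Perm (Fin n)) :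
    perm σ ∘ₗ map q n = map q n ∘ₗ perm σ :=
  ext fun v => by simp

theorem perm_comp_contract (ℓ : V →ₗ[ℂ] ℂ) (n : ℕ) (σ : Equiv.Perm (Fin n)) :
    perm σ ∘ₗ contract ℓ n = contract ℓ n ∘ₗ perm (Equiv.Perm.decomposeFin.symm (0, σ)) :=
  ext fun v => by simp

end TPow

/-- The algebraic symmetric tensor power `⊗ₛⁿ V`: the tensors that are fixed by all permutations
of the factors. -/
def SymTensor (V : Type*) [AddCommGroup V] [Module ℂ V] (n : ℕ) : Submodule ℂ (TPow V n) where
  carrier := {x | ∀ σ : Equiv.Perm (Fin n), TPow.perm σ x = x}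
  add_mem' hx hy σ := (map_add _ _ _).trans (by rw [hx σ, hy σ])
  zero_mem' σ := map_zero _
  smul_mem' c x hx σ := (map_smul _ c x).trans (by rw [hx σ])

/-- The map `q ⊗ ⋯ ⊗ q` on symmetric tensors. -/
def SymTensor.map (q : V →ₗ[ℂ] W) (n : ℕ) : SymTensor V n →ₗ[ℂ] SymTensor W n :=
  (TPow.map q n).restrict fun x hx σ =>
    (LinearMap.congr_fun (TPow.perm_comp_map q σ) x).trans (congrArg (TPow.map q n) (hx σ))

/-- The contraction `ℓ ⊗ 1 ⊗ ⋯ ⊗ 1` on symmetric tensors. -/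
def SymTensor.contract (ℓ : V →ₗ[ℂ] ℂ) (n : ℕ) : SymTensor V (n + 1) →ₗ[ℂ] SymTensor V n :=
  (TPow.contract ℓ n).restrict fun x hx σ =>
    (LinearMap.congr_fun (TPow.perm_comp_contract ℓ n σ) x).trans
      (congrArg (TPow.contract ℓ n) (hx _))

end TensorPowers

section TensorInner

/-- The inner product pulled back along an injective linear map. -/
@[reducible]
def coreComap {E F : Type*} [AddCommGroup E] [Module ℂ E] [NormedAddCommGroup F]
    [InnerProductSpace ℂ F] (f : E →ₗ[ℂ] F) (hf : Function.Injective f) :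
    InnerProductSpace.Core ℂ E where
  inner x y := inner ℂ (f x) (f y)
  conj_inner_symm x y := inner_conj_symm _ _
  re_inner_nonneg x := inner_self_nonneg
  add_left x y z := by simp
  smul_left x y r := by simp [mul_comm]
  definite x hx := hf ((inner_self_eq_zero.mp hx).trans (map_zero f).symm)

variable (H : Type*) [NormedAddCommGroup H] [InnerProductSpace ℂ H]

/-- Splitting off the last tensor factor. -/
def splitLast (n : ℕ) : TPow H (n + 1) ≃ₗ[ℂ] TPow H n ⊗[ℂ] H :=
  TensorPower.mulEquiv.symm.trans
    (TensorProduct.congr (LinearEquiv.refl ℂ (⨂[ℂ]^n H))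
      (PiTensorProduct.subsingletonEquiv (0 : Fin 1)))

theorem splitLast_tprod (n : ℕ) (f : Fin (n + 1) → H) :
    splitLast H n (TPow.tprod (n + 1) f) =
      TPow.tprod n (fun i => f i.castSucc) ⊗ₜ[ℂ] f (Fin.last n) := by
  have h := TensorPower.tprod_mul_tprod (R := ℂ) (M := H) (na := n) (nb := 1)
    (fun i => f i.castSucc) (fun _ => f (Fin.last n))
  have h2 : Fin.append (fun i : Fin n => f i.castSucc) (fun _ : Fin 1 => f (Fin.last n)) = f := by
    ext i
    refine Fin.lastCases ?_ (fun i => ?_) i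
    · exact Fin.append_right (fun i : Fin n => f i.castSucc) (fun _ : Fin 1 => f (Fin.last n)) 0
    · exact Fin.append_left (fun i : Fin n => f i.castSucc) (fun _ : Fin 1 => f (Fin.last n)) i
  rw [h2, TensorPower.gMul_def] at h
  have key : ∀ x : (⨂[ℂ]^n H) ⊗[ℂ] (⨂[ℂ]^1 H), splitLast H n (TensorPower.mulEquiv x) =
      TensorProduct.congr (LinearEquiv.refl ℂ (⨂[ℂ]^n H))
        (PiTensorProduct.subsingletonEquiv (0 : Fin 1)) x := fun x =>
    congrArg _ (LinearEquiv.symm_apply_apply TensorPower.mulEquiv x)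
  refine (congrArg (splitLast H n) h.symm).trans ((key _).trans ?_)
  rw [TensorProduct.congr_tmul, PiTensorProduct.subsingletonEquiv_apply_tprod]
  rfl

/-- The inner product of the tensor power, `⟪f₁ ⊗ ⋯ ⊗ fₙ, g₁ ⊗ ⋯ ⊗ gₙ⟫ = ∏ᵢ ⟪fᵢ, gᵢ⟫`
(see `TPow.inner_tprod`). -/
@[reducible]
def tensorCore : (n : ℕ) → InnerProductSpace.Core ℂ (TPow H n)
  | 0 => coreComap (F := ℂ) (E := TPow H 0)
      (PiTensorProduct.isEmptyEquiv (R := ℂ) (s := fun _ : Fin 0 => H) (Fin 0)).toLinearMap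
      (PiTensorProduct.isEmptyEquiv (Fin 0)).injective
  | n + 1 =>
    letI : NormedAddCommGroup (TPow H n) := (tensorCore n).toNormedAddCommGroup
    letI : InnerProductSpace ℂ (TPow H n) := InnerProductSpace.ofCore (tensorCore n).toCore
    coreComap (splitLast H n).toLinearMap (splitLast H n).injective

instance (n : ℕ) : NormedAddCommGroup (TPow H n) := (tensorCore H n).toNormedAddCommGroup

instance (n : ℕ) : InnerProductSpace ℂ (TPow H n) := InnerProductSpace.ofCore (tensorCore H n).toCore

theorem TPow.inner_tprod (n : ℕ) (f g : Fin n → H) :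
    inner ℂ (TPow.tprod n f) (TPow.tprod n g) = ∏ i, inner ℂ (f i) (g i) := by
  induction n with
  | zero =>
    have : inner ℂ (TPow.tprod 0 f) (TPow.tprod 0 g) =
      inner ℂ (PiTensorProduct.isEmptyEquiv (R := ℂ) (s := fun _ : Fin 0 => H) (Fin 0)
        (PiTensorProduct.tprod ℂ f)) (PiTensorProduct.isEmptyEquiv (R := ℂ)
        (s := fun _ : Fin 0 => H) (Fin 0) (PiTensorProduct.tprod ℂ g)) := rfl
    rw [this]
    simp
  | succ n ih =>
    rw [Fin.prod_univ_castSucc, ← ih]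
    have : inner ℂ (TPow.tprod (n + 1) f) (TPow.tprod (n + 1) g) =
      inner ℂ (splitLast H n (TPow.tprod (n + 1) f)) (splitLast H n (TPow.tprod (n + 1) g)) := rfl
    rw [this, splitLast_tprod, splitLast_tprod, TensorProduct.inner_tmul]

end TensorInner

section Fock

/-- The Hilbert space tensor product of two (pre-)Hilbert spaces. -/
abbrev HTensor (E F : Type*) [NormedAddCommGroup E] [InnerProductSpace ℂ E]
    [NormedAddCommGroup F] [InnerProductSpace ℂ F] : Type _ :=
  Completion (E ⊗[ℂ] F)

section HTensor

variable {E F : Type*} [NormedAddCommGroup E] [InnerProductSpace ℂ E]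
  [NormedAddCommGroup F] [InnerProductSpace ℂ F]

/-- The map `e ↦ e ⊗ f`, that is, `1 ⊗ |f)`. -/
def tmulRight (f : F) : E →L[ℂ] HTensor E F :=
  Completion.toComplL ∘L (TensorProduct.mkL ℂ E F).flip f

/-- The operator `A ⊗ 1`. -/
def tensorOne (A : E →L[ℂ] E) : HTensor E F →L[ℂ] HTensor E F :=
  (A.rTensor F).completion

end HTensor

/-- The bosonic Fock space `Γₛ(H)`: the Hilbert space direct sum of the Hilbert space symmetric
tensor powers of `H`. -/
def Fock (H : Type*) [NormedAddCommGroup H] [InnerProductSpace ℂ H] : Type _ :=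
  lp (fun n : ℕ => Completion (SymTensor H n)) 2

instance (H : Type*) [NormedAddCommGroup H] [InnerProductSpace ℂ H] :
    NormedAddCommGroup (Fock H) :=
  inferInstanceAs (NormedAddCommGroup (lp (fun n : ℕ => Completion (SymTensor H n)) 2))

instance (H : Type*) [NormedAddCommGroup H] [InnerProductSpace ℂ H] :
    InnerProductSpace ℂ (Fock H) :=
  inferInstanceAs (InnerProductSpace ℂ (lp (fun n : ℕ => Completion (SymTensor H n)) 2))

instance (H : Type*) [NormedAddCommGroup H] [InnerProductSpace ℂ H] : CompleteSpace (Fock H) :=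
  inferInstanceAs (CompleteSpace (lp (fun n : ℕ => Completion (SymTensor H n)) 2))

/-- The algebraic bosonic Fock space over a vector space `V`: the algebraic direct sum of the
algebraic symmetric tensor powers of `V`. -/
abbrev AlgFock (V : Type*) [AddCommGroup V] [Module ℂ V] : Type _ :=
  DirectSum ℕ fun n => SymTensor V n

variable {V W : Type*} [AddCommGroup V] [Module ℂ V] [AddCommGroup W] [Module ℂ W]

/-- The second quantization `Γ(q)`, equal to `q ⊗ ⋯ ⊗ q` on the `n`-particle sector. -/
def secondQuant (q : V →ₗ[ℂ] W) : AlgFock V →ₗ[ℂ] AlgFock W :=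
  DirectSum.toModule ℂ ℕ _ fun n => DirectSum.lof ℂ ℕ (fun n => SymTensor W n) n ∘ₗ
    SymTensor.map q n

/-- The annihilation operator of a linear functional `ℓ`, which is
`√n ℓ ⊗ 1 ⊗ ⋯ ⊗ 1` on the `n`-particle sector. For `ℓ = (z|` this is the operator `a(z)`. -/
def annih (ℓ : V →ₗ[ℂ] ℂ) : AlgFock V →ₗ[ℂ] AlgFock V :=
  DirectSum.toModule ℂ ℕ _ fun n => match n with
    | 0 => 0
    | n + 1 => ((Real.sqrt (n + 1 : ℝ) : ℝ) : ℂ) •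
        (DirectSum.lof ℂ ℕ (fun n => SymTensor V n) n ∘ₗ SymTensor.contract ℓ n)

/-- The inclusion of the `n`-particle sector into the Fock space. -/
def Fock.sector (H : Type*) [NormedAddCommGroup H] [InnerProductSpace ℂ H] (n : ℕ) :
    Completion (SymTensor H n) →ₗ[ℂ] Fock H :=
  lp.lsingle (𝕜 := ℂ) (E := fun n : ℕ => Completion (SymTensor H n)) 2 n

/-- The vacuum vector `Ω = 1 ∈ ⊗ₛ⁰ H = ℂ`. -/
def vacuum (H : Type*) [NormedAddCommGroup H] [InnerProductSpace ℂ H] : Fock H :=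
  Fock.sector H 0 ((⟨TPow.tprod 0 Fin.elim0, fun σ => by
    rw [TPow.perm_tprod, Subsingleton.elim (fun i => Fin.elim0 (σ i)) Fin.elim0]⟩ : SymTensor H 0) :
    Completion (SymTensor H 0))

/-- The canonical map from the algebraic Fock space over `H` to the Fock space. -/
def algFockToFock (H : Type*) [NormedAddCommGroup H] [InnerProductSpace ℂ H] :
    AlgFock H →ₗ[ℂ] Fock H :=
  DirectSum.toModule ℂ ℕ _ fun n =>
    Fock.sector H n ∘ₗ
      (Completion.toComplₗᵢ (𝕜 := ℂ) (E := SymTensor H n)).toLinearMap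

end Fock

section Reservoir

variable (h : Type*) [NormedAddCommGroup h] [InnerProductSpace ℂ h]

/-- The one-particle space `h ⊗ L²(ℝ)`, realized as the space `L²(ℝ; h)` of square integrable
functions with values in `h`. -/
abbrev OneParticle : Type _ := Lp h 2 (volume : Measure ℝ)

/-- The elements of `L²(ℝ; h)` that are integrable, i.e. `L²(ℝ; h) ∩ L¹(ℝ; h)`. -/
def intDomain : Submodule ℂ (OneParticle h) where
  carrier := {f | Integrable f volume}
  add_mem' {f g} hf hg := (hf.add hg).congr (Lp.coeFn_add f g).symm
  zero_mem' := (integrable_zero ℝ h volume).congr (Lp.coeFn_zero h 2 volume).symm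
  smul_mem' c f hf := (Integrable.smul c hf).congr (Lp.coeFn_smul c f).symm

variable {h}

theorem continuous_phase (t : ℝ) :
    Continuous fun x : ℝ => Complex.exp (Complex.I * t * x) := by fun_prop

theorem norm_phase (t x : ℝ) : ‖Complex.exp (Complex.I * t * x)‖ = 1 := by
  rw [Complex.norm_exp]; simp

theorem memLp_phase (t : ℝ) (f : OneParticle h) :
    MemLp (fun x : ℝ => Complex.exp (Complex.I * t * x) • f x) 2 volume :=
  (Lp.memLp f).of_le ((continuous_phase t).aestronglyMeasurable.smul (Lp.aestronglyMeasurable f))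
    (Filter.Eventually.of_forall fun x => by rw [norm_smul, norm_phase, one_mul])

/-- Multiplication by `x ↦ exp (i t x)`, that is the operator `exp (i t Z_R)`, restricted to the
integrable functions. -/
def phase (t : ℝ) : intDomain h →ₗ[ℂ] intDomain h where
  toFun f := ⟨(memLp_phase t f.1).toLp, by
    have hf : Integrable f.1 volume := f.2
    refine Integrable.congr ?_ (memLp_phase t f.1).coeFn_toLp.symm
    exact hf.mono ((continuous_phase t).aestronglyMeasurable.smul hf.aestronglyMeasurable)
      (Filter.Eventually.of_forall fun x => by rw [norm_smul, norm_phase, one_mul])⟩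
  map_add' f g := by
    ext1
    refine Lp.ext ?_
    filter_upwards [(memLp_phase t (f + g).1).coeFn_toLp, (memLp_phase t f.1).coeFn_toLp,
      (memLp_phase t g.1).coeFn_toLp, Lp.coeFn_add f.1 g.1,
      Lp.coeFn_add (memLp_phase t f.1).toLp (memLp_phase t g.1).toLp] with x h1 h2 h3 h4 h5
    refine h1.trans (Eq.trans ?_ h5.symm)
    rw [Pi.add_apply, h2, h3, ← smul_add]
    exact congrArg _ h4
  map_smul' c f := by
    ext1
    refine Lp.ext ?_
    filter_upwards [(memLp_phase t (c • f).1).coeFn_toLp, (memLp_phase t f.1).coeFn_toLp,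
      Lp.coeFn_smul c f.1, Lp.coeFn_smul c (memLp_phase t f.1).toLp] with x h1 h2 h4 h5
    refine h1.trans (Eq.trans ?_ h5.symm)
    rw [Pi.smul_apply, h2, smul_comm c]
    exact congrArg _ h4

/-- The functional `(b ⊗ 1| : f ↦ ∫ (b | f(x)) dx`. -/
def braOne (b : h) : intDomain h →ₗ[ℂ] ℂ where
  toFun f := ∫ x, inner ℂ b (f.1 x)
  map_add' f g := by
    have hf : Integrable f.1 volume := f.2
    have hg : Integrable g.1 volume := g.2
    rw [← integral_add (hf.const_inner b) (hg.const_inner b)]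
    refine integral_congr_ae ?_
    filter_upwards [Lp.coeFn_add f.1 g.1] with x hx
    rw [← inner_add_right]
    exact congrArg _ hx
  map_smul' c f := by
    rw [RingHom.id_apply, smul_eq_mul, ← integral_const_mul]
    refine integral_congr_ae ?_
    filter_upwards [Lp.coeFn_smul c f.1] with x hx
    rw [← inner_smul_right]
    exact congrArg _ hx

/-- The functional `(exp (i s Z_R) b ⊗ 1| = (b ⊗ 1| exp (-i s Z_R)`. -/
def noiseBra (s : ℝ) (b : h) : intDomain h →ₗ[ℂ] ℂ := braOne b ∘ₗ phase (-s)

end Reservoir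

section Dyson

variable {K h : Type*} [NormedAddCommGroup K] [InnerProductSpace ℂ K]
  [NormedAddCommGroup h] [InnerProductSpace ℂ h]

/-- The enlarged space `K ⊗ Γₛ(h ⊗ L²(ℝ))`. -/
abbrev BigSpace (K h : Type*) [NormedAddCommGroup K] [InnerProductSpace ℂ K]
    [NormedAddCommGroup h] [InnerProductSpace ℂ h] : Type _ :=
  HTensor K (Fock (OneParticle h))

/-- The domain of the forms: the tensor product of `K` and of the algebraic Fock space over
`L²(ℝ; h) ∩ L¹(ℝ; h)`. -/
abbrev FormDomain (K h : Type*) [NormedAddCommGroup K] [InnerProductSpace ℂ K]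
    [NormedAddCommGroup h] [InnerProductSpace ℂ h] : Type _ :=
  K ⊗[ℂ] AlgFock (intDomain h)

/-- The inclusion of the form domain into `K ⊗ Γₛ(h ⊗ L²(ℝ))`. -/
def embed : FormDomain K h →ₗ[ℂ] BigSpace K h :=
  (Completion.toComplₗᵢ (𝕜 := ℂ) (E := K ⊗[ℂ] Fock (OneParticle h))).toLinearMap ∘ₗ
    TensorProduct.map LinearMap.id
      (algFockToFock (OneParticle h) ∘ₗ secondQuant (intDomain h).subtype)

/-- The embedding `I_K : K ≃ K ⊗ Ω → K ⊗ Γₛ(h ⊗ L²(ℝ))`. -/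
def vacuumEmbedding (K h : Type*) [NormedAddCommGroup K] [InnerProductSpace ℂ K]
    [NormedAddCommGroup h] [InnerProductSpace ℂ h] : K →L[ℂ] BigSpace K h :=
  tmulRight (vacuum (OneParticle h))

/-- The contraction semigroup `exp (-i t Υ)`. -/
def contrSemigroup (Υ : K →L[ℂ] K) (t : ℝ) : K →L[ℂ] K :=
  NormedSpace.exp ((-(Complex.I * t)) • Υ)

/-- `exp (-i (t - tₙ) Υ) Vₙ exp (-i (tₙ - tₙ₋₁) Υ) ⋯ V₁ exp (-i t₁ Υ)`; the times `t₁, …, tₙ` are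
`s 0, …, s (n - 1)` and likewise for the operators. -/
def dysonOp (Υ : K →L[ℂ] K) :
    (n : ℕ) → (Fin n → (K →L[ℂ] K)) → (Fin n → ℝ) → ℝ → (K →L[ℂ] K)
  | 0, _, _, t => contrSemigroup Υ t
  | n + 1, V, s, t =>
    contrSemigroup Υ (t - s (Fin.last n)) ∘L V (Fin.last n) ∘L
      dysonOp Υ n (fun k => V k.castSucc) (fun k => s k.castSucc) (s (Fin.last n))

/-- The simplex `t ≥ tₙ ≥ ⋯ ≥ t₁ ≥ 0`. -/
def timeSimplex (n : ℕ) (t : ℝ) : Set (Fin n → ℝ) :=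
  {s | Monotone s ∧ ∀ k, 0 ≤ s k ∧ s k ≤ t}

variable [CompleteSpace K] {ι : Type*}

/-- The component `ν_j` of `ν = ∑ ν_j ⊗ |b_j)`, i.e. `ν_j = (1 ⊗ (b_j|) ν`. -/
def component (ν : K →L[ℂ] HTensor K h) (b : h) : K →L[ℂ] K :=
  (ContinuousLinearMap.adjoint (tmulRight b : K →L[ℂ] HTensor K h)) ∘L ν

/-- `ν_j^ε`: `ν_j` for `ε = true` (the sign `+`), `ν_j^*` for `ε = false` (the sign `-`). -/
def signedComponent (ν : K →L[ℂ] HTensor K h) (b : h) (ε : Bool) : K →L[ℂ] K :=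
  if ε then component ν b else ContinuousLinearMap.adjoint (component ν b)

/-- The product of the annihilation operators `a(exp (i t_k Z_R) b_{j_k} ⊗ |1))` over all `k` with
`ε_k = ε₀`. (On the symmetric tensors these operators commute.) -/
def annihProd {n : ℕ} (s : Fin n → ℝ) (b : Fin n → h) (ε : Fin n → Bool) (ε₀ : Bool) :
    AlgFock (intDomain h) →ₗ[ℂ] AlgFock (intDomain h) :=
  ((List.finRange n).map fun k =>
    if ε k = ε₀ then (annih (noiseBra (s k) (b k)) : Module.End ℂ (AlgFock (intDomain h)))
    else 1).prod

/-- The summand of the Dyson series with times `s`, basis vectors `b` and signs summed over. The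
creation operators and the factor `exp (-i t dΓ(Z_R)) = Γ(exp (-i t Z_R))` act, in the sense of
forms, as their adjoints on the left vector. -/
def dysonTerm (Υ : K →L[ℂ] K) (ν : K →L[ℂ] HTensor K h) (t : ℝ) {n : ℕ} (s : Fin n → ℝ)
    (b : Fin n → h) (Φ Ψ : FormDomain K h) : ℂ :=
  ∑ ε : Fin n → Bool, (((2 * Real.pi) ^ (-(n : ℝ) / 2) : ℝ) : ℂ) * (-Complex.I) ^ n *
    inner ℂ
      (embed (TensorProduct.map LinearMap.id (annihProd s b ε true ∘ₗ secondQuant (phase t)) Φ))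
      (embed (TensorProduct.map
        (dysonOp Υ n (fun k => signedComponent ν (b k) (ε k)) s t).toLinearMap
        (annihProd s b ε false) Ψ))

/-- The integrand of the `n`-th term of the Dyson series. -/
def dysonIntegrand (Υ : K →L[ℂ] K) (ν : K →L[ℂ] HTensor K h) (b : HilbertBasis ι ℂ h) (t : ℝ)
    (n : ℕ) (Φ Ψ : FormDomain K h) (s : Fin n → ℝ) : ℂ :=
  ∑' j : Fin n → ι, dysonTerm Υ ν t s (fun k => b (j k)) Φ Ψ

/-- The `n`-th term of the Dyson series. -/
def dysonCoeff (Υ : K →L[ℂ] K) (ν : K →L[ℂ] HTensor K h) (b : HilbertBasis ι ℂ h) (t : ℝ)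
    (Φ Ψ : FormDomain K h) (n : ℕ) : ℂ :=
  ∫ s in timeSimplex n t, dysonIntegrand Υ ν b t n Φ Ψ s

/-- The form `U_t` for `t ≥ 0`: the sum of the Dyson series. -/
def dysonForm (Υ : K →L[ℂ] K) (ν : K →L[ℂ] HTensor K h) (b : HilbertBasis ι ℂ h) (t : ℝ)
    (Φ Ψ : FormDomain K h) : ℂ :=
  ∑' n : ℕ, dysonCoeff Υ ν b t Φ Ψ n

/-- All sums and integrals in the Dyson series converge absolutely. -/
def DysonConverges (Υ : K →L[ℂ] K) (ν : K →L[ℂ] HTensor K h) (b : HilbertBasis ι ℂ h) (t : ℝ)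
    (Φ Ψ : FormDomain K h) : Prop :=
  (∀ n, ∀ s ∈ timeSimplex n t,
    Summable fun j : Fin n → ι => dysonTerm Υ ν t s (fun k => b (j k)) Φ Ψ) ∧
  (∀ n, IntegrableOn (dysonIntegrand Υ ν b t n Φ Ψ) (timeSimplex n t)) ∧
  Summable (dysonCoeff Υ ν b t Φ Ψ)

/-- The form `U_t` for all real `t`, with `U_{-t} = U_t^*`. -/
def langevinForm (Υ : K →L[ℂ] K) (ν : K →L[ℂ] HTensor K h) (b : HilbertBasis ι ℂ h) (t : ℝ)
    (Φ Ψ : FormDomain K h) : ℂ :=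
  if 0 ≤ t then dysonForm Υ ν b t Φ Ψ else starRingEnd ℂ (dysonForm Υ ν b (-t) Ψ Φ)

end Dyson

end Langevin

end

open Langevin

/-! After the Fourier transform in `x` (the time representation), multiplication by `exp (-i t x)`
becomes translation by `t`, and the functional of the noise at time `s` becomes `√(2π)` times
evaluation at `s` (`timeFn_phase`, `inner_timeFn`). In the interaction picture the Dyson series is
then the normally ordered solution of the quantum stochastic differential equation `dV = (G dt + ∑
M_i dA_i^* - ∑ M_i^* dA_i) V` with `G = -iΥ` and `M_i = -iν_i`. As `K` is finite dimensional, only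
finitely many orthonormal directions `β_i` of `h` occur in `ν`. Between exponential vectors `e(f)`
and `e(g)` the solution must have the kernel `exp ⟪f, g⟫ P`, where `P` is the propagator on `K` of
the ordinary linear equation with generator `G - ∑ ⟪β_i, g⟫ M_i^* + ∑ ⟪f, β_i⟫ M_i` (`gen`, `prop`).

That these kernels belong to a unitary is shown with an Euler scheme in which the creation operator
on a short interval `I` is replaced by the difference `e(g + β_i 1_I) - e(g)`. The Gram matrices of
the scheme are computed exactly as products of one-step maps, and the first-order part of these maps
annihilates `1` because `G + G^* + ∑ M_i^* M_i = 0`, which is the hypothesis on `Υ` and `ν`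
(`gramMapLin_one`, `tendsto_gram`). The matrix elements of the scheme converge to the kernels, so it
has weak limits; its inner product with the weak limit tends to the full squared norm
(`mixed_euler`), so the limit is strong and defines an isometry (`exists_eulerLimit`). The scheme
with coefficients `(G^*, -M)` on the reversed grid gives an isometry with the adjoint kernels, so
both are unitary (`exists_isEvolution`). Since the kernels are local in time, the evolutions compose
(`IsEvolution.inner_comp`), and together with the translations they form a strongly continuous
unitary group (`exists_unitaryGroup`).

The compression to the vacuum is read off the kernel at `f = g = 0` (`vacuum_compression`). For the
dilation of `exp (t M)`, the operator `A` is inserted into the Gram matrix of the dual scheme at the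
vacuum; the one-step maps are then `1 + |I| M` up to second order (`tendsto_gram_zero`,
`dilation_of_tendsto`).

For the form, replace `f, g` by `x f, y g` and compare coefficients of `x^m y^k`. Those of the
propagator are sums of time-ordered integrals, finite because each vertex lowers one of the two
particle numbers, and the sums over the basis are Parseval sums; so they are exactly the Dyson
series between the powers of `f` and `g` (`hasTotal_normPow`, `inner_embed_normPow`). By
polarization such powers span the form domain. The group is built before a basis is chosen, whence
the independence of it. -/

noncomputable section

namespace Langevin

open Filter Topology

set_option linter.unusedSectionVars false

/-! ### Total families, isometries and weak limits in Hilbert spaces -/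

section Abstract

variable {X Z Z' : Type*} [NormedAddCommGroup Z] [InnerProductSpace ℂ Z]
  [NormedAddCommGroup Z'] [InnerProductSpace ℂ Z']

/-- A family is total if its span is dense. -/
def IsTotal (v : X → Z) : Prop := Dense (Submodule.span ℂ (Set.range v) : Set Z)

theorem IsTotal.ext_inner {v : X → Z} (hv : IsTotal v) {x y : Z}
    (h : ∀ i, inner ℂ (v i) x = inner ℂ (v i) y) : x = y := by
  refine ext_inner_left ℂ fun z => ?_
  refine hv.induction ?_ (P := fun z => inner ℂ z x = inner ℂ z y) ?_ z
  · intro z hz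
    induction hz using Submodule.span_induction with
    | mem z hz => obtain ⟨i, rfl⟩ := hz; exact h i
    | zero => simp
    | add a b _ _ ha hb => rw [inner_add_left, inner_add_left, ha, hb]
    | smul c a _ ha => rw [inner_smul_left, inner_smul_left, ha]
  · exact isClosed_eq (by fun_prop) (by fun_prop)

theorem IsTotal.ext_clm {v : X → Z} (hv : IsTotal v) {S T : Z →L[ℂ] Z'}
    (h : ∀ i, S (v i) = T (v i)) : S = T := by
  refine ContinuousLinearMap.ext fun z => ?_
  refine hv.induction ?_ (P := fun z => S z = T z) ?_ z
  · intro z hz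
    induction hz using Submodule.span_induction with
    | mem z hz => obtain ⟨i, rfl⟩ := hz; exact h i
    | zero => simp
    | add a b _ _ ha hb => rw [map_add, map_add, ha, hb]
    | smul c a _ ha => rw [map_smul, map_smul, ha]
  · exact isClosed_eq (by fun_prop) (by fun_prop)

theorem IsTotal.of_orthogonal [CompleteSpace Z] {v : X → Z}
    (h : ∀ z : Z, (∀ i, inner ℂ (v i) z = 0) → z = 0) : IsTotal v := by
  rw [IsTotal, Submodule.dense_iff_topologicalClosure_eq_top,
    Submodule.topologicalClosure_eq_top_iff, Submodule.eq_bot_iff]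
  intro z hz
  exact h z fun i => hz _ (Submodule.subset_span ⟨i, rfl⟩)

/-- A family with the same Gram matrix as a total family is its image under an isometry. -/
theorem IsTotal.exists_isometry [CompleteSpace Z'] {v : X → Z} (hv : IsTotal v) {w : X → Z'}
    (h : ∀ i j, inner ℂ (w i) (w j) = inner ℂ (v i) (v j)) :
    ∃ V : Z →ₗᵢ[ℂ] Z', ∀ i, V (v i) = w i := by
  set e := Finsupp.linearCombination ℂ v with he
  set f := Finsupp.linearCombination ℂ w with hf
  -- The Gram matrix determines the norm of every formal linear combination, so sending combinations
  -- of `v` to those of `w` is well defined and isometric.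
  have hin : ∀ c, ‖f c‖ = ‖e c‖ := by
    intro c
    have : inner ℂ (f c) (f c) = inner ℂ (e c) (e c) := by
      simp only [he, hf, Finsupp.linearCombination_apply, Finsupp.sum, sum_inner, inner_sum,
        inner_smul_left, inner_smul_right, h]
    rw [inner_self_eq_norm_sq_to_K, inner_self_eq_norm_sq_to_K] at this
    have h2 : ‖f c‖ ^ 2 = ‖e c‖ ^ 2 := by exact_mod_cast this
    exact (sq_eq_sq₀ (norm_nonneg _) (norm_nonneg _)).mp h2
  have hd : DenseRange e := by
    have : (LinearMap.range e : Set Z) = Submodule.span ℂ (Set.range v) := by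
      rw [he, Finsupp.range_linearCombination]
    rw [DenseRange, ← LinearMap.coe_range, this]
    exact hv
  have hb : ∃ C : ℝ, ∀ c, ‖f c‖ ≤ C * ‖e c‖ := ⟨1, fun c => by rw [hin, one_mul]⟩
  set V := f.extendOfNorm e
  have hV : ∀ c, V (e c) = f c := fun c => LinearMap.extendOfNorm_eq hd hb c
  refine ⟨⟨V.toLinearMap, fun z => ?_⟩, fun i => ?_⟩
  · refine hd.induction_on (p := fun z => ‖V z‖ = ‖z‖) z ?_ fun c => ?_
    · exact isClosed_eq (by fun_prop) (by fun_prop)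
    · rw [hV, hin]
  · have := hV (Finsupp.single i 1)
    simpa [he, hf] using this

/-- A bounded sequence that converges weakly on a total family has a weak limit. -/
theorem IsTotal.exists_weak_limit [CompleteSpace Z] {v : X → Z} (hv : IsTotal v) {y : ℕ → Z} {B : ℝ}
    (hB : ∀ n, ‖y n‖ ≤ B) (h : ∀ i, ∃ c, Tendsto (fun n => inner ℂ (v i) (y n)) atTop (𝓝 c)) :
    ∃ w : Z, ∀ z, Tendsto (fun n => inner ℂ z (y n)) atTop (𝓝 (inner ℂ z w)) := by
  have hB0 : 0 ≤ B := (norm_nonneg _).trans (hB 0)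
  have key : ∀ z, CauchySeq fun n => inner ℂ z (y n) := by
    intro z
    have hspan : ∀ z ∈ Submodule.span ℂ (Set.range v),
        ∃ c, Tendsto (fun n => inner ℂ z (y n)) atTop (𝓝 c) := by
      intro z hz
      induction hz using Submodule.span_induction with
      | mem z hz => obtain ⟨i, rfl⟩ := hz; exact h i
      | zero => exact ⟨0, by simp⟩
      | add a b _ _ ha hb =>
        obtain ⟨c, hc⟩ := ha
        obtain ⟨d, hd⟩ := hb
        exact ⟨c + d, by simpa only [inner_add_left] using hc.add hd⟩
      | smul r a _ ha =>
        obtain ⟨c, hc⟩ := ha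
        exact ⟨_, by simpa only [inner_smul_left] using hc.const_mul _⟩
    -- On the span there is convergence; the uniform bound carries the Cauchy property to the
    -- closure. The constant uses `B + 1` because `B` may be zero.
    rw [Metric.cauchySeq_iff]
    intro ε hε
    obtain ⟨z', hz', hzz⟩ := Metric.dense_iff.mp hv z (ε / (4 * (B + 1))) (by positivity)
    obtain ⟨c, hc⟩ := hspan z' hzz
    obtain ⟨N, hN⟩ := Metric.cauchySeq_iff.mp hc.cauchySeq (ε / 2) (by positivity)
    refine ⟨N, fun m hm n hn => ?_⟩
    have h1 := hN m hm n hn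
    have h2 : ∀ n, ‖inner ℂ (z - z') (y n)‖ ≤ ε / 4 := by
      intro n
      have h3 : ‖z - z'‖ ≤ ε / (4 * (B + 1)) := by
        rw [← dist_eq_norm, dist_comm]
        exact (Metric.mem_ball.mp hz').le
      calc _ ≤ ‖z - z'‖ * ‖y n‖ := norm_inner_le_norm _ _
        _ ≤ ε / (4 * (B + 1)) * (B + 1) := by
          gcongr
          exact (hB n).trans (by linarith)
        _ = ε / 4 := by field_simp
    rw [dist_eq_norm] at h1 ⊢
    have : inner ℂ z (y m) - inner ℂ z (y n) =
        (inner ℂ z' (y m) - inner ℂ z' (y n)) + inner ℂ (z - z') (y m)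
          - inner ℂ (z - z') (y n) := by
      simp only [inner_sub_left]; ring
    rw [this]
    calc _ ≤ ‖inner ℂ z' (y m) - inner ℂ z' (y n)‖ + ‖inner ℂ (z - z') (y m)‖
          + ‖inner ℂ (z - z') (y n)‖ :=
            (norm_sub_le _ _).trans (add_le_add_left (norm_add_le _ _) _)
      _ < ε := by linarith [h2 m, h2 n]
  choose c hc using fun z => cauchySeq_tendsto_of_complete (key z)
  have hlim : Tendsto (fun n z => innerSL ℂ (y n) z) atTop
      (𝓝 fun z => starRingEnd ℂ (c z)) := by
    rw [tendsto_pi_nhds]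
    intro z
    have := (Complex.continuous_conj.tendsto _).comp (hc z)
    refine this.congr fun n => ?_
    simp [inner_conj_symm]
  -- The pointwise limit of the bounded functionals is bounded by Banach–Steinhaus, and its Riesz
  -- vector is the weak limit.
  refine ⟨(InnerProductSpace.toDual ℂ Z).symm (continuousLinearMapOfTendsto _ hlim), fun z => ?_⟩
  have h1 : inner ℂ ((InnerProductSpace.toDual ℂ Z).symm (continuousLinearMapOfTendsto _ hlim)) z
      = starRingEnd ℂ (c z) := by
    rw [InnerProductSpace.toDual_symm_apply]
    rfl
  rw [← inner_conj_symm, h1, Complex.conj_conj]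
  exact hc z

/-- A sequence with weak limit of no smaller norm converges in norm. -/
theorem tendsto_of_weak {y : ℕ → Z} {w : Z} {B : ℝ}
    (hB : Tendsto (fun n => ‖y n‖) atTop (𝓝 B))
    (h : ∀ z, Tendsto (fun n => inner ℂ z (y n)) atTop (𝓝 (inner ℂ z w)))
    (h' : Tendsto (fun n => inner ℂ (y n) w) atTop (𝓝 ((B ^ 2 : ℝ) : ℂ))) :
    Tendsto y atTop (𝓝 w) := by
  -- Testing the weak convergence on `w` itself shows that no norm is lost in the limit.
  have h1 : inner ℂ w w = ((B ^ 2 : ℝ) : ℂ) := by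
    refine tendsto_nhds_unique ?_ h'
    have := (Complex.continuous_conj.tendsto _).comp (h w)
    rw [inner_conj_symm] at this
    refine this.congr fun n => ?_
    simp [inner_conj_symm]
  have h2 : ‖w‖ ^ 2 = B ^ 2 := by
    have := congrArg Complex.re h1
    rw [Complex.ofReal_re] at this
    rw [← this, ← inner_self_eq_norm_sq (𝕜 := ℂ)]
    rfl
  rw [tendsto_iff_norm_sub_tendsto_zero]
  have h3 : Tendsto (fun n => ‖y n - w‖ ^ 2) atTop (𝓝 0) := by
    have : ∀ n, ‖y n - w‖ ^ 2 = ‖y n‖ ^ 2 - 2 * (inner ℂ (y n) w).re + B ^ 2 := by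
      intro n
      rw [norm_sub_sq (𝕜 := ℂ), h2]
      rfl
    simp_rw [this]
    have h4 := (((hB.pow 2).sub (((Complex.continuous_re.tendsto _).comp h').const_mul 2)).add_const
      (B ^ 2))
    refine h4.trans_eq ?_
    congr 1
    rw [Complex.ofReal_re]
    ring
  have := h3.sqrt
  simpa using this

end Abstract

/-! ### Uniqueness of the coefficients of power series in one and two variables -/

section PowerSeries

/-- A power series that vanishes near zero has vanishing coefficients. -/
theorem powerSeries_coeff_eq_zero {c : ℕ → ℂ} {ρ : ℝ} (hρ : 0 < ρ)
    (h : ∀ x : ℝ, 0 < x → x < ρ → HasSum (fun n => (x : ℂ) ^ n * c n) 0) : c = 0 := by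
  set p : FormalMultilinearSeries ℝ ℝ ℂ := fun n => ContinuousMultilinearMap.mkPiRing ℝ (Fin n) (c n)
  have hp : ∀ n, ‖p n‖ = ‖c n‖ := fun n => ContinuousMultilinearMap.norm_mkPiRing _
  have hs : Summable fun n => ‖p n‖ * ((ρ / 2).toNNReal : ℝ) ^ n := by
    have := (h (ρ / 2) (by positivity) (by linarith)).summable.norm
    refine this.congr fun n => ?_
    rw [hp, norm_mul, norm_pow, Complex.norm_real, Real.norm_eq_abs, abs_of_pos (by positivity),
      Real.coe_toNNReal _ (by positivity), mul_comm]
  have hr := p.le_radius_of_summable_norm hs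
  have hball := p.hasFPowerSeriesOnBall (lt_of_lt_of_le (by simpa using hρ) hr)
  have hzero : ∀ᶠ x in 𝓝[>] (0 : ℝ), p.sum x = 0 := by
    filter_upwards [Ioo_mem_nhdsGT hρ] with x hx
    rw [FormalMultilinearSeries.sum]
    have := (h x hx.1 hx.2).tsum_eq
    rw [← this]
    refine tsum_congr fun n => ?_
    simp [p]
  have hz2 : ∀ᶠ x in 𝓝 (0 : ℝ), p.sum x = 0 := by
    -- Zeros of an analytic function that is not locally zero are isolated, so vanishing to the
    -- right of zero suffices.
    rcases hball.analyticAt.eventually_eq_zero_or_eventually_ne_zero with h0 | h0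
    · exact h0
    · exfalso
      have h1 : ∀ᶠ x in 𝓝[>] (0 : ℝ), p.sum x ≠ 0 :=
        h0.filter_mono (nhdsWithin_mono _ fun x hx => ne_of_gt hx)
      obtain ⟨x, hx, hx'⟩ := (hzero.and h1).exists
      exact hx' hx
  have : p = 0 := (hball.hasFPowerSeriesAt.congr hz2).eq_zero
  funext n
  have h1 := hp n
  rw [this] at h1
  simpa using h1.symm

/-- For fixed `y` the coefficients of the powers of `x` are themselves power series in `y`, and the
case of one variable applies twice. -/
theorem doublePowerSeries_coeff_eq_zero {c : ℕ × ℕ → ℂ} {ρ : ℝ} (hρ : 0 < ρ)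
    (h : ∀ x y : ℝ, 0 < x → x < ρ → 0 < y → y < ρ →
      HasSum (fun p : ℕ × ℕ => (x : ℂ) ^ p.1 * (y : ℂ) ^ p.2 * c p) 0) : c = 0 := by
  have key : ∀ y : ℝ, 0 < y → y < ρ → ∀ m, HasSum (fun n => (y : ℂ) ^ n * c (m, n)) 0 := by
    intro y hy hy'
    -- Each row converges because the double series does at `x = ρ / 2`, and the nonzero factor `(ρ
    -- / 2) ^ m` can be divided out.
    have hs : ∀ m, Summable fun n => (y : ℂ) ^ n * c (m, n) := by
      intro m
      have h1 := (h (ρ / 2) y (by positivity) (by linarith) hy hy').summable.prod_factor m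
      have h2 := h1.mul_left (((ρ / 2 : ℝ) : ℂ) ^ m)⁻¹
      refine h2.congr fun n => ?_
      have : (((ρ / 2 : ℝ) : ℂ) ^ m) ≠ 0 := pow_ne_zero _ (by exact_mod_cast (by positivity))
      rw [mul_assoc, inv_mul_cancel_left₀ this]
    have h0 := powerSeries_coeff_eq_zero (c := fun m => ∑' n, (y : ℂ) ^ n * c (m, n)) hρ
      (fun x hx hx' => by
        refine (h x y hx hx' hy hy').prod_fiberwise fun m => ?_
        simp_rw [mul_assoc]
        exact (hs m).hasSum.mul_left _)
    intro m
    have := congrFun h0 m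
    simp only [Pi.zero_apply] at this
    rw [← this]
    exact (hs m).hasSum
  funext p
  exact congrFun (powerSeries_coeff_eq_zero (c := fun n => c (p.1, n)) hρ
    fun y hy hy' => key y hy hy' p.1) p.2

end PowerSeries

/-! ### Stability of long products of operators close to one -/

section Products

variable {α 𝔸 : Type*} [NormedRing 𝔸]

theorem norm_prod_list_le (h1 : ‖(1 : 𝔸)‖ ≤ 1) {R : ℝ} (l : List α) (a : α → 𝔸)
    (ha : ∀ i ∈ l, ‖a i‖ ≤ R) : ‖(l.map a).prod‖ ≤ R ^ l.length := by
  induction l with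
  | nil => simpa using h1
  | cons i l ih =>
    rw [List.map_cons, List.prod_cons, List.length_cons, pow_succ']
    exact (norm_mul_le _ _).trans (mul_le_mul (ha i (by simp))
      (ih fun j hj => ha j (by simp [hj])) (norm_nonneg _)
      ((norm_nonneg _).trans (ha i (by simp))))

/-- Telescoping. For `N` factors with `R = 1 + O(1/N)` and `η = O(1/N²)` the bound tends to zero, so
only the first-order part of each factor matters. -/
theorem norm_prod_sub_prod_le (h1 : ‖(1 : 𝔸)‖ ≤ 1) {R η : ℝ} (hR : 1 ≤ R) (l : List α)
    (a b : α → 𝔸) (ha : ∀ i ∈ l, ‖a i‖ ≤ R) (hb : ∀ i ∈ l, ‖b i‖ ≤ R)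
    (hab : ∀ i ∈ l, ‖a i - b i‖ ≤ η) :
    ‖(l.map a).prod - (l.map b).prod‖ ≤ l.length * R ^ l.length * η := by
  induction l with
  | nil => simp
  | cons i l ih =>
    have hη : 0 ≤ η := (norm_nonneg _).trans (hab i (by simp))
    have ih := ih (fun j hj => ha j (by simp [hj])) (fun j hj => hb j (by simp [hj]))
      (fun j hj => hab j (by simp [hj]))
    have hR0 : 0 ≤ R := by linarith
    rw [List.map_cons, List.prod_cons, List.map_cons, List.prod_cons, List.length_cons]
    have : a i * (l.map a).prod - b i * (l.map b).prod =
      a i * ((l.map a).prod - (l.map b).prod) + (a i - b i) * (l.map b).prod := by noncomm_ring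
    rw [this]
    calc _ ≤ ‖a i‖ * ‖(l.map a).prod - (l.map b).prod‖ + ‖a i - b i‖ * ‖(l.map b).prod‖ :=
          (norm_add_le _ _).trans (add_le_add (norm_mul_le _ _) (norm_mul_le _ _))
      _ ≤ R * (l.length * R ^ l.length * η) + η * R ^ l.length := by
          gcongr
          · exact ha i (by simp)
          · exact hab i (by simp)
          · exact norm_prod_list_le h1 l b fun j hj => hb j (by simp [hj])
      _ ≤ R * (l.length * R ^ l.length * η) + R * (η * R ^ l.length) := by
          refine add_le_add le_rfl ?_
          exact le_mul_of_one_le_left (mul_nonneg hη (pow_nonneg hR0 _)) hR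
      _ = _ := by push_cast; ring

/-- Telescoping again, but the factors need to be second-order close to the identity only on the one
vector `x`. In the applications `x` is the operator `1`. -/
theorem norm_prod_apply_sub_le {E : Type*} [NormedAddCommGroup E] [NormedSpace ℂ E] {R η : ℝ}
    (hR : 1 ≤ R) (l : List α) (Λ : α → E →L[ℂ] E) (x : E) (hΛ : ∀ i ∈ l, ‖Λ i‖ ≤ R)
    (hx : ∀ i ∈ l, ‖Λ i x - x‖ ≤ η) :
    ‖(l.map Λ).prod x - x‖ ≤ l.length * R ^ l.length * η := by
  induction l with
  | nil => simp
  | cons i l ih =>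
    have hη : 0 ≤ η := (norm_nonneg _).trans (hx i (by simp))
    have ih := ih (fun j hj => hΛ j (by simp [hj])) (fun j hj => hx j (by simp [hj]))
    have hR0 : 0 ≤ R := by linarith
    rw [List.map_cons, List.prod_cons, List.length_cons, mul_apply_eq_comp]
    have : Λ i ((l.map Λ).prod x) - x = Λ i ((l.map Λ).prod x - x) + (Λ i x - x) := by
      rw [map_sub]; abel
    rw [this]
    calc _ ≤ R * (l.length * R ^ l.length * η) + η := by
          refine (norm_add_le _ _).trans (add_le_add ?_ (hx i (by simp)))
          refine ((Λ i).le_opNorm _).trans ?_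
          gcongr
          exact hΛ i (by simp)
      _ ≤ R * (l.length * R ^ l.length * η) + R ^ (l.length + 1) * η := by
          gcongr
          exact le_mul_of_one_le_left hη (one_le_pow₀ hR)
      _ = _ := by push_cast; ring

/-- The accumulated error of an Euler scheme tends to zero. -/
theorem tendsto_euler_error (C C' : ℝ) (hC : 0 ≤ C) :
    Tendsto (fun N : ℕ => (N : ℝ) * (1 + C / N) ^ N * (C' / N ^ 2)) atTop (𝓝 0) := by
  have h1 : Tendsto (fun N : ℕ => Real.exp C * |C'| * (1 / (N : ℝ))) atTop (𝓝 0) := by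
    simpa using (tendsto_one_div_atTop_nhds_zero_nat (𝕜 := ℝ)).const_mul (Real.exp C * |C'|)
  refine squeeze_zero_norm' ?_ h1
  filter_upwards [eventually_gt_atTop 0] with N hN
  have hN' : (0 : ℝ) < N := by exact_mod_cast hN
  have h2 : (1 + C / N) ^ N ≤ Real.exp C := by
    calc (1 + C / N) ^ N ≤ (Real.exp (C / N)) ^ N := by
          gcongr
          linarith [Real.add_one_le_exp (C / N)]
      _ = Real.exp C := by rw [← Real.exp_nat_mul]; congr 1; field_simp
  have h3 : (0 : ℝ) ≤ (1 + C / N) ^ N := by positivity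
  rw [norm_mul, norm_mul, norm_div, Real.norm_eq_abs, Real.norm_eq_abs, Real.norm_eq_abs,
    Real.norm_eq_abs, abs_of_pos hN', abs_of_nonneg h3, abs_of_nonneg (by positivity : (0:ℝ) ≤ (N:ℝ) ^ 2)]
  calc _ ≤ (N : ℝ) * Real.exp C * (|C'| / N ^ 2) := by gcongr
    _ = _ := by field_simp

end Products

/-! ### Propagators of linear equations with bounded measurable generators -/

section Propagator

open intervalIntegral Set

variable {𝔸 : Type*} [NormedRing 𝔸] [NormedAlgebra ℂ 𝔸] [CompleteSpace 𝔸]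

/-- Bounded measurable generators. -/
structure IsGenerator (E : ℝ → 𝔸) (C : ℝ) : Prop where
  meas : AEStronglyMeasurable E volume
  bound : ∀ s, ‖E s‖ ≤ C

variable {E : ℝ → 𝔸} {C : ℝ}

theorem IsGenerator.nonneg (hE : IsGenerator E C) : 0 ≤ C := (norm_nonneg _).trans (hE.bound 0)

theorem IsGenerator.intervalIntegrable (hE : IsGenerator E C) (a b : ℝ) :
    IntervalIntegrable E volume a b :=
  (intervalIntegrable_const (c := C)).mono_fun hE.meas.restrict
    (Eventually.of_forall fun s => by
      rw [Real.norm_of_nonneg hE.nonneg]; exact hE.bound s)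

theorem IsGenerator.intervalIntegrable_mul (hE : IsGenerator E C) {a b : ℝ} {Y : ℝ → 𝔸}
    (hY : ContinuousOn Y (uIcc a b)) : IntervalIntegrable (fun r => E r * Y r) volume a b :=
  (hE.intervalIntegrable a b).mul_continuousOn hY

/-- The iterated integrals of the Picard series. -/
def picard (E : ℝ → 𝔸) (s : ℝ) : ℕ → ℝ → 𝔸
  | 0, _ => 1
  | n + 1, t => ∫ r in s..t, E r * picard E s n r

/-- The propagator of the linear equation `X' = E X`. -/
def prop (E : ℝ → 𝔸) (s t : ℝ) : 𝔸 := ∑' n, picard E s n t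

theorem continuous_picard (hE : IsGenerator E C) (s : ℝ) (n : ℕ) : Continuous (picard E s n) := by
  induction n with
  | zero => exact continuous_const
  | succ n ih =>
    exact continuous_primitive (fun a b => hE.intervalIntegrable_mul ih.continuousOn) s

theorem norm_picard_le (hE : IsGenerator E C) (s : ℝ) (n : ℕ) {t : ℝ} (ht : s ≤ t) :
    ‖picard E s n t‖ ≤ ‖(1 : 𝔸)‖ * ((C * (t - s)) ^ n / n.factorial) := by
  induction n generalizing t with
  | zero => simp [picard]
  | succ n ih =>
    have hC := hE.nonneg
    rw [picard]
    have h1 : ‖∫ r in s..t, E r * picard E s n r‖ ≤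
        ∫ r in s..t, C * (‖(1 : 𝔸)‖ * ((C * (r - s)) ^ n / n.factorial)) := by
      refine norm_integral_le_of_norm_le ht (Eventually.of_forall fun r hr => ?_)
        (Continuous.intervalIntegrable (by fun_prop) _ _)
      exact (norm_mul_le _ _).trans (mul_le_mul (hE.bound r) (ih hr.1.le) (norm_nonneg _) hC)
    refine h1.trans (le_of_eq ?_)
    have h2 : ∀ r, C * (‖(1 : 𝔸)‖ * ((C * (r - s)) ^ n / n.factorial)) =
        (‖(1 : 𝔸)‖ * C ^ (n + 1) / n.factorial) * (r - s) ^ n := by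
      intro r; rw [mul_pow]; ring
    simp_rw [h2]
    rw [intervalIntegral.integral_const_mul, integral_comp_sub_right (fun r => r ^ n), integral_pow, sub_self,
      Nat.factorial_succ, mul_pow]
    push_cast
    rw [zero_pow (by simp), sub_zero]
    field_simp

theorem summable_picard (hE : IsGenerator E C) {s t : ℝ} (ht : s ≤ t) :
    Summable fun n => picard E s n t :=
  Summable.of_norm_bounded ((Real.summable_pow_div_factorial _).mul_left _)
    fun n => norm_picard_le hE s n ht

theorem continuousOn_prop (hE : IsGenerator E C) (s t : ℝ) :
    ContinuousOn (prop E s) (Icc s t) := by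
  refine continuousOn_tsum (fun n => (continuous_picard hE s n).continuousOn)
    ((Real.summable_pow_div_factorial (C * (t - s))).mul_left ‖(1 : 𝔸)‖) fun n r hr => ?_
  refine (norm_picard_le hE s n hr.1).trans ?_
  have := hE.nonneg
  have h1 : 0 ≤ r - s := by linarith [hr.1]
  have h2 := hr.2
  gcongr

theorem norm_prop_le (h1 : ‖(1 : 𝔸)‖ ≤ 1) (hE : IsGenerator E C) {s t : ℝ} (ht : s ≤ t) :
    ‖prop E s t‖ ≤ Real.exp (C * (t - s)) := by
  have h := Real.summable_pow_div_factorial (C * (t - s))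
  rw [Real.exp_eq_exp_ℝ, NormedSpace.exp_eq_tsum_div]
  refine tsum_of_norm_bounded h.hasSum fun n => (norm_picard_le hE s n ht).trans ?_
  refine mul_le_of_le_one_left ?_ h1
  have := hE.nonneg
  have h1 : 0 ≤ t - s := by linarith
  positivity

theorem prop_eq (hE : IsGenerator E C) {s t : ℝ} (ht : s ≤ t) :
    prop E s t = 1 + ∫ r in s..t, E r * prop E s r := by
  rw [prop, (summable_picard hE ht).tsum_eq_zero_add]
  congr 1
  have hC := hE.nonneg
  symm
  have := hasSum_integral_of_dominated_convergence (μ := volume) (a := s) (b := t)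
    (F := fun n r => E r * picard E s n r) (f := fun r => E r * prop E s r)
    (fun n _ => C * (‖(1 : 𝔸)‖ * ((C * (t - s)) ^ n / n.factorial)))
    (fun n => (hE.meas.mul (continuous_picard hE s n).aestronglyMeasurable).restrict)
    (fun n => Eventually.of_forall fun r hr => ?_)
    (Eventually.of_forall fun r hr => ((Real.summable_pow_div_factorial _).mul_left _).mul_left _)
    intervalIntegrable_const
    (Eventually.of_forall fun r hr => ?_)
  · exact this.tsum_eq.symm
  · rw [uIoc_of_le ht] at hr
    refine (norm_mul_le _ _).trans (mul_le_mul (hE.bound r) ?_ (norm_nonneg _) hC)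
    refine (norm_picard_le hE s n hr.1.le).trans ?_
    have h1 : 0 ≤ r - s := by linarith [hr.1]
    have h2 := hr.2
    gcongr
  · rw [uIoc_of_le ht] at hr
    exact (summable_picard hE hr.1.le).hasSum.mul_left _

/-- Iterating the equation `n` times bounds `W t` by a multiple of `(C (t - s)) ^ n / n!`. -/
theorem volterra_eq_zero (hE : IsGenerator E C) {s T : ℝ} {W : ℝ → 𝔸}
    (hW : ContinuousOn W (Icc s T))
    (h : ∀ t ∈ Icc s T, W t = ∫ r in s..t, E r * W r) : ∀ t ∈ Icc s T, W t = 0 := by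
  obtain ⟨B, hB⟩ := isCompact_Icc.exists_bound_of_continuousOn hW
  have hC := hE.nonneg
  have key : ∀ n : ℕ, ∀ t ∈ Icc s T, ‖W t‖ ≤ B * ((C * (t - s)) ^ n / n.factorial) := by
    intro n
    induction n with
    | zero => intro t ht; simpa using hB t ht
    | succ n ih =>
      intro t ht
      rw [h t ht]
      have h1 : ‖∫ r in s..t, E r * W r‖ ≤
          ∫ r in s..t, C * (B * ((C * (r - s)) ^ n / n.factorial)) := by
        refine norm_integral_le_of_norm_le ht.1 (Eventually.of_forall fun r hr => ?_)
          (Continuous.intervalIntegrable (by fun_prop) _ _)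
        exact (norm_mul_le _ _).trans (mul_le_mul (hE.bound r)
          (ih r ⟨hr.1.le, hr.2.trans ht.2⟩) (norm_nonneg _) hC)
      refine h1.trans (le_of_eq ?_)
      have h2 : ∀ r, C * (B * ((C * (r - s)) ^ n / n.factorial)) =
          (B * C ^ (n + 1) / n.factorial) * (r - s) ^ n := by
        intro r; rw [mul_pow]; ring
      simp_rw [h2]
      rw [intervalIntegral.integral_const_mul, integral_comp_sub_right (fun r => r ^ n), integral_pow, sub_self,
        Nat.factorial_succ, mul_pow]
      push_cast
      rw [zero_pow (by simp), sub_zero]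
      field_simp
  intro t ht
  have h0 : Tendsto (fun n : ℕ => B * ((C * (t - s)) ^ n / n.factorial)) atTop (𝓝 0) := by
    simpa using (FloorSemiring.tendsto_pow_div_factorial_atTop (C * (t - s))).const_mul B
  exact norm_le_zero_iff.mp (ge_of_tendsto' h0 fun n => key n t ht)

/-- Uniqueness of solutions of the integral equation. -/
theorem eq_prop_mul (hE : IsGenerator E C) {s T : ℝ} {Y : ℝ → 𝔸} {c : 𝔸}
    (hY : ContinuousOn Y (Icc s T))
    (h : ∀ t ∈ Icc s T, Y t = c + ∫ r in s..t, E r * Y r) :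
    ∀ t ∈ Icc s T, Y t = prop E s t * c := by
  have hp := continuousOn_prop hE s T
  have key := volterra_eq_zero hE (W := fun t => Y t - prop E s t * c)
    (hY.sub (hp.mul continuousOn_const)) (s := s) (T := T) ?_
  · intro t ht
    exact sub_eq_zero.mp (key t ht)
  · intro t ht
    have hsub : uIcc s t ⊆ Icc s T := by
      rw [uIcc_of_le ht.1]; exact Icc_subset_Icc_right ht.2
    have i1 := hE.intervalIntegrable_mul (hY.mono hsub)
    have i2 := hE.intervalIntegrable_mul (hp.mono hsub)
    have hcm : ∫ r in s..t, E r * prop E s r * c = (∫ r in s..t, E r * prop E s r) * c :=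
      ContinuousLinearMap.intervalIntegral_comp_comm ((ContinuousLinearMap.mul ℂ 𝔸).flip c) i2
    simp_rw [mul_sub, ← mul_assoc]
    rw [integral_sub i1 (i2.mul_const c), hcm, h t ht, prop_eq hE ht.1]
    noncomm_ring

theorem prop_self (hE : IsGenerator E C) (s : ℝ) : prop E s s = 1 := by
  rw [prop_eq hE le_rfl]; simp

theorem prop_mul_prop (hE : IsGenerator E C) {s t u : ℝ} (hst : s ≤ t) (htu : t ≤ u) :
    prop E t u * prop E s t = prop E s u := by
  symm
  refine eq_prop_mul hE (s := t) (T := u) (Y := prop E s) ?_ ?_ u ⟨htu, le_rfl⟩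
  · exact (continuousOn_prop hE s u).mono (Icc_subset_Icc_left hst)
  · intro r hr
    have h1 : ∀ a b, s ≤ a → a ≤ b → IntervalIntegrable (fun r => E r * prop E s r) volume a b := by
      intro a b ha hab
      refine hE.intervalIntegrable_mul ((continuousOn_prop hE s b).mono ?_)
      rw [uIcc_of_le hab]
      exact Icc_subset_Icc_left ha
    rw [prop_eq hE (hst.trans hr.1), prop_eq hE hst, add_assoc,
      integral_add_adjacent_intervals (h1 s t le_rfl hst) (h1 t r hst hr.1)]

/-- The integral equation sees the generator only on the interval. This is the source of the
locality of the kernels: changing an exponential vector elsewhere in time has no effect. -/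
theorem prop_congr {E' : ℝ → 𝔸} (hE : IsGenerator E C) {C' : ℝ} (hE' : IsGenerator E' C') {s t : ℝ}
    (hst : s ≤ t) (h : ∀ r ∈ Ioc s t, E r = E' r) : prop E s t = prop E' s t := by
  have := eq_prop_mul hE (s := s) (T := t) (Y := prop E' s) (c := 1) (continuousOn_prop hE' s t)
    (fun r hr => ?_) t ⟨hst, le_rfl⟩
  · rw [this, mul_one]
  · rw [prop_eq hE' hr.1]
    congr 1
    refine integral_congr_ae (Eventually.of_forall fun x hx => ?_)
    rw [uIoc_of_le hr.1] at hx
    rw [h x ⟨hx.1, hx.2.trans hr.2⟩]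

theorem IsGenerator.shift (hE : IsGenerator E C) (u : ℝ) : IsGenerator (fun r => E (r + u)) C :=
  ⟨hE.meas.comp_measurePreserving (measurePreserving_add_right volume u), fun _ => hE.bound _⟩

theorem prop_shift (hE : IsGenerator E C) {s t : ℝ} (hst : s ≤ t) (u : ℝ) :
    prop (fun r => E (r + u)) s t = prop E (s + u) (t + u) := by
  have := eq_prop_mul (hE.shift u) (s := s) (T := t) (Y := fun r => prop E (s + u) (r + u)) (c := 1)
    ((continuousOn_prop hE (s + u) (t + u)).comp (by fun_prop)
      fun r hr => ⟨by linarith [hr.1], by linarith [hr.2]⟩)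
    (fun r hr => ?_) t ⟨hst, le_rfl⟩
  · rw [this, mul_one]
  · rw [prop_eq hE (by linarith [hr.1]),
      integral_comp_add_right (fun x => E x * prop E (s + u) x)]

theorem prop_const (G : 𝔸) {s t : ℝ} (hst : s ≤ t) :
    prop (fun _ => G) s t = NormedSpace.exp (((t - s : ℝ) : ℂ) • G) := by
  have hd : ∀ r : ℝ, HasDerivAt (fun r : ℝ => NormedSpace.exp (((r - s : ℝ) : ℂ) • G))
      (G * NormedSpace.exp (((r - s : ℝ) : ℂ) • G)) r := by
    intro r
    have h1 := hasDerivAt_exp_smul_const' (𝕂 := ℂ) G (((r - s : ℝ) : ℂ))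
    have h2 : HasDerivAt (fun r : ℝ => ((r - s : ℝ) : ℂ)) 1 r := by
      simpa using ((hasDerivAt_id r).sub_const s).ofReal_comp
    have := h1.scomp r h2
    rw [one_smul] at this
    exact this
  have hc : Continuous fun r : ℝ => NormedSpace.exp (((r - s : ℝ) : ℂ) • G) :=
    continuous_iff_continuousAt.mpr fun r => (hd r).continuousAt
  have hG : IsGenerator (fun _ : ℝ => G) ‖G‖ := ⟨aestronglyMeasurable_const, fun _ => le_rfl⟩
  have := eq_prop_mul hG (s := s) (T := t)
    (Y := fun r => NormedSpace.exp (((r - s : ℝ) : ℂ) • G)) (c := 1) hc.continuousOn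
    (fun r hr => ?_) t ⟨hst, le_rfl⟩
  · rw [this, mul_one]
  · rw [integral_eq_sub_of_hasDerivAt (fun x _ => hd x)
      ((continuous_const.mul hc).intervalIntegrable _ _)]
    simp

theorem norm_prop_sub_le (h1 : ‖(1 : 𝔸)‖ ≤ 1) (hE : IsGenerator E C) {s t : ℝ} (hst : s ≤ t) :
    ‖prop E s t - 1‖ ≤ C * Real.exp (C * (t - s)) * (t - s) := by
  have hC := hE.nonneg
  rw [prop_eq hE hst, add_sub_cancel_left]
  have := norm_integral_le_of_norm_le_const (a := s) (b := t)
    (f := fun r => E r * prop E s r) (C := C * Real.exp (C * (t - s))) ?_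
  · rwa [abs_of_nonneg (by linarith)] at this
  · intro r hr
    rw [uIoc_of_le hst] at hr
    refine (norm_mul_le _ _).trans (mul_le_mul (hE.bound r) ?_ (norm_nonneg _) hC)
    refine (norm_prop_le h1 hE hr.1.le).trans ?_
    have := hr.2
    gcongr

/-- The error is the integral of `E r * (prop E s r - 1)`, whose second factor is already of first
order. It yields the consistency of the Euler scheme with the propagator. -/
theorem norm_prop_sub_sub_le (h1 : ‖(1 : 𝔸)‖ ≤ 1) (hE : IsGenerator E C) {s t : ℝ} (hst : s ≤ t) :
    ‖prop E s t - (1 + ∫ r in s..t, E r)‖ ≤ C ^ 2 * Real.exp (C * (t - s)) * (t - s) ^ 2 := by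
  have hC := hE.nonneg
  have hcont : ContinuousOn (prop E s) (uIcc s t) := by
    rw [uIcc_of_le hst]; exact continuousOn_prop hE s t
  have h2 : prop E s t - (1 + ∫ r in s..t, E r) = ∫ r in s..t, E r * (prop E s r - 1) := by
    simp_rw [mul_sub, mul_one]
    rw [integral_sub (hE.intervalIntegrable_mul hcont) (hE.intervalIntegrable s t), prop_eq hE hst]
    abel
  rw [h2]
  have := norm_integral_le_of_norm_le_const (a := s) (b := t)
    (f := fun r => E r * (prop E s r - 1))
    (C := C * (C * Real.exp (C * (t - s)) * (t - s))) ?_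
  · rw [abs_of_nonneg (by linarith)] at this
    refine this.trans (le_of_eq (by ring))
  · intro r hr
    rw [uIoc_of_le hst] at hr
    refine (norm_mul_le _ _).trans (mul_le_mul (hE.bound r) ?_ (norm_nonneg _) hC)
    refine (norm_prop_sub_le h1 hE hr.1.le).trans ?_
    have := hr.2
    have h3 : 0 ≤ r - s := by linarith [hr.1]
    gcongr

end Propagator

/-! ### Polarization of symmetric tensors -/

section Polarization

variable {V : Type*} [AddCommGroup V] [Module ℂ V]

/-- The symmetric tensor `f ⊗ ⋯ ⊗ f`. -/
def SymTensor.pow (f : V) (n : ℕ) : SymTensor V n :=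
  ⟨TPow.tprod n fun _ => f, fun σ => TPow.perm_tprod σ _⟩

theorem TPow.sum_perm_tprod_mem (n : ℕ) (v : Fin n → V) :
    ∑ σ : Equiv.Perm (Fin n), TPow.tprod n (fun i => v (σ i)) ∈
      Submodule.span ℂ (Set.range fun f : V => TPow.tprod n fun _ => f) := by
  classical
  -- Inclusion–exclusion: expanding the powers gives a sum over all index maps `φ`, and the
  -- alternating sum over the sets `T` that avoid the image of `φ` vanishes unless `φ` is onto.
  have key : ∑ T : Finset (Fin n), (-1 : ℤ) ^ T.card • TPow.tprod n (fun _ => ∑ i ∈ Tᶜ, v i) =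
      ∑ σ : Equiv.Perm (Fin n), TPow.tprod n (fun i => v (σ i)) := by
    have h1 : ∀ T : Finset (Fin n), TPow.tprod n (fun _ => ∑ i ∈ Tᶜ, v i) =
        ∑ φ : Fin n → Fin n, if T ⊆ (Finset.univ.image φ)ᶜ then TPow.tprod n (fun i => v (φ i))
          else 0 := by
      intro T
      have := (TPow.tprod (V := V) n).map_sum_finset (fun _ i => v i) (fun _ => Tᶜ)
      refine this.trans ?_
      rw [← Finset.sum_filter]
      refine Finset.sum_congr ?_ fun _ _ => rfl
      ext φ
      simp only [Fintype.mem_piFinset, Finset.mem_compl, Finset.mem_filter, Finset.mem_univ,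
        true_and]
      constructor
      · intro h i hi
        rw [Finset.mem_compl, Finset.mem_image]
        rintro ⟨k, -, rfl⟩
        exact h k hi
      · intro h k hk
        have := h hk
        simp at this
    simp_rw [h1, Finset.smul_sum]
    rw [Finset.sum_comm]
    have h2 : ∀ φ : Fin n → Fin n, (∑ T : Finset (Fin n), (-1 : ℤ) ^ T.card •
        if T ⊆ (Finset.univ.image φ)ᶜ then TPow.tprod n (fun i => v (φ i)) else 0) =
        if Function.Bijective φ then TPow.tprod n (fun i => v (φ i)) else 0 := by
      intro φ
      have h3 : (∑ T : Finset (Fin n), (-1 : ℤ) ^ T.card •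
        if T ⊆ (Finset.univ.image φ)ᶜ then TPow.tprod n (fun i => v (φ i)) else 0) =
        (∑ T ∈ ((Finset.univ.image φ)ᶜ).powerset, (-1 : ℤ) ^ T.card) •
          TPow.tprod n (fun i => v (φ i)) := by
        rw [Finset.sum_smul, ← Finset.sum_subset (Finset.subset_univ _)
          (f := fun T : Finset (Fin n) => (-1 : ℤ) ^ T.card •
            if T ⊆ (Finset.univ.image φ)ᶜ then TPow.tprod n (fun i => v (φ i)) else 0)]
        · refine Finset.sum_congr rfl fun T hT => ?_
          rw [if_pos (Finset.mem_powerset.mp hT)]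
        · intro T _ hT
          rw [if_neg (fun h => hT (Finset.mem_powerset.mpr h)), smul_zero]
      rw [h3, Finset.sum_powerset_neg_one_pow_card]
      have h4 : (Finset.univ.image φ)ᶜ = ∅ ↔ Function.Bijective φ := by
        rw [← Finite.surjective_iff_bijective, Finset.compl_eq_empty_iff, Finset.eq_univ_iff_forall]
        simp [Function.Surjective]
      by_cases hφ : Function.Bijective φ
      · rw [if_pos (h4.mpr hφ), if_pos hφ, one_smul]
      · rw [if_neg (fun h => hφ (h4.mp h)), if_neg hφ, zero_smul]
    simp_rw [h2]
    symm
    refine Finset.sum_of_injOn (t := Finset.univ) (s := Finset.univ) (fun σ : Equiv.Perm (Fin n) => (σ : Fin n → Fin n))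
      (fun σ _ τ _ h => DFunLike.coe_injective h) (fun _ _ => Finset.mem_coe.mpr (Finset.mem_univ _)) ?_ ?_
    · intro φ _ hφ
      rw [if_neg]
      intro hb
      exact hφ ((Set.mem_image _ _ _).mpr
        ⟨Equiv.ofBijective φ hb, Finset.mem_coe.mpr (Finset.mem_univ _), rfl⟩)
    · intro σ _
      rw [if_pos σ.bijective]
  rw [← key]
  exact Submodule.sum_mem _ fun T _ => zsmul_mem (Submodule.subset_span (Set.mem_range_self _)) _

/-- Symmetric tensors are spanned by the powers. -/
theorem SymTensor.span_pow (n : ℕ) :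
    Submodule.span ℂ (Set.range fun f : V => SymTensor.pow f n) = ⊤ := by
  rw [eq_top_iff]
  rintro x -
  have h1 : ∀ y : TPow V n, ∑ σ : Equiv.Perm (Fin n), TPow.perm σ y ∈
      Submodule.span ℂ (Set.range fun f : V => TPow.tprod n fun _ => f) := by
    intro y
    have hy : y ∈ Submodule.span ℂ (Set.range (TPow.tprod (V := V) n)) := by
      have := PiTensorProduct.span_tprod_eq_top (R := ℂ) (s := fun _ : Fin n => V)
      have h2 : Submodule.span ℂ (Set.range (TPow.tprod (V := V) n)) = ⊤ := this
      rw [h2]; trivial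
    induction hy using Submodule.span_induction with
    | mem y hy =>
      obtain ⟨v, rfl⟩ := hy
      simp only [TPow.perm_tprod]
      exact TPow.sum_perm_tprod_mem n v
    | zero => simp
    | add a b _ _ ha hb => simpa [Finset.sum_add_distrib] using add_mem ha hb
    | smul c a _ ha => simpa [Finset.smul_sum] using Submodule.smul_mem _ c ha
  have h2 : (x : TPow V n) ∈ Submodule.span ℂ (Set.range fun f : V => TPow.tprod n fun _ => f) := by
    -- A symmetric tensor is `1 / n!` times its own symmetrization.
    have h3 : ∑ σ : Equiv.Perm (Fin n), TPow.perm σ (x : TPow V n) =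
        (n.factorial : ℂ) • (x : TPow V n) := by
      rw [Finset.sum_congr rfl fun σ _ => x.2 σ, Finset.sum_const, Finset.card_univ,
        Fintype.card_perm, Fintype.card_fin, Nat.cast_smul_eq_nsmul]
    have h4 := Submodule.smul_mem _ ((n.factorial : ℂ)⁻¹) (h1 x)
    rwa [h3, inv_smul_smul₀ (by exact_mod_cast n.factorial_ne_zero)] at h4
  have h5 : (Submodule.span ℂ (Set.range fun f : V => SymTensor.pow f n)).map
      (SymTensor V n).subtype = Submodule.span ℂ (Set.range fun f : V => TPow.tprod n fun _ => f) := by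
    rw [Submodule.map_span, ← Set.range_comp]
    rfl
  rw [← h5] at h2
  obtain ⟨y, hy, hyx⟩ := h2
  have : y = x := Subtype.ext hyx
  rwa [← this]

end Polarization

/-! ### Exponential vectors in the Fock space -/

section ExpVec

variable {H : Type*} [NormedAddCommGroup H] [InnerProductSpace ℂ H]

theorem SymTensor.inner_pow (f g : H) (n : ℕ) :
    inner ℂ (SymTensor.pow f n) (SymTensor.pow g n) = (inner ℂ f g) ^ n := by
  have : inner ℂ (SymTensor.pow f n) (SymTensor.pow g n) =
    inner ℂ (TPow.tprod n fun _ => f) (TPow.tprod n fun _ => g) := rfl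
  rw [this, TPow.inner_tprod]
  simp

theorem SymTensor.norm_pow (f : H) (n : ℕ) : ‖SymTensor.pow f n‖ = ‖f‖ ^ n := by
  have h := SymTensor.inner_pow f f n
  have h' : inner ℂ (SymTensor.pow f n) (SymTensor.pow f n) = ((‖SymTensor.pow f n‖ : ℝ) : ℂ) ^ 2 :=
    inner_self_eq_norm_sq_to_K _
  rw [h', inner_self_eq_norm_sq_to_K] at h
  have h2 : ‖SymTensor.pow f n‖ ^ 2 = (‖f‖ ^ n) ^ 2 := by
    rw [← pow_mul, mul_comm n 2, pow_mul]
    exact Complex.ofReal_injective (by push_cast; exact h)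
  exact (sq_eq_sq₀ (norm_nonneg _) (by positivity)).mp h2

theorem SymTensor.pow_smul (c : ℂ) (f : H) (n : ℕ) :
    SymTensor.pow (c • f) n = c ^ n • SymTensor.pow f n := by
  refine Subtype.ext ?_
  have := (TPow.tprod (V := H) n).map_smul_univ (fun _ => c) (fun _ => f)
  simpa [SymTensor.pow] using this

/-- The components `f ⊗ ⋯ ⊗ f / √n!` of the exponential vector. -/
def expComponent (f : H) (n : ℕ) : Completion (SymTensor H n) :=
  ((((Real.sqrt n.factorial)⁻¹ : ℝ) : ℂ) • SymTensor.pow f n : SymTensor H n)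

theorem norm_expComponent (f : H) (n : ℕ) :
    ‖expComponent f n‖ = (Real.sqrt n.factorial)⁻¹ * ‖f‖ ^ n := by
  have h1 : ‖((((Real.sqrt n.factorial)⁻¹ : ℝ) : ℂ) • SymTensor.pow f n : SymTensor H n)‖ =
      ‖(((Real.sqrt n.factorial)⁻¹ : ℝ) : ℂ)‖ * ‖SymTensor.pow f n‖ :=
    norm_smul (((Real.sqrt n.factorial)⁻¹ : ℝ) : ℂ) (SymTensor.pow f n : TPow H n)
  rw [expComponent, Completion.norm_coe, h1, SymTensor.norm_pow, Complex.norm_real,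
    Real.norm_of_nonneg (by positivity)]

/-- The exponential (coherent) vector. -/
def expVec (f : H) : Fock H :=
  (⟨expComponent f, by
    refine memℓp_gen ?_
    have : ∀ n, ‖expComponent f n‖ ^ (2 : ℝ≥0∞).toReal = (‖f‖ ^ 2) ^ n / n.factorial := by
      intro n
      rw [norm_expComponent]
      simp only [ENNReal.toReal_ofNat, Real.rpow_ofNat]
      rw [mul_pow, inv_pow, Real.sq_sqrt (by positivity), ← pow_mul, ← pow_mul, mul_comm 2 n]
      field_simp
    exact (Real.summable_pow_div_factorial _).congr fun n => (this n).symm⟩ :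
    lp (fun n : ℕ => Completion (SymTensor H n)) 2)

/-- The `n`-particle sector contributes `⟪f, g⟫ ^ n / n!`. Through this formula every change of a
label becomes a scalar factor, the origin of all exponentials in the one-step maps below. -/
theorem inner_expVec (f g : H) : inner ℂ (expVec f) (expVec g) = Complex.exp (inner ℂ f g) := by
  have h1 : inner ℂ (expVec f) (expVec g) =
      ∑' n, inner ℂ (expComponent f n) (expComponent g n) := lp.inner_eq_tsum _ _
  rw [h1, Complex.exp_eq_exp_ℂ, NormedSpace.exp_eq_tsum_div]
  refine tsum_congr fun n => ?_
  have h2 : ∀ c d : ℂ, inner ℂ (c • SymTensor.pow f n) (d • SymTensor.pow g n) =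
      starRingEnd ℂ c * (d * inner ℂ (SymTensor.pow f n) (SymTensor.pow g n)) := by
    intro c d
    have : inner ℂ (c • (SymTensor.pow f n : TPow H n)) (d • (SymTensor.pow g n : TPow H n)) =
      starRingEnd ℂ c * (d * inner ℂ (SymTensor.pow f n : TPow H n) (SymTensor.pow g n : TPow H n)) := by
      rw [inner_smul_left, inner_smul_right]
    exact this
  rw [expComponent, expComponent, Completion.inner_coe, h2,
    SymTensor.inner_pow, Complex.conj_ofReal, ← mul_assoc, ← Complex.ofReal_mul, ← mul_inv,
    Real.mul_self_sqrt (by positivity)]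
  push_cast
  field_simp

/-- The distance of two exponential vectors is a continuous function of inner products of their
labels. -/
theorem continuous_expVec : Continuous (expVec : H → Fock H) := by
  rw [continuous_iff_continuousAt]
  intro g
  rw [ContinuousAt, tendsto_iff_norm_sub_tendsto_zero]
  have h1 : ∀ f : H, ‖expVec f - expVec g‖ ^ 2 = (Complex.exp (inner ℂ f f)).re
      - 2 * (Complex.exp (inner ℂ f g)).re + (Complex.exp (inner ℂ g g)).re := by
    intro f
    rw [norm_sub_sq (𝕜 := ℂ), inner_expVec, ← inner_self_eq_norm_sq (𝕜 := ℂ),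
      ← inner_self_eq_norm_sq (𝕜 := ℂ), inner_expVec, inner_expVec]
    rfl
  have h2 : Tendsto (fun f : H => ‖expVec f - expVec g‖ ^ 2) (𝓝 g) (𝓝 0) := by
    simp_rw [h1]
    have : Continuous fun f : H => (Complex.exp (inner ℂ f f)).re
      - 2 * (Complex.exp (inner ℂ f g)).re + (Complex.exp (inner ℂ g g)).re := by
      have h3 : Continuous fun f : H => inner ℂ f f := continuous_id.inner continuous_id
      have h4 : Continuous fun f : H => inner ℂ f g := continuous_id.inner continuous_const
      fun_prop
    refine (this.tendsto g).trans_eq ?_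
    ring_nf
  simpa using h2.sqrt

/-- The vector `f ⊗ ⋯ ⊗ f` of the `n`-particle sector. -/
def powVec (f : H) (n : ℕ) : Fock H :=
  Fock.sector H n ((SymTensor.pow f n : SymTensor H n) : Completion (SymTensor H n))

theorem hasSum_sector (w : Fock H) :
    HasSum (fun n => Fock.sector H n ((w.1 : ∀ n, Completion (SymTensor H n)) n)) w :=
  lp.hasSum_single (E := fun n : ℕ => Completion (SymTensor H n)) (by simp) w

theorem hasSum_expVec (x : ℂ) (f : H) :
    HasSum (fun n => (x ^ n * (((Real.sqrt n.factorial)⁻¹ : ℝ) : ℂ)) • powVec f n)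
      (expVec (x • f)) := by
  refine (hasSum_sector (expVec (x • f))).congr_fun ?_
  intro n
  have : ((expVec (x • f)).1 : ∀ n, Completion (SymTensor H n)) n =
    expComponent (x • f) n := rfl
  rw [this, powVec, ← map_smul, expComponent, SymTensor.pow_smul, smul_smul, ← Completion.coe_smul,
    mul_comm]

theorem expVec_zero : expVec (0 : H) = vacuum H := by
  have h := hasSum_expVec 0 (0 : H)
  rw [zero_smul] at h
  have h2 := hasSum_single (f := fun n => ((0 : ℂ) ^ n * (((Real.sqrt n.factorial)⁻¹ : ℝ) : ℂ)) •
    powVec (0 : H) n) 0 (fun n hn => by rw [zero_pow hn, zero_mul, zero_smul])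
  rw [h.unique h2]
  simp only [pow_zero, Nat.factorial_zero, Nat.cast_one, Real.sqrt_one, inv_one, Complex.ofReal_one,
    mul_one, one_smul]
  rw [powVec, vacuum]
  have : SymTensor.pow (0 : H) 0 = ⟨TPow.tprod 0 Fin.elim0, fun σ => by
      rw [TPow.perm_tprod, Subsingleton.elim (fun i => Fin.elim0 (σ i)) Fin.elim0]⟩ :=
    Subtype.ext (congrArg (TPow.tprod (V := H) 0) (Subsingleton.elim _ _))
  rw [this]

end ExpVec

/-! ### Product vectors in the Hilbert space tensor product -/

section Tensor

variable {K F : Type*} [NormedAddCommGroup K] [InnerProductSpace ℂ K]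
  [NormedAddCommGroup F] [InnerProductSpace ℂ F]

theorem tmulRight_apply (f : F) (ψ : K) :
    (tmulRight f : K →L[ℂ] HTensor K F) ψ = ((ψ ⊗ₜ[ℂ] f : K ⊗[ℂ] F) : Completion (K ⊗[ℂ] F)) := rfl

theorem inner_tmulRight (f g : F) (ψ φ : K) :
    inner ℂ ((tmulRight f : K →L[ℂ] HTensor K F) ψ) ((tmulRight g : K →L[ℂ] HTensor K F) φ) =
      inner ℂ ψ φ * inner ℂ f g := by
  rw [tmulRight_apply, tmulRight_apply, Completion.inner_coe, TensorProduct.inner_tmul]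

theorem tensorOne_tmulRight (A : K →L[ℂ] K) (f : F) (ψ : K) :
    tensorOne A ((tmulRight f : K →L[ℂ] HTensor K F) ψ) = tmulRight f (A ψ) := by
  rw [tmulRight_apply, tmulRight_apply, tensorOne]
  erw [ContinuousLinearMap.completion_apply_coe]
  simp

theorem continuous_tmulRight (ψ : K) :
    Continuous fun f : F => (tmulRight f : K →L[ℂ] HTensor K F) ψ := by
  simp_rw [tmulRight_apply]
  exact (Completion.continuous_coe _).comp
    ((TensorProduct.mkL ℂ K F ψ).continuous)

/-- The map `f ↦ ψ ⊗ f`. -/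
def tmulLeft (ψ : K) : F →L[ℂ] HTensor K F :=
  Completion.toComplL ∘L TensorProduct.mkL ℂ K F ψ

theorem tmulLeft_apply (f : F) (ψ : K) :
    (tmulLeft ψ : F →L[ℂ] HTensor K F) f = tmulRight f ψ := rfl

theorem htensor_ext_zero {z : HTensor K F}
    (h : ∀ (ψ : K) (f : F), inner ℂ ((tmulRight f : K →L[ℂ] HTensor K F) ψ) z = 0) : z = 0 := by
  refine ext_inner_left ℂ fun w => ?_
  rw [inner_zero_right]
  refine Completion.induction_on w (isClosed_eq (by fun_prop) (by fun_prop)) fun w => ?_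
  induction w using TensorProduct.induction_on with
  | zero => rw [Completion.coe_zero, inner_zero_left]
  | tmul ψ f => exact h ψ f
  | add a b ha hb => rw [Completion.coe_add, inner_add_left, ha, hb, add_zero]

end Tensor

/-! ### Totality of the exponential vectors -/

section Total

variable {K H : Type*} [NormedAddCommGroup K] [InnerProductSpace ℂ K]
  [NormedAddCommGroup H] [InnerProductSpace ℂ H]

/-- Product vectors with exponential vectors of a dense set of functions are total. -/
theorem isTotal_expVec {α : Type*} (q : α → H) (hq : DenseRange q) :
    IsTotal fun p : K × α => (tmulRight (expVec (q p.2)) : K →L[ℂ] HTensor K (Fock H)) p.1 := by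
  refine IsTotal.of_orthogonal fun z hz => ?_
  have h1 : ∀ (ψ : K) (f : H),
      inner ℂ ((tmulRight (expVec f) : K →L[ℂ] HTensor K (Fock H)) ψ) z = 0 := by
    intro ψ f
    refine hq.induction_on (p := fun f =>
      inner ℂ ((tmulRight (expVec f) : K →L[ℂ] HTensor K (Fock H)) ψ) z = 0) f ?_ ?_
    · exact isClosed_eq (((continuous_tmulRight ψ).comp continuous_expVec).inner continuous_const)
        continuous_const
    · exact fun a => hz (ψ, a)
  have h2 : ∀ (ψ : K) (f : H) (n : ℕ),
      inner ℂ z ((tmulRight (powVec f n) : K →L[ℂ] HTensor K (Fock H)) ψ) = 0 := by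
    intro ψ f n
    -- Scaling `f` by `x` gives a power series in `x` that vanishes identically, which isolates each
    -- power of `f`; polarization later gives the whole sector.
    have h3 := powerSeries_coeff_eq_zero (c := fun n => (((Real.sqrt n.factorial)⁻¹ : ℝ) : ℂ) *
      inner ℂ z ((tmulRight (powVec f n) : K →L[ℂ] HTensor K (Fock H)) ψ)) (ρ := 1) one_pos ?_
    · have h4 := congrFun h3 n
      refine (mul_eq_zero.mp h4).resolve_left ?_
      exact_mod_cast (by positivity)
    · intro x _ _
      have h4 := ((innerSL ℂ z).comp (tmulLeft ψ : Fock H →L[ℂ] HTensor K (Fock H))).hasSum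
        (hasSum_expVec (x : ℂ) f)
      have h5 : ((innerSL ℂ z).comp (tmulLeft ψ : Fock H →L[ℂ] HTensor K (Fock H)))
          (expVec ((x : ℂ) • f)) = 0 := by
        have := h1 ψ ((x : ℂ) • f)
        rw [← inner_conj_symm, map_eq_zero] at this
        exact this
      rw [h5] at h4
      refine h4.congr_fun ?_
      intro n
      rw [map_smul, smul_eq_mul, mul_assoc]
      rfl
  refine htensor_ext_zero fun ψ w => ?_
  rw [← inner_conj_symm, map_eq_zero]
  have h6 : ∀ (n : ℕ) (y : Completion (SymTensor H n)),
      inner ℂ z ((tmulLeft ψ : Fock H →L[ℂ] HTensor K (Fock H)) (Fock.sector H n y)) = 0 := by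
    intro n y
    refine Completion.induction_on y ?_ fun y => ?_
    · refine isClosed_eq (continuous_const.inner ((tmulLeft ψ).continuous.comp ?_)) continuous_const
      exact (lp.isometry_single (E := fun n : ℕ => Completion (SymTensor H n)) n).continuous
    · have hy : y ∈ Submodule.span ℂ (Set.range fun f : H => SymTensor.pow f n) := by
        rw [SymTensor.span_pow]; trivial
      induction hy using Submodule.span_induction with
      | mem y hy => obtain ⟨f, rfl⟩ := hy; exact h2 ψ f n
      | zero => rw [Completion.coe_zero, map_zero, map_zero, inner_zero_right]
      | add a b _ _ ha hb =>
        rw [Completion.coe_add, map_add, map_add, inner_add_right, ha, hb, add_zero]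
      | smul c a _ ha =>
        rw [Completion.coe_smul, map_smul, map_smul, inner_smul_right, ha, mul_zero]
  have h7 := ((innerSL ℂ z).comp (tmulLeft ψ : Fock H →L[ℂ] HTensor K (Fock H))).hasSum
    (hasSum_sector w)
  refine h7.unique ?_
  convert hasSum_zero with n
  exact h6 n _

end Total

/-! ### The time representation of the one-particle space -/

section Labels

variable (h : Type*) [NormedAddCommGroup h] [InnerProductSpace ℂ h]

/-- Bounded square integrable functions of time with values in `h`. -/
def Label : Submodule ℂ (ℝ → h) where
  carrier := {φ | MemLp φ 2 volume ∧ ∃ C, ∀ s, ‖φ s‖ ≤ C}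
  add_mem' := by
    rintro φ χ ⟨h1, C, hC⟩ ⟨h2, D, hD⟩
    exact ⟨h1.add h2, C + D, fun s => (norm_add_le _ _).trans (add_le_add (hC s) (hD s))⟩
  zero_mem' := ⟨MemLp.zero, 0, fun s => by simp⟩
  smul_mem' := by
    rintro c φ ⟨h1, C, hC⟩
    exact ⟨h1.const_smul c, ‖c‖ * C, fun s => by
      rw [Pi.smul_apply, norm_smul]
      exact mul_le_mul_of_nonneg_left (hC s) (norm_nonneg _)⟩

variable {h}

theorem memLp_comp_mul {φ : ℝ → h} (hφ : MemLp φ 2 volume) {a : ℝ} (ha : a ≠ 0) :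
    MemLp (fun x => φ (a * x)) 2 volume := by
  have h1 : MemLp φ 2 (Measure.map (a * ·) volume) := by
    rw [Real.map_volume_mul_left ha]
    exact hφ.smul_measure ENNReal.ofReal_ne_top
  exact h1.comp_of_map (by fun_prop)

theorem two_pi_ne_zero' : (2 * Real.pi : ℝ) ≠ 0 := by positivity

theorem memLp_rescale (φ : Label h) :
    MemLp (fun x : ℝ => ((Real.sqrt (2 * Real.pi) : ℝ) : ℂ) • φ.1 (2 * Real.pi * x)) 2 volume :=
  (memLp_comp_mul φ.2.1 two_pi_ne_zero').const_smul _

variable [CompleteSpace h]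

/-- The vector of `L²(ℝ; h)` whose Fourier transform is the given function of time. -/
def toVec : Label h →ₗ[ℂ] OneParticle h where
  toFun φ := (Lp.fourierTransformₗᵢ ℝ h).symm (memLp_rescale φ).toLp
  map_add' φ χ := by
    rw [← map_add, ← MemLp.toLp_add]
    congr 1
    refine MemLp.toLp_congr _ _ (Eventually.of_forall fun x => ?_)
    simp [smul_add]
  map_smul' c φ := by
    rw [RingHom.id_apply, ← map_smul, ← MemLp.toLp_const_smul]
    congr 1
    refine MemLp.toLp_congr _ _ (Eventually.of_forall fun x => ?_)
    simp [smul_comm c]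

/-- Plancherel and the substitution `s = 2πx`. The rescaling by `√(2π)` adapts the transform with
kernel `exp (-2πi x ξ)` to the variable `s` of the noise. -/
theorem inner_toVec (φ χ : Label h) :
    inner ℂ (toVec φ) (toVec χ) = ∫ s, inner ℂ (φ.1 s) (χ.1 s) := by
  have h1 : inner ℂ (toVec φ) (toVec χ) =
      inner ℂ (memLp_rescale φ).toLp (memLp_rescale χ).toLp :=
    (Lp.fourierTransformₗᵢ ℝ h).symm.inner_map_map _ _
  rw [h1, L2.inner_def]
  have h2 : ∀ᵐ x : ℝ, inner ℂ (((memLp_rescale φ).toLp : OneParticle h) x)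
      (((memLp_rescale χ).toLp : OneParticle h) x) =
      (2 * Real.pi : ℂ) * (fun s => inner ℂ (φ.1 s) (χ.1 s)) (2 * Real.pi * x) := by
    filter_upwards [(memLp_rescale φ).coeFn_toLp, (memLp_rescale χ).coeFn_toLp] with x h3 h4
    rw [h3, h4, inner_smul_left, inner_smul_right, Complex.conj_ofReal, ← mul_assoc,
      ← Complex.ofReal_mul, Real.mul_self_sqrt (by positivity)]
    push_cast
    rfl
  rw [integral_congr_ae h2, integral_const_mul,
    Measure.integral_comp_mul_left (fun s => inner ℂ (φ.1 s) (χ.1 s)),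
    abs_of_pos (by positivity), Complex.real_smul, ← mul_assoc]
  push_cast
  rw [mul_inv_cancel₀ (by exact_mod_cast two_pi_ne_zero'), one_mul]

-- The transform on `L²` is known through its action as a distribution on Schwartz functions. There
-- Fubini moves the Fourier integral from the test function to the integrable `f`, and smooth
-- compactly supported test functions determine a locally integrable function almost everywhere.
open FourierTransform in
theorem fourier_ae_eq (f : OneParticle h) (hf : Integrable f volume) :
    ((Lp.fourierTransformₗᵢ ℝ h f : OneParticle h) : ℝ → h) =ᵐ[volume] 𝓕 (f : ℝ → h) := by
  have hcont : Continuous (𝓕 (f : ℝ → h)) :=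
    VectorFourier.fourierIntegral_continuous Real.continuous_fourierChar
      (by exact continuous_inner) hf
  refine ae_eq_of_integral_contDiff_smul_eq
    ((Lp.memLp _).locallyIntegrable (by norm_num)) hcont.locallyIntegrable ?_
  intro g hg hgs
  have hgs' : HasCompactSupport fun x => (g x : ℂ) := hgs.comp_left (g := fun x : ℝ => (x : ℂ)) (by simp)
  set G : SchwartzMap ℝ ℂ := hgs'.toSchwartzMap (Complex.ofRealCLM.contDiff.comp hg) with hG
  have hGx : ∀ x, G x = (g x : ℂ) := fun x => rfl
  have h1 := congrArg (fun T => T G) (Lp.fourier_toTemperedDistribution_eq f)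
  simp only [TemperedDistribution.fourier_apply, Lp.toTemperedDistribution_apply] at h1
  have h2 : ∫ x, (𝓕 G) x • f x = ∫ x, G x • 𝓕 (f : ℝ → h) x := by
    have := VectorFourier.integral_fourierIntegral_smul_eq_flip (L := innerₗ ℝ)
      (μ := volume) (ν := volume) (f := G) (g := (f : ℝ → h))
      Real.continuous_fourierChar (by exact continuous_inner) G.integrable hf
    rw [flip_innerₗ] at this
    exact this
  rw [h2] at h1
  have h3 : ∀ k : ℝ → h, ∫ x, g x • k x = ∫ x, G x • k x := by
    intro k
    refine integral_congr_ae (Eventually.of_forall fun x => ?_)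
    simp only [hGx]
    exact (Complex.coe_smul (g x) (k x)).symm
  rw [h3, h3]
  exact h1.symm

open FourierTransform in
/-- The time representation `s ↦ (2π)^{-1/2} ∫ exp (-i s x) f(x) dx` of an integrable function. -/
def timeFn (f : intDomain h) (s : ℝ) : h :=
  (((Real.sqrt (2 * Real.pi))⁻¹ : ℝ) : ℂ) • 𝓕 (f.1 : ℝ → h) ((2 * Real.pi)⁻¹ * s)

theorem timeFn_eq (f : intDomain h) (s : ℝ) :
    timeFn f s = (((Real.sqrt (2 * Real.pi))⁻¹ : ℝ) : ℂ) •
      ∫ x : ℝ, Complex.exp (Complex.I * (-s : ℝ) * x) • f.1 x := by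
  rw [timeFn, Real.fourier_real_eq_integral_exp_smul]
  congr 1
  refine integral_congr_ae (Eventually.of_forall fun x => ?_)
  simp only
  congr 2
  have : (2 * Real.pi : ℂ) ≠ 0 := by exact_mod_cast two_pi_ne_zero'
  have hpi : (Real.pi : ℂ) ≠ 0 := by exact_mod_cast Real.pi_ne_zero
  push_cast
  field_simp

theorem continuous_timeFn (f : intDomain h) : Continuous (timeFn f) := by
  refine Continuous.const_smul ?_ _
  refine (VectorFourier.fourierIntegral_continuous Real.continuous_fourierChar
      (by exact continuous_inner) f.2).comp (by fun_prop)

theorem norm_timeFn_le (f : intDomain h) (s : ℝ) :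
    ‖timeFn f s‖ ≤ (Real.sqrt (2 * Real.pi))⁻¹ * ∫ x, ‖f.1 x‖ := by
  rw [timeFn_eq, norm_smul, Complex.norm_real, Real.norm_of_nonneg (by positivity)]
  gcongr
  refine (norm_integral_le_integral_norm _).trans (le_of_eq ?_)
  refine integral_congr_ae (Eventually.of_forall fun x => ?_)
  simp only [norm_smul, norm_phase, one_mul]

theorem memLp_timeFn (f : intDomain h) : MemLp (timeFn f) 2 volume := by
  refine MemLp.const_smul (c := (((Real.sqrt (2 * Real.pi))⁻¹ : ℝ) : ℂ)) ?_
  refine memLp_comp_mul ?_ (inv_ne_zero two_pi_ne_zero')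
  exact (Lp.memLp _).ae_eq (fourier_ae_eq f.1 f.2)

/-- The time representation as a map into bounded square integrable functions. -/
def timeLabel : intDomain h →ₗ[ℂ] Label h where
  toFun f := ⟨timeFn f, memLp_timeFn f, _, norm_timeFn_le f⟩
  map_add' f g := by
    refine Subtype.ext (funext fun s => ?_)
    change timeFn (f + g) s = timeFn f s + timeFn g s
    have hf : Integrable f.1 volume := f.2
    have hg : Integrable g.1 volume := g.2
    have i : ∀ k : intDomain h, Integrable (fun x : ℝ => Complex.exp (Complex.I * (-s : ℝ) * x) • k.1 x)
        volume := fun k => (show Integrable k.1 volume from k.2).mono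
      ((continuous_phase (-s)).aestronglyMeasurable.smul (Lp.aestronglyMeasurable k.1))
      (Eventually.of_forall fun x => by rw [norm_smul, norm_phase, one_mul])
    rw [timeFn_eq, timeFn_eq, timeFn_eq, ← smul_add, ← integral_add (i f) (i g)]
    congr 1
    refine integral_congr_ae ?_
    filter_upwards [Lp.coeFn_add f.1 g.1] with x hx
    rw [← smul_add]
    exact congrArg _ hx
  map_smul' c f := by
    refine Subtype.ext (funext fun s => ?_)
    change timeFn (c • f) s = c • timeFn f s
    rw [timeFn_eq, timeFn_eq, smul_comm c]
    congr 1
    rw [← integral_smul]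
    refine integral_congr_ae ?_
    filter_upwards [Lp.coeFn_smul c f.1] with x hx
    rw [smul_comm c]
    exact congrArg (fun y => Complex.exp (Complex.I * (-s : ℝ) * x) • y) hx

theorem timeLabel_apply (f : intDomain h) (s : ℝ) : (timeLabel f).1 s = timeFn f s := rfl

theorem toVec_timeLabel (f : intDomain h) : toVec (timeLabel f) = f.1 := by
  have : toVec (timeLabel f) =
    (Lp.fourierTransformₗᵢ ℝ h).symm (memLp_rescale (timeLabel f)).toLp := rfl
  rw [this, LinearIsometryEquiv.symm_apply_eq]
  refine Lp.ext ?_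
  filter_upwards [(memLp_rescale (timeLabel f)).coeFn_toLp, fourier_ae_eq f.1 f.2] with x h1 h2
  rw [h1, h2, timeLabel_apply, timeFn, smul_smul, ← Complex.ofReal_mul,
    mul_inv_cancel₀ (by positivity), Complex.ofReal_one, one_smul, inv_mul_cancel_left₀ two_pi_ne_zero']

/-- In the time representation the noise functionals are point evaluations. The factor `√(2π)`
cancels the `(2π)^(-1/2)` of one vertex of the Dyson series. -/
theorem inner_timeFn (f : intDomain h) (b : h) (s : ℝ) :
    noiseBra s b f = ((Real.sqrt (2 * Real.pi) : ℝ) : ℂ) * inner ℂ b (timeFn f s) := by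
  have hf : Integrable f.1 volume := f.2
  rw [timeFn_eq, inner_smul_right, ← mul_assoc, ← Complex.ofReal_mul,
    mul_inv_cancel₀ (by positivity), Complex.ofReal_one, one_mul]
  have i : Integrable (fun x : ℝ => Complex.exp (Complex.I * (-s : ℝ) * x) • f.1 x) volume :=
    hf.mono ((continuous_phase (-s)).aestronglyMeasurable.smul (Lp.aestronglyMeasurable f.1))
      (Eventually.of_forall fun x => by rw [norm_smul, norm_phase, one_mul])
  rw [← integral_inner i]
  refine integral_congr_ae ?_
  filter_upwards [(memLp_phase (-s) f.1).coeFn_toLp] with x hx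
  exact congrArg _ hx

/-- Modulation becomes translation, so the free evolution of the reservoir shifts time. -/
theorem timeFn_phase (t : ℝ) (f : intDomain h) (s : ℝ) :
    timeFn (phase t f) s = timeFn f (s - t) := by
  rw [timeFn_eq, timeFn_eq]
  congr 1
  refine integral_congr_ae ?_
  filter_upwards [(memLp_phase t f.1).coeFn_toLp] with x hx
  have : (phase t f).1 x = Complex.exp (Complex.I * t * x) • f.1 x := hx
  rw [this, smul_smul, ← Complex.exp_add]
  congr 2
  push_cast
  ring

theorem denseRange_intDomain : DenseRange fun f : intDomain h => f.1 := by
  have h1 := SchwartzMap.denseRange_toLpCLM (E := ℝ) (F := h) (p := 2) (μ := volume)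
    ENNReal.ofNat_ne_top
  refine h1.mono ?_
  rintro _ ⟨g, rfl⟩
  refine ⟨⟨g.toLp 2 volume, ?_⟩, rfl⟩
  exact g.integrable.congr (g.coeFn_toLp 2 volume).symm

end Labels

/-! ### Second-order expansions of the one-step maps -/

section Estimates

open Asymptotics ContinuousLinearMap

variable {α m 𝔸 : Type*} [Fintype m] [DecidableEq m] [NormedRing 𝔸] [NormedAlgebra ℂ 𝔸]
  {l : Filter α} {δ : α → ℝ}

theorem isBigO_exp_sub_one {x : α → ℂ} (hδ : Tendsto δ l (𝓝 0)) (hx : x =O[l] δ) :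
    (fun p => Complex.exp (x p) - 1) =O[l] δ := by
  have h0 : Tendsto x l (𝓝 0) := hx.trans_tendsto hδ
  have h1 : (fun w : ℂ => Complex.exp w - 1) =O[𝓝 0] fun w => w := by
    have := (Complex.hasDerivAt_exp 0).differentiableAt.isBigO_sub
    simpa using this
  exact (h1.comp_tendsto h0).trans hx

theorem isBigO_exp_sub_one_sub {x : α → ℂ} (hδ : Tendsto δ l (𝓝 0)) (hx : x =O[l] δ) :
    (fun p => Complex.exp (x p) - 1 - x p) =O[l] fun p => δ p ^ 2 := by
  have h0 : Tendsto x l (𝓝 0) := hx.trans_tendsto hδ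
  have h1 : (fun w : ℂ => Complex.exp w - 1 - w) =O[𝓝 0] fun w => w ^ 2 := by
    refine IsBigO.of_bound 1 ?_
    filter_upwards [Metric.ball_mem_nhds (0 : ℂ) one_pos] with w hw
    have := Complex.norm_exp_sub_one_sub_id_le (x := w) (by simpa using (Metric.mem_ball.mp hw).le)
    simpa using this
  exact (h1.comp_tendsto h0).trans (hx.pow 2)

theorem isBigO_mulLeftRight {a b : α → 𝔸} {u v : α → ℝ} (ha : a =O[l] u) (hb : b =O[l] v) :
    (fun p => mulLeftRight ℂ 𝔸 (a p) (b p)) =O[l] fun p => u p * v p := by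
  have h1 : (fun p => mulLeftRight ℂ 𝔸 (a p) (b p)) =O[l] fun p => ‖a p‖ * ‖b p‖ :=
    IsBigO.of_bound 1 (Eventually.of_forall fun p => by
      rw [one_mul, Real.norm_of_nonneg (by positivity)]
      exact opNorm_mulLeftRight_apply_apply_le _ _ _ _)
  exact h1.trans (ha.norm_left.mul hb.norm_left)

/-- The one-step map of Gram matrices of the Euler scheme. -/
def gramStep (a a' : 𝔸) (x z : m → ℂ) (d : ℝ) (Ms M : m → 𝔸) : 𝔸 →L[ℂ] 𝔸 :=
  mulLeftRight ℂ 𝔸 a a' + ∑ j, (Complex.exp (z j) - 1) • mulLeftRight ℂ 𝔸 a (M j) +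
    ∑ i, (Complex.exp (x i) - 1) • mulLeftRight ℂ 𝔸 (Ms i) a' +
    ∑ i, ∑ j, (Complex.exp (x i + z j + if i = j then (d : ℂ) else 0) - Complex.exp (x i)
      - Complex.exp (z j) + 1) • mulLeftRight ℂ 𝔸 (Ms i) (M j)

/-- The linear part of `gramStep`. -/
def gramLin (γ γ' : 𝔸) (x z : m → ℂ) (d : ℝ) (Ms M : m → 𝔸) : 𝔸 →L[ℂ] 𝔸 :=
  mulLeftRight ℂ 𝔸 γ 1 + mulLeftRight ℂ 𝔸 1 γ' + ∑ j, z j • mulLeftRight ℂ 𝔸 1 (M j) +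
    ∑ i, x i • mulLeftRight ℂ 𝔸 (Ms i) 1 + ∑ i, (d : ℂ) • mulLeftRight ℂ 𝔸 (Ms i) (M i)

/-- The one-step map of the inner products of the Euler scheme with the limit. -/
def mixedStep (a c : 𝔸) (x : m → ℂ) (c' : m → 𝔸) (Ms : m → 𝔸) : 𝔸 →L[ℂ] 𝔸 :=
  mulLeftRight ℂ 𝔸 a c + ∑ i, mulLeftRight ℂ 𝔸 (Ms i) (Complex.exp (x i) • c' i - c)

variable {γ γ' : α → 𝔸} {x z : α → m → ℂ} (Ms M : m → 𝔸)

theorem isBigO_delta_one (hδ : Tendsto δ l (𝓝 0)) : δ =O[l] fun _ => (1 : ℝ) := hδ.isBigO_one ℝ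

/-- In the double sum the first orders of the exponentials in `x` and `z` cancel and only `δ` on the
diagonal survives. This is the Itô correction, the last sum of `gramLin`; everything else is a
product of two first-order quantities or a second-order remainder of `exp`. -/
theorem isBigO_gramStep (hδ : Tendsto δ l (𝓝 0)) (hγ : γ =O[l] δ) (hγ' : γ' =O[l] δ)
    (hx : ∀ i, (fun p => x p i) =O[l] δ) (hz : ∀ i, (fun p => z p i) =O[l] δ) :
    (fun p => gramStep (1 + γ p) (1 + γ' p) (x p) (z p) (δ p) Ms M -
      (1 + gramLin (γ p) (γ' p) (x p) (z p) (δ p) Ms M)) =O[l] fun p => δ p ^ 2 := by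
  have one : ∀ c : 𝔸, (fun _ : α => c) =O[l] fun _ => (1 : ℝ) := fun c => isBigO_const_const _ one_ne_zero _
  have hq : ∀ i j, (fun p => Complex.exp (x p i + z p j + if i = j then (δ p : ℂ) else 0)
      - Complex.exp (x p i) - Complex.exp (z p j) + 1 - if i = j then (δ p : ℂ) else 0) =O[l]
      fun p => δ p ^ 2 := by
    intro i j
    have hd : (fun p => if i = j then (δ p : ℂ) else 0) =O[l] δ := by
      by_cases hij : i = j
      · simp only [hij, if_true]
        exact IsBigO.of_bound 1 (Eventually.of_forall fun p => by simp)
      · simp only [hij, if_false]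
        exact isBigO_zero _ _
    have h1 := isBigO_exp_sub_one_sub hδ (((hx i).add (hz j)).add hd)
    have h2 := isBigO_exp_sub_one_sub hδ (hx i)
    have h3 := isBigO_exp_sub_one_sub hδ (hz j)
    refine ((h1.sub h2).sub h3).congr_left fun p => ?_
    ring
  have key : ∀ p, gramStep (1 + γ p) (1 + γ' p) (x p) (z p) (δ p) Ms M -
      (1 + gramLin (γ p) (γ' p) (x p) (z p) (δ p) Ms M) =
      mulLeftRight ℂ 𝔸 (γ p) (γ' p) +
      ∑ j, ((Complex.exp (z p j) - 1 - z p j) • mulLeftRight ℂ 𝔸 1 (M j) +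
        (Complex.exp (z p j) - 1) • mulLeftRight ℂ 𝔸 (γ p) (M j)) +
      ∑ i, ((Complex.exp (x p i) - 1 - x p i) • mulLeftRight ℂ 𝔸 (Ms i) 1 +
        (Complex.exp (x p i) - 1) • mulLeftRight ℂ 𝔸 (Ms i) (γ' p)) +
      ∑ i, ∑ j, (Complex.exp (x p i + z p j + if i = j then (δ p : ℂ) else 0)
        - Complex.exp (x p i) - Complex.exp (z p j) + 1 - if i = j then (δ p : ℂ) else 0) •
          mulLeftRight ℂ 𝔸 (Ms i) (M j) := by
    intro p
    have hT : (1 : 𝔸 →L[ℂ] 𝔸) = mulLeftRight ℂ 𝔸 1 1 := by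
      ext a; simp [mulLeftRight_apply]
    have hd : ∑ i, (δ p : ℂ) • mulLeftRight ℂ 𝔸 (Ms i) (M i) =
        ∑ i, ∑ j, (if i = j then (δ p : ℂ) else 0) • mulLeftRight ℂ 𝔸 (Ms i) (M j) := by
      refine Finset.sum_congr rfl fun i _ => ?_
      simp [ite_smul]
    rw [gramStep, gramLin, hT, hd]
    simp only [map_add, add_apply, smul_add, sub_smul, Finset.sum_add_distrib,
      Finset.sum_sub_distrib]
    abel
  simp_rw [key]
  have hsq : ∀ {f : α → 𝔸 →L[ℂ] 𝔸}, f =O[l] (fun p => δ p * δ p) → f =O[l] fun p => δ p ^ 2 := by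
    intro f hf
    exact hf.congr_right fun p => (sq (δ p)).symm
  refine (((hsq (isBigO_mulLeftRight hγ hγ')).add ?_).add ?_).add ?_
  · refine IsBigO.fun_sum fun j _ => ?_
    refine IsBigO.add ?_ ?_
    · have := (isBigO_exp_sub_one_sub hδ (hz j)).smul
        (isBigO_mulLeftRight (one 1) (one (M j)))
      exact this.congr_right fun p => by simp
    · have := (isBigO_exp_sub_one hδ (hz j)).smul (isBigO_mulLeftRight hγ (one (M j)))
      exact this.congr_right fun p => by simp [sq]
  · refine IsBigO.fun_sum fun j _ => ?_
    refine IsBigO.add ?_ ?_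
    · have := (isBigO_exp_sub_one_sub hδ (hx j)).smul
        (isBigO_mulLeftRight (one (Ms j)) (one 1))
      exact this.congr_right fun p => by simp
    · have := (isBigO_exp_sub_one hδ (hx j)).smul (isBigO_mulLeftRight (one (Ms j)) hγ')
      exact this.congr_right fun p => by simp [sq]
  · refine IsBigO.fun_sum fun i _ => IsBigO.fun_sum fun j _ => ?_
    have := (hq i j).smul (isBigO_mulLeftRight (one (Ms i)) (one (M j)))
    exact this.congr_right fun p => by simp

theorem isBigO_gramLin (hγ : γ =O[l] δ) (hγ' : γ' =O[l] δ)
    (hx : ∀ i, (fun p => x p i) =O[l] δ) (hz : ∀ i, (fun p => z p i) =O[l] δ) :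
    (fun p => gramLin (γ p) (γ' p) (x p) (z p) (δ p) Ms M) =O[l] δ := by
  have one : ∀ c : 𝔸, (fun _ : α => c) =O[l] fun _ => (1 : ℝ) := fun c => isBigO_const_const _ one_ne_zero _
  unfold gramLin
  refine ((((?_ : IsBigO _ _ _).add ?_).add ?_).add ?_).add ?_
  · exact (isBigO_mulLeftRight hγ (one 1)).congr_right fun p => by simp
  · exact (isBigO_mulLeftRight (one 1) hγ').congr_right fun p => by simp
  · refine IsBigO.fun_sum fun j _ => ?_
    exact ((hz j).smul (isBigO_mulLeftRight (one 1) (one (M j)))).congr_right fun p => by simp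
  · refine IsBigO.fun_sum fun j _ => ?_
    exact ((hx j).smul (isBigO_mulLeftRight (one (Ms j)) (one 1))).congr_right fun p => by simp
  · refine IsBigO.fun_sum fun j _ => ?_
    have : (fun p => (δ p : ℂ)) =O[l] δ :=
      IsBigO.of_bound 1 (Eventually.of_forall fun p => by simp)
    exact (this.smul (isBigO_mulLeftRight (one (Ms j)) (one (M j)))).congr_right fun p => by simp

/-- Only the first order of the kernels enters. The label of `c'` is changed on the interval itself,
which adds `δ M_i` and so reproduces the Itô term of `gramLin`. -/
theorem isBigO_mixedStep (hδ : Tendsto δ l (𝓝 0)) (hγ : γ =O[l] δ)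
    (hx : ∀ i, (fun p => x p i) =O[l] δ) {c : α → 𝔸} {c' : α → m → 𝔸} {κ : α → 𝔸}
    (hκ : κ =O[l] δ)
    (hc : (fun p => c p - (1 + κ p)) =O[l] fun p => δ p ^ 2)
    (hc' : ∀ i, (fun p => c' p i - (1 + κ p + (δ p : ℂ) • M i)) =O[l] fun p => δ p ^ 2) :
    (fun p => mixedStep (1 + γ p) (c p) (x p) (c' p) Ms -
      (1 + (mulLeftRight ℂ 𝔸 (γ p) 1 + mulLeftRight ℂ 𝔸 1 (κ p) +
        ∑ i, x p i • mulLeftRight ℂ 𝔸 (Ms i) 1 + ∑ i, (δ p : ℂ) • mulLeftRight ℂ 𝔸 (Ms i) (M i))))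
      =O[l] fun p => δ p ^ 2 := by
  have one : ∀ c : 𝔸, (fun _ : α => c) =O[l] fun _ => (1 : ℝ) := fun c => isBigO_const_const _ one_ne_zero _
  have hδ1 := isBigO_delta_one hδ
  have hδC : (fun p => (δ p : ℂ)) =O[l] δ :=
    IsBigO.of_bound 1 (Eventually.of_forall fun p => by simp)
  have hsq1 : (fun p => δ p ^ 2) =O[l] δ := by
    simpa [sq] using (isBigO_refl δ l).mul hδ1
  have hc1 : (fun p => c p - 1) =O[l] δ := by
    refine ((hc.trans hsq1).add hκ).congr_left fun p => ?_
    abel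
  have hM : ∀ i, (fun p => (δ p : ℂ) • M i) =O[l] δ := fun i => by
    exact (hδC.smul (one (M i))).congr_right fun p => by simp
  have hc1' : ∀ i, (fun p => c' p i - 1) =O[l] δ := by
    intro i
    refine (((hc' i).trans hsq1).add (hκ.add (hM i))).congr_left fun p => ?_
    abel
  have hd : ∀ i, (fun p => (Complex.exp (x p i) • c' p i - c p) - (x p i • (1 : 𝔸) + (δ p : ℂ) • M i))
      =O[l] fun p => δ p ^ 2 := by
    intro i
    have h1 : (fun p => (Complex.exp (x p i) - 1 - x p i) • (1 : 𝔸)) =O[l] fun p => δ p ^ 2 :=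
      ((isBigO_exp_sub_one_sub hδ (hx i)).smul (one 1)).congr_right fun p => by simp
    have h2 : (fun p => (Complex.exp (x p i) - 1) • (c' p i - 1)) =O[l] fun p => δ p ^ 2 :=
      ((isBigO_exp_sub_one hδ (hx i)).smul (hc1' i)).congr_right fun p => by simp [sq]
    refine (((h1.add h2).add (hc' i)).sub hc).congr_left fun p => ?_
    simp only [smul_sub, sub_smul, one_smul]
    abel
  have key : ∀ p, mixedStep (1 + γ p) (c p) (x p) (c' p) Ms -
      (1 + (mulLeftRight ℂ 𝔸 (γ p) 1 + mulLeftRight ℂ 𝔸 1 (κ p) +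
        ∑ i, x p i • mulLeftRight ℂ 𝔸 (Ms i) 1 + ∑ i, (δ p : ℂ) • mulLeftRight ℂ 𝔸 (Ms i) (M i))) =
      mulLeftRight ℂ 𝔸 (γ p) (c p - 1) + mulLeftRight ℂ 𝔸 1 (c p - (1 + κ p)) +
      ∑ i, mulLeftRight ℂ 𝔸 (Ms i) ((Complex.exp (x p i) • c' p i - c p) -
        (x p i • (1 : 𝔸) + (δ p : ℂ) • M i)) := by
    intro p
    have hT : (1 : 𝔸 →L[ℂ] 𝔸) = mulLeftRight ℂ 𝔸 1 1 := by
      ext a; simp [mulLeftRight_apply]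
    rw [mixedStep, hT]
    simp only [map_add, map_sub, map_smul, add_apply, Finset.sum_add_distrib,
      Finset.sum_sub_distrib]
    abel
  simp_rw [key]
  refine ((?_ : IsBigO _ _ _).add ?_).add ?_
  · exact (isBigO_mulLeftRight hγ hc1).congr_right fun p => by simp [sq]
  · exact (isBigO_mulLeftRight (one 1) hc).congr_right fun p => by simp
  · refine IsBigO.fun_sum fun i _ => ?_
    exact (isBigO_mulLeftRight (one (Ms i)) (hd i)).congr_right fun p => by simp

end Estimates

/-! ### Grids of intervals and limits of products along them -/

section Grids

open Asymptotics

/-- The filter of intervals of nonnegative length tending to zero. -/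
def shortIntervals : Filter (ℝ × ℝ) :=
  comap (fun I : ℝ × ℝ => I.2 - I.1) (𝓝[≥] 0)

theorem tendsto_length : Tendsto (fun I : ℝ × ℝ => I.2 - I.1) shortIntervals (𝓝 0) :=
  tendsto_comap.mono_right nhdsWithin_le_nhds

theorem eventually_le : ∀ᶠ I in shortIntervals, I.1 ≤ I.2 := by
  have : ∀ᶠ x in 𝓝[≥] (0 : ℝ), 0 ≤ x := eventually_mem_nhdsWithin
  filter_upwards [tendsto_comap.eventually this] with I hI
  linarith

/-- Sequences of lists of `N` intervals of length `τ / N`. -/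
structure IsGrid (τ : ℝ) (L : ℕ → List (ℝ × ℝ)) : Prop where
  nonneg : 0 ≤ τ
  length : ∀ N, (L N).length = N
  width : ∀ N, ∀ I ∈ L N, I.2 - I.1 = τ / N

/-- The filter `shortIntervals` depends on the length alone, so what holds along it holds for all
intervals of a fine grid at once, wherever they lie. -/
theorem IsGrid.eventually {τ : ℝ} {L : ℕ → List (ℝ × ℝ)} (hL : IsGrid τ L) {P : ℝ × ℝ → Prop}
    (hP : ∀ᶠ I in shortIntervals, P I) : ∀ᶠ N in atTop, ∀ I ∈ L N, P I := by
  obtain ⟨s, hs, hsP⟩ := mem_comap.mp hP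
  have h1 : Tendsto (fun N : ℕ => τ / N) atTop (𝓝[≥] 0) :=
    tendsto_nhdsWithin_iff.mpr ⟨tendsto_const_div_atTop_nhds_zero_nat τ,
      Eventually.of_forall fun N => div_nonneg hL.nonneg N.cast_nonneg⟩
  filter_upwards [h1.eventually hs] with N hN I hI
  refine hsP ?_
  change I.2 - I.1 ∈ s
  rw [hL.width N I hI]
  exact hN

theorem IsGrid.reverse {τ : ℝ} {L : ℕ → List (ℝ × ℝ)} (hL : IsGrid τ L) :
    IsGrid τ fun N => (L N).reverse :=
  ⟨hL.nonneg, fun N => by rw [List.length_reverse, hL.length],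
    fun N I hI => hL.width N I (List.mem_reverse.mp hI)⟩

theorem norm_le_of_sub_one_le {𝔸 : Type*} [NormedRing 𝔸] (h1 : ‖(1 : 𝔸)‖ ≤ 1) {a : 𝔸} {η : ℝ}
    (h : ‖a - 1‖ ≤ η) : ‖a‖ ≤ 1 + η := by
  calc ‖a‖ = ‖1 + (a - 1)‖ := by rw [add_sub_cancel]
    _ ≤ ‖(1 : 𝔸)‖ + ‖a - 1‖ := norm_add_le _ _
    _ ≤ 1 + η := add_le_add h1 h

/-- There are `N` factors, each with an error `O(1/N²)` and of norm at most `1 + O(1/N)`. -/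
theorem IsGrid.tendsto_prod_sub {𝔸 : Type*} [NormedRing 𝔸] (h1 : ‖(1 : 𝔸)‖ ≤ 1) {τ : ℝ}
    {L : ℕ → List (ℝ × ℝ)} (hL : IsGrid τ L) {a b : ℝ × ℝ → 𝔸}
    (ha : (fun I => a I - 1) =O[shortIntervals] fun I => I.2 - I.1)
    (hab : (fun I => a I - b I) =O[shortIntervals] fun I => (I.2 - I.1) ^ 2) :
    Tendsto (fun N => ((L N).map a).prod - ((L N).map b).prod) atTop (𝓝 0) := by
  have hb : (fun I => b I - 1) =O[shortIntervals] fun I => I.2 - I.1 := by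
    have h2 : (fun I : ℝ × ℝ => (I.2 - I.1) ^ 2) =O[shortIntervals] fun I => I.2 - I.1 := by
      simpa [sq] using (isBigO_refl (fun I : ℝ × ℝ => I.2 - I.1) shortIntervals).mul
        (tendsto_length.isBigO_one ℝ)
    refine (ha.sub (hab.trans h2)).congr_left fun I => ?_
    abel
  obtain ⟨C1, hC1, h2⟩ := ha.exists_pos
  obtain ⟨C2, hC2, h3⟩ := hb.exists_pos
  obtain ⟨C3, hC3, h4⟩ := hab.exists_pos
  have e1 := hL.eventually h2.bound
  have e2 := hL.eventually h3.bound
  have e3 := hL.eventually h4.bound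
  have hτ := hL.nonneg
  set C := max C1 C2 with hC
  have hC0 : 0 ≤ C := hC1.le.trans (le_max_left _ _)
  refine squeeze_zero_norm' ?_ (tendsto_euler_error (C * τ) (C3 * τ ^ 2) (by positivity))
  filter_upwards [e1, e2, e3] with N f1 f2 f3
  have hw : ∀ I ∈ L N, ‖I.2 - I.1‖ = τ / N := fun I hI => by
    rw [hL.width N I hI, Real.norm_of_nonneg (by positivity)]
  have := norm_prod_sub_prod_le h1 (R := 1 + C * τ / N) (η := C3 * τ ^ 2 / N ^ 2)
    (by have : 0 ≤ C * τ / N := by positivity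
        linarith) (L N) a b ?_ ?_ ?_
  · rwa [hL.length N] at this
  · intro I hI
    refine norm_le_of_sub_one_le h1 ((f1 I hI).trans ?_)
    rw [hw I hI, mul_div_assoc]
    gcongr
    exact le_max_left _ _
  · intro I hI
    refine norm_le_of_sub_one_le h1 ((f2 I hI).trans ?_)
    rw [hw I hI, mul_div_assoc]
    gcongr
    exact le_max_right _ _
  · intro I hI
    refine (f3 I hI).trans (le_of_eq ?_)
    rw [norm_pow, hw I hI, div_pow, mul_div_assoc]

theorem IsGrid.tendsto_prod_apply {E : Type*} [NormedAddCommGroup E] [NormedSpace ℂ E] {τ : ℝ}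
    {L : ℕ → List (ℝ × ℝ)} (hL : IsGrid τ L) {Λ : ℝ × ℝ → E →L[ℂ] E} {x : E}
    (ha : (fun I => Λ I - 1) =O[shortIntervals] fun I => I.2 - I.1)
    (hx : (fun I => Λ I x - x) =O[shortIntervals] fun I => (I.2 - I.1) ^ 2) :
    Tendsto (fun N => ((L N).map Λ).prod x) atTop (𝓝 x) := by
  obtain ⟨C, hC, h2⟩ := ha.exists_pos
  obtain ⟨C3, hC3, h4⟩ := hx.exists_pos
  have e1 := hL.eventually h2.bound
  have e3 := hL.eventually h4.bound
  have hτ := hL.nonneg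
  rw [tendsto_iff_norm_sub_tendsto_zero]
  refine squeeze_zero_norm' ?_ (tendsto_euler_error (C * τ) (C3 * τ ^ 2) (by positivity))
  filter_upwards [e1, e3] with N f1 f3
  have hw : ∀ I ∈ L N, ‖I.2 - I.1‖ = τ / N := fun I hI => by
    rw [hL.width N I hI, Real.norm_of_nonneg (by positivity)]
  have := norm_prod_apply_sub_le (R := 1 + C * τ / N) (η := C3 * τ ^ 2 / N ^ 2)
    (by have : 0 ≤ C * τ / N := by positivity
        linarith) (L N) Λ x ?_ ?_
  · rwa [hL.length N, ← norm_norm] at this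
  · intro I hI
    refine norm_le_of_sub_one_le ContinuousLinearMap.norm_id_le ((f1 I hI).trans ?_)
    rw [hw I hI, mul_div_assoc]
  · intro I hI
    refine (f3 I hI).trans (le_of_eq ?_)
    rw [norm_pow, hw I hI, div_pow, mul_div_assoc]

end Grids

/-! ### The Euler scheme and its exact matrix elements -/

section Euler

open ContinuousLinearMap

variable {K h m : Type*} [NormedAddCommGroup K] [InnerProductSpace ℂ K] [CompleteSpace K]
  [NormedAddCommGroup h] [InnerProductSpace ℂ h]

/-- Disjointness of half-open intervals given by their end points. -/
def Disj (I J : ℝ × ℝ) : Prop := Disjoint (Set.Ioc I.1 I.2) (Set.Ioc J.1 J.2)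

/-- The integral of `(b | φ)` over a half-open interval. -/
def pairing (b : h) (I : ℝ × ℝ) (φ : Label h) : ℂ := ∫ s in Set.Ioc I.1 I.2, inner ℂ b (φ.1 s)

theorem integrableOn_inner (b : h) (φ : Label h) {S : Set ℝ} (hS : volume S ≠ ⊤) :
    IntegrableOn (fun s => inner ℂ b (φ.1 s)) S := by
  obtain ⟨C, hC⟩ := φ.2.2
  refine IntegrableOn.of_bound hS.lt_top
    ((aestronglyMeasurable_const.inner φ.2.1.1).restrict) (‖b‖ * C) ?_
  exact Eventually.of_forall fun s =>
    (norm_inner_le_norm _ _).trans (mul_le_mul_of_nonneg_left (hC s) (norm_nonneg _))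

theorem pairing_add (b : h) (I : ℝ × ℝ) (φ χ : Label h) :
    pairing b I (φ + χ) = pairing b I φ + pairing b I χ := by
  rw [pairing, pairing, pairing, ← integral_add (integrableOn_inner b φ measure_Ioc_lt_top.ne)
    (integrableOn_inner b χ measure_Ioc_lt_top.ne)]
  refine integral_congr_ae (Eventually.of_forall fun s => ?_)
  exact inner_add_right _ _ _

theorem isBigO_pairing (b : h) (φ : Label h) :
    (fun I => pairing b I φ) =O[shortIntervals] fun I => I.2 - I.1 := by
  obtain ⟨C, hC⟩ := φ.2.2
  refine Asymptotics.IsBigO.of_bound (‖b‖ * C) ?_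
  filter_upwards [eventually_le] with I hI
  have := norm_setIntegral_le_of_norm_le_const (μ := volume) (s := Set.Ioc I.1 I.2)
    (f := fun s => inner ℂ b (φ.1 s)) (C := ‖b‖ * C) measure_Ioc_lt_top
    (fun s _ => (norm_inner_le_norm _ _).trans (mul_le_mul_of_nonneg_left (hC s) (norm_nonneg _)))
  rw [Measure.real, Real.volume_Ioc, ENNReal.toReal_ofReal (sub_nonneg.mpr hI)] at this
  rwa [Real.norm_of_nonneg (sub_nonneg.mpr hI)]

/-- The function equal to `b` on an interval and to zero elsewhere. -/
def kick (b : h) (I : ℝ × ℝ) : Label h :=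
  ⟨Set.indicator (Set.Ioc I.1 I.2) fun _ => b,
    memLp_indicator_const 2 measurableSet_Ioc b (Or.inr measure_Ioc_lt_top.ne),
    ‖b‖, fun s => norm_indicator_le_norm_self (fun _ : ℝ => b) s⟩

theorem kick_apply (b : h) (I : ℝ × ℝ) (s : ℝ) :
    (kick b I).1 s = Set.indicator (Set.Ioc I.1 I.2) (fun _ => b) s := rfl

theorem pairing_kick_of_disj (b b' : h) {I J : ℝ × ℝ} (hIJ : Disj I J) :
    pairing b I (kick b' J) = 0 := by
  rw [pairing]
  refine (setIntegral_congr_fun measurableSet_Ioc fun s hs => ?_).trans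
    (integral_zero ℝ ℂ)
  have : s ∉ Set.Ioc J.1 J.2 := fun h' => Set.disjoint_left.mp hIJ hs h'
  simp [kick_apply, Set.indicator_of_notMem this]

theorem pairing_kick_self (b b' : h) {I : ℝ × ℝ} (hI : I.1 ≤ I.2) :
    pairing b I (kick b' I) = ((I.2 - I.1 : ℝ) : ℂ) * inner ℂ b b' := by
  rw [pairing]
  refine (setIntegral_congr_fun (g := fun _ => inner ℂ b b') measurableSet_Ioc
    fun s hs => ?_).trans ?_
  · simp only [kick_apply, Set.indicator_of_mem hs]
  · rw [setIntegral_const, Measure.real, Real.volume_Ioc,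
      ENNReal.toReal_ofReal (sub_nonneg.mpr hI), Complex.real_smul]

theorem pairing_add_kick (b b' : h) {I J : ℝ × ℝ} (hIJ : Disj I J) (φ : Label h) :
    pairing b I (φ + kick b' J) = pairing b I φ := by
  rw [pairing_add, pairing_kick_of_disj b b' hIJ, add_zero]

variable [CompleteSpace h]

theorem inner_toVec_kick (b : h) (I : ℝ × ℝ) (φ : Label h) :
    inner ℂ (toVec (kick b I)) (toVec φ) = pairing b I φ := by
  rw [inner_toVec, pairing, ← integral_indicator measurableSet_Ioc]
  refine integral_congr_ae (Eventually.of_forall fun s => ?_)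
  by_cases hs : s ∈ Set.Ioc I.1 I.2
  · simp [kick_apply, hs]
  · simp [kick_apply, hs]

theorem inner_toVec_kick_right (b : h) (I : ℝ × ℝ) (φ : Label h) :
    inner ℂ (toVec φ) (toVec (kick b I)) = star (pairing b I φ) := by
  rw [← inner_toVec_kick, Complex.star_def, inner_conj_symm]

/-- The map from `K` to the `K`-multiples of an exponential vector. -/
def coh (φ : Label h) : K →L[ℂ] BigSpace K h := tmulRight (expVec (toVec φ))

theorem inner_coh (f g : Label h) (ψ φ : K) :
    inner ℂ (coh f ψ) (coh g φ) = Complex.exp (inner ℂ (toVec f) (toVec g)) * inner ℂ ψ φ := by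
  rw [coh, coh, inner_tmulRight, inner_expVec, mul_comm]

theorem adjoint_coh_comp (f g : Label h) (A : K →L[ℂ] K) :
    adjoint (coh f) ∘L tensorOne A ∘L coh g =
      Complex.exp (inner ℂ (toVec f) (toVec g)) • A := by
  ext φ
  refine ext_inner_left ℂ fun ψ => ?_
  rw [comp_apply, adjoint_inner_right, comp_apply, coh, coh, tensorOne_tmulRight,
    inner_tmulRight, inner_expVec, smul_apply, inner_smul_right, mul_comm]

theorem tensorOne_one {F : Type*} [NormedAddCommGroup F] [InnerProductSpace ℂ F] :
    tensorOne (1 : K →L[ℂ] K) = (1 : HTensor K F →L[ℂ] HTensor K F) := by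
  have : (1 : K →L[ℂ] K).rTensor F = ContinuousLinearMap.id ℂ (K ⊗[ℂ] F) := by
    ext x
    exact LinearMap.congr_fun (LinearMap.rTensor_id F K) x
  ext x
  rw [tensorOne, this]
  induction x using Completion.induction_on with
  | hp => exact isClosed_eq (by fun_prop) (by fun_prop)
  | ih a => simp

theorem isTotal_coh : IsTotal fun p : K × Label h => (coh p.2 p.1 : BigSpace K h) := by
  refine isTotal_expVec (fun φ : Label h => toVec φ) ?_
  refine (denseRange_intDomain (h := h)).mono ?_
  rintro _ ⟨f, rfl⟩
  exact ⟨timeLabel f, toVec_timeLabel f⟩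

variable [Fintype m] [DecidableEq m] (G : K →L[ℂ] K) (M : m → K →L[ℂ] K) (β : m → h)

/-- The drift part of the Euler scheme on an interval. -/
def drift (I : ℝ × ℝ) (g : Label h) : K →L[ℂ] K :=
  ((I.2 - I.1 : ℝ) : ℂ) • G - ∑ i, pairing (β i) I g • star (M i)

/-- The Euler scheme of the quantum stochastic differential equation with drift `G` and noise
coefficients `M`, started at an exponential vector; the intervals of the list act one after the
other, the first one coming first. -/
def euler : List (ℝ × ℝ) → Label h → (K →L[ℂ] BigSpace K h)
  | [], g => coh g
  -- The difference of the two terms replaces the creation operator on `I`. The annihilation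
  -- operator is diagonal on exponential vectors and sits in `drift` as the scalar `pairing`.
  | I :: l, g => euler l g ∘L (1 + drift G M β I g) +
      ∑ i, (euler l (g + kick (β i) I) - euler l g) ∘L M i

/-- The one-step map of the Gram matrices of the Euler scheme. -/
def gramMap (f g : Label h) (I : ℝ × ℝ) : (K →L[ℂ] K) →L[ℂ] (K →L[ℂ] K) :=
  gramStep (1 + star (drift G M β I f)) (1 + drift G M β I g) (fun i => pairing (β i) I g)
    (fun i => star (pairing (β i) I f)) (I.2 - I.1) (fun i => star (M i)) M

/-- The one-step map of the inner products of the Euler scheme with a vector that has the kernels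
`c`. -/
def mixedMap (c : ℝ × ℝ → Label h → K →L[ℂ] K) (f g : Label h) (I : ℝ × ℝ) :
    (K →L[ℂ] K) →L[ℂ] (K →L[ℂ] K) :=
  mixedStep (1 + star (drift G M β I f)) (c I f) (fun i => pairing (β i) I g)
    (fun i => c I (f + kick (β i) I)) (fun i => star (M i))

/-- The one-step kernel of the Euler scheme. -/
def weakStep (f g : Label h) (I : ℝ × ℝ) : K →L[ℂ] K :=
  1 + drift G M β I g + ∑ i, (Complex.exp (star (pairing (β i) I f)) - 1) • M i

variable {G M β}

theorem drift_add_kick {I J : ℝ × ℝ} (hIJ : Disj I J) (g : Label h) (i : m) :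
    drift G M β I (g + kick (β i) J) = drift G M β I g := by
  simp only [drift, pairing_add_kick _ _ hIJ]

theorem Disj.symm {I J : ℝ × ℝ} (hIJ : Disj I J) : Disj J I := Disjoint.symm hIJ

theorem map_prod_congr {R : Type*} [Monoid R] {l : List (ℝ × ℝ)} {a b : ℝ × ℝ → R}
    (hab : ∀ I ∈ l, a I = b I) : (l.map a).prod = (l.map b).prod := by
  rw [List.map_congr_left hab]

theorem gramMap_add_kick_left {I J : ℝ × ℝ} (hIJ : Disj I J) (f g : Label h) (i : m) :
    gramMap G M β (f + kick (β i) J) g I = gramMap G M β f g I := by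
  simp only [gramMap, drift_add_kick hIJ, pairing_add_kick _ _ hIJ]

theorem gramMap_add_kick_right {I J : ℝ × ℝ} (hIJ : Disj I J) (f g : Label h) (i : m) :
    gramMap G M β f (g + kick (β i) J) I = gramMap G M β f g I := by
  simp only [gramMap, drift_add_kick hIJ, pairing_add_kick _ _ hIJ]

theorem weakStep_add_kick {I J : ℝ × ℝ} (hIJ : Disj I J) (f g : Label h) (i : m) :
    weakStep G M β f (g + kick (β i) J) I = weakStep G M β f g I := by
  simp only [weakStep, drift_add_kick hIJ]

theorem mixedMap_add_kick {c : ℝ × ℝ → Label h → K →L[ℂ] K}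
    (hc : ∀ I J, Disj I J → ∀ f i, c I (f + kick (β i) J) = c I f) {I J : ℝ × ℝ} (hIJ : Disj I J)
    (f g : Label h) (i : m) :
    mixedMap G M β c (f + kick (β i) J) g I = mixedMap G M β c f g I := by
  simp only [mixedMap, drift_add_kick hIJ, hc I J hIJ, add_right_comm f (kick (β i) J)]

theorem adjoint_sum_comp {E F : Type*} [NormedAddCommGroup E] [InnerProductSpace ℂ E]
    [CompleteSpace E] [NormedAddCommGroup F] [InnerProductSpace ℂ F] [CompleteSpace F]
    (X : m → E →L[ℂ] F) (N : m → E →L[ℂ] E) :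
    adjoint (∑ i, X i ∘L N i) = ∑ i, star (N i) ∘L adjoint (X i) := by
  rw [map_sum]
  exact Finset.sum_congr rfl fun i _ => adjoint_comp _ _

theorem adjoint_euler_cons (I : ℝ × ℝ) (l : List (ℝ × ℝ)) (f : Label h) :
    adjoint (euler G M β (I :: l) f) =
      (1 + star (drift G M β I f)) ∘L adjoint (euler G M β l f) +
      ∑ i, star (M i) ∘L (adjoint (euler G M β l (f + kick (β i) I)) -
        adjoint (euler G M β l f)) := by
  rw [euler, map_add, adjoint_comp, adjoint_sum_comp]
  simp only [map_sub]
  congr 2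
  rw [← star_eq_adjoint, star_add, star_one]

/-- Pure sesquilinear expansion: once the labels are translated into scalars, one step on both sides
is `gramStep` applied to the Gram operator of the remaining steps. -/
theorem gramStep_expand {𝔸 : Type*} [NormedRing 𝔸] [NormedAlgebra ℂ 𝔸] (a a' Y : 𝔸) (x z : m → ℂ)
    (d : ℝ) (Ms M : m → 𝔸) (e : ℂ) :
    (a * (e • Y) + ∑ i, Ms i * (e • Complex.exp (x i) • Y - e • Y)) * a' +
      ∑ j, (a * (e • Complex.exp (z j) • Y) +
          ∑ i, Ms i * (e • Complex.exp (x i + z j + if i = j then (d : ℂ) else 0) • Y -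
            e • Complex.exp (z j) • Y) -
        (a * (e • Y) + ∑ i, Ms i * (e • Complex.exp (x i) • Y - e • Y))) * M j =
    e • gramStep a a' x z d Ms M Y := by
  rw [gramStep]
  simp only [add_apply, sum_apply, smul_apply, mulLeftRight_apply]
  rw [Finset.sum_comm (γ := m) (s := Finset.univ) (t := Finset.univ)]
  simp only [mul_sub, sub_mul, add_mul, Finset.sum_mul, mul_smul_comm, smul_mul_assoc, smul_add,
    smul_sub, add_smul, sub_smul, one_smul, Finset.smul_sum, Finset.sum_add_distrib,
    Finset.sum_sub_distrib]
  abel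

/-- A kick on the first interval only contributes the scalar `exp (star (pairing (β i) I f))`,
because the other intervals are disjoint from it. A general `W` in place of the adjoint of `coh f`
allows a later evolution to be put on the left, as in `IsEvolution.inner_comp`. -/
theorem weak_euler (f : Label h) {E : Type*} [NormedAddCommGroup E] [InnerProductSpace ℂ E]
    [CompleteSpace E] (W : BigSpace K h →L[ℂ] E) (S : Label h → K →L[ℂ] E)
    (hW : ∀ g, W ∘L coh g = Complex.exp (inner ℂ (toVec f) (toVec g)) • S g)
    (l : List (ℝ × ℝ)) (hl : l.Pairwise Disj)
    (hS : ∀ J ∈ l, ∀ g i, S (g + kick (β i) J) = S g) (g : Label h) :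
    W ∘L euler G M β l g = Complex.exp (inner ℂ (toVec f) (toVec g)) •
      (S g ∘L (l.map (weakStep G M β f g)).reverse.prod) := by
  induction l generalizing g with
  | nil => exact hW g
  | cons I l ih =>
    obtain ⟨hI, hl⟩ := List.pairwise_cons.mp hl
    replace ih := ih hl fun J hJ => hS J (List.mem_cons_of_mem _ hJ)
    set Y := (l.map (weakStep G M β f g)).reverse.prod with hY
    have hYr : ∀ i, (l.map (weakStep G M β f (g + kick (β i) I))).reverse.prod = Y := fun i => by
      rw [hY, List.map_congr_left fun J hJ => weakStep_add_kick (hI J hJ).symm f g i]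
    have h1 : ∀ i, W ∘L euler G M β l (g + kick (β i) I) =
        Complex.exp (inner ℂ (toVec f) (toVec g)) •
          Complex.exp (star (pairing (β i) I f)) • (S g ∘L Y) := fun i => by
      rw [ih, hYr, hS I List.mem_cons_self, map_add, inner_add_right, Complex.exp_add,
        inner_toVec_kick_right, mul_smul]
    have h2 : W ∘L euler G M β (I :: l) g = (W ∘L euler G M β l g) ∘L (1 + drift G M β I g) +
        ∑ i, (W ∘L euler G M β l (g + kick (β i) I) - W ∘L euler G M β l g) ∘L M i := by
      simp only [euler, comp_add, comp_finsetSum, sub_comp, comp_sub]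
      rfl
    rw [h2, ih g, List.map_cons, List.reverse_cons, List.prod_append, List.prod_singleton]
    simp only [h1, ← hY]
    rw [weakStep]
    have h3 : S g ∘L (Y * (1 + drift G M β I g +
        ∑ i, (Complex.exp (star (pairing (β i) I f)) - 1) • M i)) =
        (S g ∘L Y) ∘L (1 + drift G M β I g) +
          ∑ i, (Complex.exp (star (pairing (β i) I f)) - 1) • ((S g ∘L Y) ∘L M i) := by
      have : ∀ X : K →L[ℂ] K, S g ∘L (Y * X) = (S g ∘L Y) ∘L X := fun _ => rfl
      rw [this, comp_add, comp_finsetSum]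
      simp only [comp_smul]
    rw [h3, smul_add, Finset.smul_sum, smul_comp]
    congr 1
    refine Finset.sum_congr rfl fun i _ => ?_
    rw [sub_comp, smul_comp, smul_comp, smul_comp, sub_smul, one_smul, smul_sub]

/-- The factor of the first interval acts first in the kernel of `v`, so removing that interval
turns `S f` into `c I f (S f)`; the induction therefore needs `S` as a function of the label. The
kernels of `v` must be known for all labels, as the scheme moves them. -/
theorem mixed_euler (g : Label h) (v : BigSpace K h) (c : ℝ × ℝ → Label h → K →L[ℂ] K)
    (hc : ∀ I J, Disj I J → ∀ f i, c I (f + kick (β i) J) = c I f)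
    (l : List (ℝ × ℝ)) (hl : l.Pairwise Disj) (S : Label h → K)
    (hS : ∀ J ∈ l, ∀ f i, S (f + kick (β i) J) = S f)
    (hv : ∀ f, adjoint (coh f) v = Complex.exp (inner ℂ (toVec f) (toVec g)) •
      (l.map fun I => c I f).reverse.prod (S f)) (f : Label h) :
    adjoint (euler G M β l f) v = Complex.exp (inner ℂ (toVec f) (toVec g)) •
      (l.map (mixedMap G M β c f g)).prod 1 (S f) := by
  induction l generalizing f S with
  | nil => simpa [euler] using hv f
  | cons I l ih =>
    obtain ⟨hI, hl⟩ := List.pairwise_cons.mp hl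
    replace ih := ih hl (fun f => c I f (S f))
      (fun J hJ f i => by
        simp only [hc I J (hI J hJ) f i, hS J (List.mem_cons_of_mem _ hJ) f i])
      (fun f => by
        rw [hv, List.map_cons, List.reverse_cons, List.prod_append, List.prod_singleton]
        rfl)
    set Y := (l.map (mixedMap G M β c f g)).prod 1 with hY
    have hYl : ∀ i, (l.map (mixedMap G M β c (f + kick (β i) I) g)).prod 1 = Y := fun i => by
      rw [hY, map_prod_congr fun J hJ => mixedMap_add_kick hc (hI J hJ).symm f g i]
    have h1 : ∀ i, adjoint (euler G M β l (f + kick (β i) I)) v =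
        Complex.exp (inner ℂ (toVec f) (toVec g)) •
          Complex.exp (pairing (β i) I g) • Y (c I (f + kick (β i) I) (S f)) := fun i => by
      rw [ih, hYl, hS I List.mem_cons_self, map_add, inner_add_left, Complex.exp_add,
        inner_toVec_kick, mul_smul]
    rw [adjoint_euler_cons]
    simp only [add_apply, sum_apply, comp_apply, sub_apply, h1, ih f, ← hY, List.map_cons,
      List.prod_cons]
    have h2 : (mixedMap G M β c f g I * (l.map (mixedMap G M β c f g)).prod) 1 (S f) =
        (1 + star (drift G M β I f)) (Y (c I f (S f))) + ∑ i, star (M i)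
          (Complex.exp (pairing (β i) I g) • Y (c I (f + kick (β i) I) (S f)) -
            Y (c I f (S f))) := by
      change mixedMap G M β c f g I Y (S f) = _
      simp only [mixedMap, mixedStep, add_apply, sum_apply, mulLeftRight_apply]
      refine congrArg _ (Finset.sum_congr rfl fun i _ => ?_)
      change star (M i) (Y ((Complex.exp (pairing (β i) I g) • c I (f + kick (β i) I) - c I f)
        (S f))) = _
      rw [sub_apply, smul_apply, map_sub, map_smul]
    rw [h2, smul_add, Finset.smul_sum]
    simp only [map_smul, map_sub, smul_sub, add_apply, smul_add]

/-- Kicks on the first interval leave the later one-step maps unchanged. Two kicks on the same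
interval, one on each side, overlap in `|I| ⟪β_i, β_j⟫`; orthonormality makes this the diagonal term
of `gramStep`. -/
theorem adjoint_euler_comp_tensorOne_comp_euler (hβ : Orthonormal ℂ β) (A : K →L[ℂ] K)
    (l : List (ℝ × ℝ)) (hl : l.Pairwise Disj) (hle : ∀ I ∈ l, I.1 ≤ I.2) (f g : Label h) :
    adjoint (euler G M β l f) ∘L tensorOne A ∘L euler G M β l g =
      Complex.exp (inner ℂ (toVec f) (toVec g)) • (l.map (gramMap G M β f g)).prod A := by
  induction l generalizing f g with
  | nil => simpa [euler] using adjoint_coh_comp f g A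
  | cons I l ih =>
    obtain ⟨hI, hl⟩ := List.pairwise_cons.mp hl
    replace ih := ih hl fun J hJ => hle J (List.mem_cons_of_mem _ hJ)
    have hI' := hle I List.mem_cons_self
    set Y := (l.map (gramMap G M β f g)).prod A with hY
    set e := Complex.exp (inner ℂ (toVec f) (toVec g)) with he
    set x : m → ℂ := fun i => pairing (β i) I g with hx
    set z : m → ℂ := fun i => star (pairing (β i) I f) with hz
    have hYl : ∀ i, (l.map (gramMap G M β (f + kick (β i) I) g)).prod A = Y := fun i => by
      rw [hY, map_prod_congr fun J hJ => gramMap_add_kick_left (hI J hJ).symm f g i]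
    have hYr : ∀ i, (l.map (gramMap G M β f (g + kick (β i) I))).prod A = Y := fun i => by
      rw [hY, map_prod_congr fun J hJ => gramMap_add_kick_right (hI J hJ).symm f g i]
    have hYlr : ∀ i j, (l.map (gramMap G M β (f + kick (β i) I) (g + kick (β j) I))).prod A = Y :=
      fun i j => by
        rw [← hYl i, map_prod_congr fun J hJ => gramMap_add_kick_right (hI J hJ).symm _ g j]
    have h00 : adjoint (euler G M β l f) ∘L tensorOne A ∘L euler G M β l g = e • Y := ih f g
    have h10 : ∀ i, adjoint (euler G M β l (f + kick (β i) I)) ∘L tensorOne A ∘L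
        euler G M β l g = e • Complex.exp (x i) • Y := fun i => by
      rw [ih, hYl, map_add, inner_add_left, Complex.exp_add, inner_toVec_kick, mul_smul]
    have h01 : ∀ j, adjoint (euler G M β l f) ∘L tensorOne A ∘L
        euler G M β l (g + kick (β j) I) = e • Complex.exp (z j) • Y := fun j => by
      rw [ih, hYr, map_add, inner_add_right, Complex.exp_add, inner_toVec_kick_right, mul_smul]
    have h11 : ∀ i j, adjoint (euler G M β l (f + kick (β i) I)) ∘L tensorOne A ∘L
        euler G M β l (g + kick (β j) I) =
        e • Complex.exp (x i + z j + if i = j then ((I.2 - I.1 : ℝ) : ℂ) else 0) • Y :=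
      fun i j => by
        have : pairing (β i) I (kick (β j) I) = if i = j then ((I.2 - I.1 : ℝ) : ℂ) else 0 := by
          rw [pairing_kick_self _ _ hI', orthonormal_iff_ite.mp hβ i j, mul_ite, mul_one, mul_zero]
        rw [ih, hYlr, map_add, map_add, inner_add_left, inner_add_right, inner_add_right,
          inner_toVec_kick_right, inner_toVec_kick, inner_toVec_kick, this, ← mul_smul,
          he, ← Complex.exp_add]
        congr 2
        ring
    have expand : adjoint (euler G M β (I :: l) f) ∘L tensorOne A ∘L euler G M β (I :: l) g =
        e • gramMap G M β f g I Y := by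
      rw [adjoint_euler_cons, euler]
      set a := 1 + star (drift G M β I f) with ha
      set a' := 1 + drift G M β I g with ha'
      have hL : ∀ (Z : K →L[ℂ] BigSpace K h),
          (a ∘L adjoint (euler G M β l f) + ∑ i, star (M i) ∘L
            (adjoint (euler G M β l (f + kick (β i) I)) - adjoint (euler G M β l f))) ∘L
            tensorOne A ∘L Z = a * (adjoint (euler G M β l f) ∘L tensorOne A ∘L Z) +
            ∑ i, star (M i) * (adjoint (euler G M β l (f + kick (β i) I)) ∘L tensorOne A ∘L Z -
              adjoint (euler G M β l f) ∘L tensorOne A ∘L Z) := by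
        intro Z
        rw [add_comp, finsetSum_comp]
        rfl
      have hR : ∀ (X : BigSpace K h →L[ℂ] K),
          X ∘L tensorOne A ∘L (euler G M β l g ∘L a' + ∑ j, (euler G M β l (g + kick (β j) I) -
            euler G M β l g) ∘L M j) = (X ∘L tensorOne A ∘L euler G M β l g) * a' +
            ∑ j, (X ∘L tensorOne A ∘L euler G M β l (g + kick (β j) I) -
              X ∘L tensorOne A ∘L euler G M β l g) * M j := by
        intro X
        simp only [comp_add, comp_finsetSum, sub_comp, comp_sub, sub_mul]
        rfl
      rw [hR, hL]
      simp only [hL, h00, h10, h01, h11]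
      rw [gramStep_expand]
      rfl
    rw [expand, List.map_cons, List.prod_cons]
    rfl

end Euler

/-! ### Strong convergence of the Euler scheme to an isometry -/

section EulerLimit

open ContinuousLinearMap Asymptotics

variable {K h m : Type*} [NormedAddCommGroup K] [InnerProductSpace ℂ K] [CompleteSpace K]
  [NormedAddCommGroup h] [InnerProductSpace ℂ h] [CompleteSpace h] [Fintype m] [DecidableEq m]
  (G : K →L[ℂ] K) (M : m → K →L[ℂ] K) (β : m → h)

/-- The part of first order of the kernels on a short interval. -/
def linPart (f g : Label h) (I : ℝ × ℝ) : K →L[ℂ] K :=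
  drift G M β I g + ∑ i, star (pairing (β i) I f) • M i

theorem isBigO_sq_length :
    (fun I : ℝ × ℝ => (I.2 - I.1) ^ 2) =O[shortIntervals] fun I => I.2 - I.1 := by
  simpa [sq] using (isBigO_refl (fun I : ℝ × ℝ => I.2 - I.1) shortIntervals).mul
    (tendsto_length.isBigO_one ℝ)

theorem isBigO_star {E : Type*} [SeminormedAddCommGroup E] [StarAddMonoid E] [NormedStarGroup E]
    {l : Filter (ℝ × ℝ)} {u : ℝ × ℝ → E} {v : ℝ × ℝ → ℝ} (hu : u =O[l] v) :
    (fun I => star (u I)) =O[l] v :=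
  (hu.norm_left.congr_left fun I => (norm_star (u I)).symm).of_norm_left

theorem isBigO_smul_const {E : Type*} [NormedAddCommGroup E] [NormedSpace ℂ E]
    {l : Filter (ℝ × ℝ)} {u : ℝ × ℝ → ℂ} {v : ℝ × ℝ → ℝ} (hu : u =O[l] v) (A : E) :
    (fun I => u I • A) =O[l] v :=
  (hu.smul (isBigO_const_const A (one_ne_zero (α := ℝ)) l)).congr_right fun I => by simp

theorem isBigO_length_ofReal :
    (fun I : ℝ × ℝ => ((I.2 - I.1 : ℝ) : ℂ)) =O[shortIntervals] fun I => I.2 - I.1 :=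
  IsBigO.of_bound 1 (Eventually.of_forall fun p => by rw [Complex.norm_real, one_mul])

theorem isBigO_drift (g : Label h) :
    (fun I => drift G M β I g) =O[shortIntervals] fun I => I.2 - I.1 := by
  unfold drift
  refine IsBigO.sub ?_ (IsBigO.fun_sum fun i _ => ?_)
  · exact isBigO_smul_const isBigO_length_ofReal _
  · exact isBigO_smul_const (isBigO_pairing _ _) _

theorem isBigO_linPart (f g : Label h) :
    (fun I => linPart G M β f g I) =O[shortIntervals] fun I => I.2 - I.1 := by
  unfold linPart
  refine (isBigO_drift G M β g).add (IsBigO.fun_sum fun i _ => ?_)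
  exact isBigO_smul_const (isBigO_star (isBigO_pairing _ _)) _

theorem isBigO_weakStep (f g : Label h) :
    (fun I => weakStep G M β f g I - (1 + linPart G M β f g I)) =O[shortIntervals]
      fun I => (I.2 - I.1) ^ 2 := by
  have : (fun I => ∑ i, (Complex.exp (star (pairing (β i) I f)) - 1 - star (pairing (β i) I f)) •
      M i) =O[shortIntervals] fun I => (I.2 - I.1) ^ 2 :=
    IsBigO.fun_sum fun i _ => isBigO_smul_const
      (isBigO_exp_sub_one_sub tendsto_length (isBigO_star (isBigO_pairing _ _))) _
  refine this.congr_left fun I => ?_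
  rw [weakStep, linPart]
  simp only [sub_smul, Finset.sum_sub_distrib]
  abel

/-- The part of first order of `gramMap`. -/
def gramMapLin (f g : Label h) (I : ℝ × ℝ) : (K →L[ℂ] K) →L[ℂ] (K →L[ℂ] K) :=
  gramLin (star (drift G M β I f)) (drift G M β I g) (fun i => pairing (β i) I g)
    (fun i => star (pairing (β i) I f)) (I.2 - I.1) (fun i => star (M i)) M

theorem isBigO_gramMap (f g : Label h) :
    (fun I => gramMap G M β f g I - (1 + gramMapLin G M β f g I)) =O[shortIntervals]
      fun I => (I.2 - I.1) ^ 2 :=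
  isBigO_gramStep _ _ tendsto_length (isBigO_star (isBigO_drift G M β f)) (isBigO_drift G M β g)
    (fun i => isBigO_pairing (β i) g) fun i => isBigO_star (isBigO_pairing (β i) f)

theorem isBigO_gramMapLin (f g : Label h) :
    (fun I => gramMapLin G M β f g I) =O[shortIntervals] fun I => I.2 - I.1 :=
  isBigO_gramLin _ _ (isBigO_star (isBigO_drift G M β f)) (isBigO_drift G M β g)
    (fun i => isBigO_pairing (β i) g) fun i => isBigO_star (isBigO_pairing (β i) f)

theorem isBigO_sub_one {E : Type*} [NormedRing E] {a κ : ℝ × ℝ → E}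
    (ha : (fun I => a I - (1 + κ I)) =O[shortIntervals] fun I => (I.2 - I.1) ^ 2)
    (hκ : κ =O[shortIntervals] fun I => I.2 - I.1) :
    (fun I => a I - 1) =O[shortIntervals] fun I => I.2 - I.1 :=
  ((ha.trans isBigO_sq_length).add hκ).congr_left fun I => by abel

theorem isBigO_apply {E F : Type*} [NormedAddCommGroup E] [NormedSpace ℂ E]
    [NormedAddCommGroup F] [NormedSpace ℂ F] {l : Filter (ℝ × ℝ)}
    {a : ℝ × ℝ → E →L[ℂ] F} {v : ℝ × ℝ → ℝ} (ha : a =O[l] v) (x : E) :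
    (fun I => a I x) =O[l] v := by
  refine IsBigO.trans (IsBigO.of_bound ‖x‖ (Eventually.of_forall fun I => ?_)) ha
  rw [mul_comm]
  exact (a I).le_opNorm x

variable {G M β}

/-- All terms with `pairing` cancel between drift and noise, and the length of the interval times
the left side of `hGM` remains. This is the infinitesimal form of isometry. -/
theorem gramMapLin_one (hGM : G + star G + ∑ i, star (M i) * M i = 0) (f g : Label h)
    (I : ℝ × ℝ) : gramMapLin G M β f g I 1 = 0 := by
  have : gramMapLin G M β f g I 1 =
      ((I.2 - I.1 : ℝ) : ℂ) • (G + star G + ∑ i, star (M i) * M i) := by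
    simp only [gramMapLin, gramLin, add_apply, sum_apply, smul_apply, mulLeftRight_apply, drift,
      star_sub, star_sum, star_smul, star_star, one_mul, mul_one, smul_add, Finset.smul_sum,
      Complex.star_def, Complex.conj_ofReal]
    abel
  rw [this, hGM, smul_zero]

/-- Every one-step map fixes the operator `1` up to second order, so in the limit the scheme
preserves the Gram matrix of the exponential vectors. -/
theorem tendsto_gram (hGM : G + star G + ∑ i, star (M i) * M i = 0) (hβ : Orthonormal ℂ β)
    {τ : ℝ} {L : ℕ → List (ℝ × ℝ)} (hL : IsGrid τ L) (hd : ∀ N, (L N).Pairwise Disj)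
    (f g : Label h) (ψ φ : K) :
    Tendsto (fun N => inner ℂ (euler G M β (L N) f ψ) (euler G M β (L N) g φ)) atTop
      (𝓝 (inner ℂ (coh f ψ) (coh g φ) : ℂ)) := by
  have h1 : Tendsto (fun N => ((L N).map (gramMap G M β f g)).prod 1) atTop (𝓝 1) := by
    refine hL.tendsto_prod_apply (isBigO_sub_one (isBigO_gramMap G M β f g)
      (isBigO_gramMapLin G M β f g)) ?_
    refine (isBigO_apply (isBigO_gramMap G M β f g) 1).congr_left fun I => ?_
    rw [sub_apply, add_apply, gramMapLin_one hGM, add_zero]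
    rfl
  have h2 : ∀ N, inner ℂ (euler G M β (L N) f ψ) (euler G M β (L N) g φ) =
      Complex.exp (inner ℂ (toVec f) (toVec g)) *
        inner ℂ ψ (((L N).map (gramMap G M β f g)).prod 1 φ) := by
    intro N
    have := adjoint_euler_comp_tensorOne_comp_euler (G := G) (M := M) hβ 1 (L N) (hd N)
      (fun I hI => by
        have := hL.width N I hI
        have h0 : 0 ≤ τ / N := div_nonneg hL.nonneg N.cast_nonneg
        linarith) f g
    have h3 : tensorOne (1 : K →L[ℂ] K) = (1 : BigSpace K h →L[ℂ] BigSpace K h) := tensorOne_one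
    rw [h3] at this
    rw [← inner_smul_right, ← smul_apply, ← this, comp_apply, adjoint_inner_right]
    rfl
  simp only [h2, inner_coh]
  refine Tendsto.const_mul _ ?_
  refine Tendsto.inner tendsto_const_nhds ?_
  exact ((ContinuousLinearMap.apply ℂ K φ).continuous.tendsto 1).comp h1

/-- The propagator `T` is an exact product over each nonempty grid, with factors that agree with
`weakStep` to second order. For `N = 0` the product is empty, hence the restriction. -/
theorem tendsto_weakStep {τ : ℝ} {L : ℕ → List (ℝ × ℝ)} (hL : IsGrid τ L) {f g : Label h}
    {c : ℝ × ℝ → K →L[ℂ] K}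
    (hc : (fun I => c I - (1 + linPart G M β f g I)) =O[shortIntervals] fun I => (I.2 - I.1) ^ 2)
    {T : K →L[ℂ] K} (hT : ∀ N, 0 < N → T = ((L N).map c).reverse.prod) :
    Tendsto (fun N => ((L N).map (weakStep G M β f g)).reverse.prod) atTop (𝓝 T) := by
  have h1 := hL.reverse.tendsto_prod_sub (𝔸 := K →L[ℂ] K) ContinuousLinearMap.norm_id_le
    (a := weakStep G M β f g) (b := c)
    (isBigO_sub_one (isBigO_weakStep G M β f g) (isBigO_linPart G M β f g))
    (((isBigO_weakStep G M β f g).sub hc).congr_left fun I => by abel)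
  rw [← tendsto_sub_nhds_zero_iff]
  refine h1.congr' ?_
  filter_upwards [eventually_gt_atTop 0] with N hN
  rw [hT N hN, List.map_reverse, List.map_reverse]

/-- Bounded norms and convergent matrix elements give a weak limit `w` with the prescribed kernels.
Knowing these, `mixed_euler` computes the inner product of the scheme with `w`, which tends to the
square of the limiting norm; so the convergence is strong. Then the Gram matrices pass to the limit
and `w` is an isometric image of the exponential vectors. -/
theorem exists_eulerLimit (hGM : G + star G + ∑ i, star (M i) * M i = 0) (hβ : Orthonormal ℂ β)
    {τ : ℝ} {L : ℕ → List (ℝ × ℝ)} (hL : IsGrid τ L) (hd : ∀ N, (L N).Pairwise Disj)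
    (c : ℝ × ℝ → Label h → Label h → K →L[ℂ] K)
    (hcl : ∀ I J, Disj I J → ∀ f g i, c I (f + kick (β i) J) g = c I f g)
    (hc : ∀ f g, (fun I => c I f g - (1 + linPart G M β f g I)) =O[shortIntervals]
      fun I => (I.2 - I.1) ^ 2)
    (hc' : ∀ f g i, (fun I => c I (f + kick (β i) I) g -
      (1 + linPart G M β f g I + ((I.2 - I.1 : ℝ) : ℂ) • M i)) =O[shortIntervals]
      fun I => (I.2 - I.1) ^ 2)
    (T : Label h → Label h → K →L[ℂ] K)
    (hT : ∀ f g, ∀ N, 0 < N → T f g = ((L N).map fun I => c I f g).reverse.prod) :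
    ∃ V : BigSpace K h →ₗᵢ[ℂ] BigSpace K h,
      (∀ f g ψ φ, inner ℂ (coh f ψ) (V (coh g φ)) =
        Complex.exp (inner ℂ (toVec f) (toVec g)) * inner ℂ ψ (T f g φ)) ∧
      ∀ g φ, Tendsto (fun N => euler G M β (L N) g φ) atTop (𝓝 (V (coh g φ))) := by
  have hweak : ∀ f g ψ φ, Tendsto (fun N => inner ℂ (coh f ψ) (euler G M β (L N) g φ)) atTop
      (𝓝 (Complex.exp (inner ℂ (toVec f) (toVec g)) * inner ℂ ψ (T f g φ))) := by
    intro f g ψ φ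
    have h2 := tendsto_weakStep hL (hc f g) (hT f g)
    have h3 : ∀ N, inner ℂ (coh f ψ) (euler G M β (L N) g φ) =
        Complex.exp (inner ℂ (toVec f) (toVec g)) *
          inner ℂ ψ (((L N).map (weakStep G M β f g)).reverse.prod φ) := by
      intro N
      have h4 := weak_euler (G := G) (M := M) (β := β) f (adjoint (coh f : K →L[ℂ] BigSpace K h))
        (fun _ => (1 : K →L[ℂ] K)) (fun g => by
          have := adjoint_coh_comp f g (1 : K →L[ℂ] K)
          rw [tensorOne_one] at this
          exact this) (L N) (hd N) (fun _ _ _ _ => rfl) g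
      have h5 := congrArg (fun X : K →L[ℂ] K => inner ℂ ψ (X φ)) h4
      simp only [comp_apply, smul_apply, inner_smul_right] at h5
      rwa [adjoint_inner_right] at h5
    simp only [h3]
    refine Tendsto.const_mul _ (Tendsto.inner tendsto_const_nhds ?_)
    exact ((ContinuousLinearMap.apply ℂ K φ).continuous.tendsto _).comp h2
  have hnorm : ∀ g φ, Tendsto (fun N => ‖euler G M β (L N) g φ‖) atTop
      (𝓝 ‖(coh g φ : BigSpace K h)‖) := by
    intro g φ
    have h1 := (tendsto_gram hGM hβ hL hd g g φ φ).norm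
    have h2 := h1.sqrt
    simpa [inner_self_eq_norm_sq_to_K, Real.sqrt_sq] using h2
  have hex : ∀ p : K × Label h, ∃ w : BigSpace K h, ∀ z, Tendsto
      (fun N => inner ℂ z (euler G M β (L N) p.2 p.1)) atTop (𝓝 (inner ℂ z w)) := by
    rintro ⟨φ, g⟩
    obtain ⟨B, hB⟩ := (hnorm g φ).bddAbove_range
    exact isTotal_coh.exists_weak_limit (B := B) (fun N => hB ⟨N, rfl⟩)
      fun p => ⟨_, hweak p.2 g p.1 φ⟩
  choose w hw using hex
  have hwT : ∀ f g ψ φ, inner ℂ (coh f ψ) (w (φ, g)) =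
        Complex.exp (inner ℂ (toVec f) (toVec g)) * inner ℂ ψ (T f g φ) := fun f g ψ φ =>
    tendsto_nhds_unique (hw (φ, g) _) (hweak f g ψ φ)
  have hstrong : ∀ p : K × Label h,
      Tendsto (fun N => euler G M β (L N) p.2 p.1) atTop (𝓝 (w p)) := by
    rintro ⟨φ, g⟩
    refine tendsto_of_weak (hnorm g φ) (hw (φ, g)) ?_
    -- For equal labels the first-order part of `mixedMap` is that of `gramMap`, and it annihilates
    -- `1`.
    have h1 : Tendsto (fun N => ((L N).map (mixedMap G M β (fun I f => c I f g) g g)).prod 1)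
        atTop (𝓝 1) := by
      have h2 := isBigO_mixedStep (l := shortIntervals) (fun i => star (M i)) M
        tendsto_length (isBigO_star (isBigO_drift G M β g)) (fun i => isBigO_pairing (β i) g)
        (c := fun I => c I g g) (c' := fun I i => c I (g + kick (β i) I) g)
        (κ := fun I => linPart G M β g g I) (isBigO_linPart G M β g g) (hc g g)
        (fun i => hc' g g i)
      have h3 : ∀ I : ℝ × ℝ,
          (mulLeftRight ℂ (K →L[ℂ] K) (star (drift G M β I g)) 1 +
            mulLeftRight ℂ (K →L[ℂ] K) 1 (linPart G M β g g I) +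
            ∑ i, pairing (β i) I g • mulLeftRight ℂ (K →L[ℂ] K) (star (M i)) 1 +
            ∑ i, ((I.2 - I.1 : ℝ) : ℂ) • mulLeftRight ℂ (K →L[ℂ] K) (star (M i)) (M i)) =
          gramMapLin G M β g g I := by
        intro I
        rw [gramMapLin, gramLin, linPart, map_add, map_sum]
        simp only [map_smul]
        abel
      simp only [h3] at h2
      refine hL.tendsto_prod_apply (isBigO_sub_one h2 (isBigO_gramMapLin G M β g g)) ?_
      refine (isBigO_apply h2 1).congr_left fun I => ?_
      rw [sub_apply, add_apply, gramMapLin_one hGM, add_zero]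
      rfl
    have h4 : ∀ N, 0 < N → inner ℂ (euler G M β (L N) g φ) (w (φ, g)) =
        Complex.exp (inner ℂ (toVec g) (toVec g)) *
          inner ℂ φ (((L N).map (mixedMap G M β (fun I f => c I f g) g g)).prod 1 φ) := by
      intro N hN
      have h5 := mixed_euler (G := G) (M := M) g (w (φ, g)) (fun I f => c I f g)
        (fun I J hIJ f i => hcl I J hIJ f g i) (L N) (hd N) (fun _ => φ) (fun _ _ _ _ => rfl)
        (fun f => by
          refine ext_inner_left ℂ fun ψ => ?_
          rw [adjoint_inner_right, hwT, inner_smul_right, hT f g N hN]) g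
      rw [← adjoint_inner_right, h5, inner_smul_right]
    have h6 : ((‖(coh g φ : BigSpace K h)‖ ^ 2 : ℝ) : ℂ) =
        Complex.exp (inner ℂ (toVec g) (toVec g)) * inner ℂ φ φ := by
      rw [← inner_coh, inner_self_eq_norm_sq_to_K]
      push_cast
      rfl
    rw [h6]
    have h7 : Tendsto (fun N => Complex.exp (inner ℂ (toVec g) (toVec g)) *
          inner ℂ φ (((L N).map (mixedMap G M β (fun I f => c I f g) g g)).prod 1 φ)) atTop
        (𝓝 (Complex.exp (inner ℂ (toVec g) (toVec g)) * inner ℂ φ φ)) := by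
      refine Tendsto.const_mul _ (Tendsto.inner tendsto_const_nhds ?_)
      exact ((ContinuousLinearMap.apply ℂ K φ).continuous.tendsto 1).comp h1
    refine h7.congr' ?_
    filter_upwards [eventually_gt_atTop 0] with N hN
    exact (h4 N hN).symm
  obtain ⟨V, hV⟩ := isTotal_coh.exists_isometry (w := w) fun p q =>
    tendsto_nhds_unique ((hstrong p).inner (hstrong q))
      (tendsto_gram hGM hβ hL hd p.2 q.2 p.1 q.1)
  refine ⟨V, fun f g ψ φ => ?_, fun g φ => ?_⟩
  · rw [hV (φ, g), hwT]
  · rw [hV (φ, g)]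
    exact hstrong (φ, g)

end EulerLimit

/-! ### The unitary evolution over an interval and its cocycle property -/

section Kernels

open ContinuousLinearMap Asymptotics

variable {K h m : Type*} [NormedAddCommGroup K] [InnerProductSpace ℂ K] [CompleteSpace K]
  [NormedAddCommGroup h] [InnerProductSpace ℂ h] [CompleteSpace h] [Fintype m] [DecidableEq m]
  (G : K →L[ℂ] K) (M : m → K →L[ℂ] K) (β : m → h)

/-- The generator of the kernels of the quantum stochastic evolution on exponential vectors. -/
def gen (f g : ℝ → h) (s : ℝ) : K →L[ℂ] K :=
  G - ∑ i, inner ℂ (β i) (g s) • star (M i) + ∑ i, star (inner ℂ (β i) (f s)) • M i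

/-- A bound of `gen` for functions bounded by `C`. -/
def genBound (C : ℝ) : ℝ := ‖G‖ + ∑ i, ‖β i‖ * C * ‖M i‖ + ∑ i, ‖β i‖ * C * ‖M i‖

theorem norm_inner_le_of_norm_le {b x : h} {C : ℝ} (hx : ‖x‖ ≤ C) : ‖inner ℂ b x‖ ≤ ‖b‖ * C :=
  (norm_inner_le_norm b x).trans (mul_le_mul_of_nonneg_left hx (norm_nonneg _))

theorem isGenerator_gen {f g : Label h} {C : ℝ} (hf : ∀ s, ‖f.1 s‖ ≤ C)
    (hg : ∀ s, ‖g.1 s‖ ≤ C) : IsGenerator (gen G M β f.1 g.1) (genBound G M β C) := by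
  have hm : ∀ (φ : Label h) i, AEStronglyMeasurable (fun s => inner ℂ (β i) (φ.1 s)) volume :=
    fun φ i => aestronglyMeasurable_const.inner φ.2.1.1
  refine ⟨(aestronglyMeasurable_const.sub (Finset.aestronglyMeasurable_fun_sum _ fun i _ =>
    (hm g i).smul_const _)).add (Finset.aestronglyMeasurable_fun_sum _ fun i _ =>
    (continuous_star.comp_aestronglyMeasurable (hm f i)).smul_const _), fun s => ?_⟩
  refine (norm_add_le _ _).trans (add_le_add ((norm_sub_le _ _).trans (add_le_add le_rfl ?_)) ?_)
  · refine norm_sum_le_of_le _ fun i _ => ?_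
    rw [norm_smul, norm_star]
    exact mul_le_mul_of_nonneg_right (norm_inner_le_of_norm_le (hg s)) (norm_nonneg _)
  · refine norm_sum_le_of_le _ fun i _ => ?_
    rw [norm_smul, norm_star]
    exact mul_le_mul_of_nonneg_right (norm_inner_le_of_norm_le (hf s)) (norm_nonneg _)

theorem exists_bound₂ (f g : Label h) : ∃ C, (∀ s, ‖f.1 s‖ ≤ C) ∧ ∀ s, ‖g.1 s‖ ≤ C := by
  obtain ⟨C, hC⟩ := f.2.2
  obtain ⟨D, hD⟩ := g.2.2
  exact ⟨max C D, fun s => (hC s).trans (le_max_left _ _), fun s => (hD s).trans (le_max_right _ _)⟩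

theorem exists_isGenerator_gen (f g : Label h) : ∃ C, IsGenerator (gen G M β f.1 g.1) C := by
  obtain ⟨C, hf, hg⟩ := exists_bound₂ f g
  exact ⟨_, isGenerator_gen G M β hf hg⟩

theorem integral_gen (f g : Label h) {I : ℝ × ℝ} (hI : I.1 ≤ I.2) :
    ∫ s in I.1..I.2, gen G M β f.1 g.1 s = linPart G M β f g I := by
  have hi : ∀ (φ : Label h) i, IntervalIntegrable (fun s => inner ℂ (β i) (φ.1 s)) volume I.1 I.2 :=
    fun φ i => (intervalIntegrable_iff_integrableOn_Ioc_of_le hI).mpr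
      (integrableOn_inner _ _ measure_Ioc_lt_top.ne)
  have hi' : ∀ (φ : Label h) i, IntervalIntegrable (fun s => star (inner ℂ (β i) (φ.1 s)))
      volume I.1 I.2 := fun φ i => ⟨(Complex.conjCLE.toContinuousLinearMap.integrable_comp (hi φ i).1),
      (Complex.conjCLE.toContinuousLinearMap.integrable_comp (hi φ i).2)⟩
  have h1 : ∀ i, IntervalIntegrable (fun s => inner ℂ (β i) (g.1 s) • star (M i)) volume I.1 I.2 :=
    fun i => ⟨(hi g i).1.smul_const _, (hi g i).2.smul_const _⟩
  have h2 : ∀ i, IntervalIntegrable (fun s => star (inner ℂ (β i) (f.1 s)) • M i) volume I.1 I.2 :=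
    fun i => ⟨(hi' f i).1.smul_const _, (hi' f i).2.smul_const _⟩
  have hs1 : IntervalIntegrable (fun s => ∑ i, inner ℂ (β i) (g.1 s) • star (M i)) volume I.1 I.2 := by
    simpa only [Finset.sum_fn] using IntervalIntegrable.sum Finset.univ fun i _ => h1 i
  have hs2 : IntervalIntegrable (fun s => ∑ i, star (inner ℂ (β i) (f.1 s)) • M i)
      volume I.1 I.2 := by
    simpa only [Finset.sum_fn] using IntervalIntegrable.sum Finset.univ fun i _ => h2 i
  unfold gen
  rw [intervalIntegral.integral_add (intervalIntegrable_const.sub hs1) hs2,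
    intervalIntegral.integral_sub intervalIntegrable_const hs1,
    intervalIntegral.integral_finsetSum fun i _ => h1 i,
    intervalIntegral.integral_finsetSum fun i _ => h2 i, linPart, drift,
    intervalIntegral.integral_const]
  refine congrArg₂ _ (congrArg _ ?_) ?_
  · exact Finset.sum_congr rfl fun i _ => by
      rw [intervalIntegral.integral_smul_const, intervalIntegral.integral_of_le hI, pairing]
  · refine Finset.sum_congr rfl fun i _ => ?_
    rw [intervalIntegral.integral_smul_const, intervalIntegral.integral_of_le hI, pairing]
    congr 1
    exact integral_conj

/-- The kernel of the quantum stochastic evolution over an interval. -/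
def kernel (I : ℝ × ℝ) (f g : Label h) : K →L[ℂ] K :=
  -- The maximum makes a reversed pair degenerate, so that locality holds for all pairs related by
  -- `Disj` without a condition on their order.
  prop (gen G M β f.1 g.1) I.1 (max I.1 I.2)

theorem kernel_of_le {I : ℝ × ℝ} (hI : I.1 ≤ I.2) (f g : Label h) :
    kernel G M β I f g = prop (gen G M β f.1 g.1) I.1 I.2 := by
  rw [kernel, max_eq_right hI]

theorem add_kick_apply_of_disj (b : h) {I J : ℝ × ℝ} (hIJ : Disj I J) (f : Label h) {r : ℝ}
    (hr : r ∈ Set.Ioc I.1 (max I.1 I.2)) : (f + kick b J).1 r = f.1 r := by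
  have hr' : r ∈ Set.Ioc I.1 I.2 := ⟨hr.1, by
    rcases le_max_iff.mp hr.2 with h' | h'
    · exact absurd hr.1 (not_lt.mpr h')
    · exact h'⟩
  have : r ∉ Set.Ioc J.1 J.2 := fun h' => Set.disjoint_left.mp hIJ hr' h'
  change f.1 r + (kick b J).1 r = f.1 r
  rw [kick_apply, Set.indicator_of_notMem this, add_zero]

theorem kernel_add_kick_left {I J : ℝ × ℝ} (hIJ : Disj I J) (f g : Label h) (b : h) :
    kernel G M β I (f + kick b J) g = kernel G M β I f g := by
  obtain ⟨C, hC⟩ := exists_isGenerator_gen G M β f g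
  obtain ⟨C', hC'⟩ := exists_isGenerator_gen G M β (f + kick b J) g
  refine prop_congr hC' hC (le_max_left _ _) fun r hr => ?_
  rw [gen, gen, add_kick_apply_of_disj b hIJ f hr]

theorem kernel_add_kick_right {I J : ℝ × ℝ} (hIJ : Disj I J) (f g : Label h) (b : h) :
    kernel G M β I f (g + kick b J) = kernel G M β I f g := by
  obtain ⟨C, hC⟩ := exists_isGenerator_gen G M β f g
  obtain ⟨C', hC'⟩ := exists_isGenerator_gen G M β f (g + kick b J)
  refine prop_congr hC' hC (le_max_left _ _) fun r hr => ?_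
  rw [gen, gen, add_kick_apply_of_disj b hIJ g hr]

/-- The labels may depend on the interval under a common bound, because this is also needed for
labels kicked on the interval itself. -/
theorem isBigO_kernel {f g : ℝ × ℝ → Label h} {C : ℝ} (hf : ∀ I s, ‖(f I).1 s‖ ≤ C)
    (hg : ∀ I s, ‖(g I).1 s‖ ≤ C) :
    (fun I => kernel G M β I (f I) (g I) - (1 + linPart G M β (f I) (g I) I)) =O[shortIntervals]
      fun I => (I.2 - I.1) ^ 2 := by
  set B := genBound G M β C with hB
  refine IsBigO.of_bound (B ^ 2 * Real.exp B) ?_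
  have h1 : ∀ᶠ I in shortIntervals, I.2 - I.1 ≤ 1 :=
    tendsto_length.eventually (eventually_le_nhds one_pos)
  filter_upwards [eventually_le, h1] with I hI hI1
  have hE := isGenerator_gen G M β (hf I) (hg I)
  rw [kernel_of_le G M β hI, ← integral_gen G M β _ _ hI]
  refine (norm_prop_sub_sub_le ContinuousLinearMap.norm_id_le hE hI).trans ?_
  rw [Real.norm_of_nonneg (sq_nonneg _)]
  have hB0 := hE.nonneg
  gcongr
  exact mul_le_of_le_one_right hB0 hI1

theorem exists_bound_add_kick (f g : Label h) (b : h) :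
    ∃ C, (∀ I s, ‖(f + kick b I).1 s‖ ≤ C) ∧ ∀ s, ‖g.1 s‖ ≤ C := by
  obtain ⟨C, hf, hg⟩ := exists_bound₂ f g
  refine ⟨C + ‖b‖, fun I s => ?_, fun s => (hg s).trans (by linarith [norm_nonneg b])⟩
  exact (norm_add_le _ _).trans (add_le_add (hf s) (norm_indicator_le_norm_self (fun _ : ℝ => b) s))

variable {β}

theorem pairing_add_kick_self (hβ : Orthonormal ℂ β) {I : ℝ × ℝ} (hI : I.1 ≤ I.2) (f : Label h)
    (i j : m) : pairing (β j) I (f + kick (β i) I) =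
      pairing (β j) I f + if j = i then ((I.2 - I.1 : ℝ) : ℂ) else 0 := by
  rw [pairing_add, pairing_kick_self _ _ hI, orthonormal_iff_ite.mp hβ, mul_ite, mul_one, mul_zero]

theorem linPart_add_kick_left (hβ : Orthonormal ℂ β) {I : ℝ × ℝ} (hI : I.1 ≤ I.2) (f g : Label h)
    (i : m) : linPart G M β (f + kick (β i) I) g I =
      linPart G M β f g I + ((I.2 - I.1 : ℝ) : ℂ) • M i := by
  simp only [linPart, pairing_add_kick_self hβ hI, star_add, add_smul, Finset.sum_add_distrib,
    apply_ite star, star_zero, ite_smul, zero_smul, Finset.sum_ite_eq', Finset.mem_univ, if_true,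
    add_assoc]
  rw [Complex.star_def, Complex.conj_ofReal]

theorem linPart_add_kick_right (hβ : Orthonormal ℂ β) {I : ℝ × ℝ} (hI : I.1 ≤ I.2) (f g : Label h)
    (i : m) : linPart G M β f (g + kick (β i) I) I =
      linPart G M β f g I - ((I.2 - I.1 : ℝ) : ℂ) • star (M i) := by
  simp only [linPart, drift, pairing_add_kick_self hβ hI, add_smul, Finset.sum_add_distrib,
    ite_smul, zero_smul, Finset.sum_ite_eq', Finset.mem_univ, if_true]
  abel

/-- Taking adjoints exchanges the labels and replaces `(G, M)` by `(G^*, -M)`, so the adjoint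
evolution is again of the same kind. -/
theorem star_linPart (β : m → h) (f g : Label h) (I : ℝ × ℝ) :
    star (linPart G M β g f I) = linPart (star G) (-M) β f g I := by
  simp only [linPart, drift, star_add, star_sub, star_sum, star_smul, star_star, Pi.neg_apply,
    star_neg, smul_neg, Finset.sum_neg_distrib, Complex.star_def, Complex.conj_ofReal,
    Complex.conj_conj]
  abel

/-- The partition of an interval into intervals of equal length. -/
def grid (s t : ℝ) (N : ℕ) : List (ℝ × ℝ) :=
  (List.range N).map fun k : ℕ => ((s + k * ((t - s) / N) : ℝ), (s + (k + 1) * ((t - s) / N) : ℝ))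

theorem isGrid_grid {s t : ℝ} (hst : s ≤ t) : IsGrid (t - s) (grid s t) := by
  refine ⟨sub_nonneg.mpr hst, fun N => by simp [grid], fun N I hI => ?_⟩
  obtain ⟨k, -, rfl⟩ := List.mem_map.mp hI
  ring

theorem pairwise_grid {s t : ℝ} (hst : s ≤ t) (N : ℕ) : (grid s t N).Pairwise Disj := by
  rw [grid, List.pairwise_map]
  refine List.pairwise_lt_range.imp fun {j k} hjk => ?_
  rw [Disj, Set.disjoint_left]
  intro x hx hx'
  have h1 : (j : ℝ) + 1 ≤ k := by exact_mod_cast hjk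
  have h2 : 0 ≤ (t - s) / N := div_nonneg (sub_nonneg.mpr hst) N.cast_nonneg
  have := mul_le_mul_of_nonneg_right h1 h2
  simp only [Set.mem_Ioc] at hx hx'
  linarith [hx.2, hx'.1]

theorem grid_subset {s t : ℝ} (hst : s ≤ t) {N : ℕ} {I : ℝ × ℝ} (hI : I ∈ grid s t N) :
    s ≤ I.1 ∧ I.2 ≤ t := by
  obtain ⟨k, hk, rfl⟩ := List.mem_map.mp hI
  have hk' : k < N := List.mem_range.mp hk
  have hN : (0 : ℝ) < N := by exact_mod_cast (Nat.zero_le k).trans_lt hk'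
  have h1 : (k : ℝ) + 1 ≤ N := by exact_mod_cast hk'
  have h2 : 0 ≤ (t - s) / N := div_nonneg (sub_nonneg.mpr hst) N.cast_nonneg
  have h3 := mul_le_mul_of_nonneg_right h1 h2
  have h4 : (N : ℝ) * ((t - s) / N) = t - s := by field_simp
  have h5 : 0 ≤ (k : ℝ) * ((t - s) / N) := by positivity
  exact ⟨by simpa using h5, by simp only; linarith⟩

variable (β)

theorem prod_kernel_grid {s t : ℝ} (hst : s ≤ t) (f g : Label h) {N : ℕ} (hN : 0 < N) :
    prop (gen G M β f.1 g.1) s t =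
      ((grid s t N).map fun I => kernel G M β I f g).reverse.prod := by
  obtain ⟨C, hC⟩ := exists_isGenerator_gen G M β f g
  have h2 : 0 ≤ (t - s) / N := div_nonneg (sub_nonneg.mpr hst) N.cast_nonneg
  have key : ∀ n : ℕ, (((List.range n).map fun k : ℕ => ((s + k * ((t - s) / N) : ℝ),
      (s + (k + 1) * ((t - s) / N) : ℝ))).map fun I => kernel G M β I f g).reverse.prod =
      prop (gen G M β f.1 g.1) s (s + n * ((t - s) / N)) := by
    intro n
    induction n with
    | zero => simp [prop_self hC]
    | succ n ih =>
      rw [List.range_succ, List.map_append, List.map_append, List.reverse_append, List.prod_append,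
        ih]
      simp only [List.map_cons, List.map_nil, List.reverse_singleton, List.prod_singleton]
      rw [kernel_of_le _ _ _ (by simp only; linarith)]
      simp only
      have h3 : 0 ≤ (n : ℝ) * ((t - s) / N) := by positivity
      rw [prop_mul_prop hC (by linarith) (by linarith)]
      push_cast
      rfl
  have hN' : (N : ℝ) ≠ 0 := by exact_mod_cast hN.ne'
  rw [grid, key N, mul_div_cancel₀ _ hN', add_sub_cancel]

/-- A unitary operator with the kernels of the quantum stochastic evolution over an interval,
together with its approximation by the Euler scheme. -/
structure IsEvolution (s t : ℝ) (V : BigSpace K h →L[ℂ] BigSpace K h) : Prop where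
  unitary : V ∈ unitary (BigSpace K h →L[ℂ] BigSpace K h)
  inner_coh : ∀ f g ψ φ, inner ℂ (coh f ψ) (V (coh g φ)) =
    Complex.exp (inner ℂ (toVec f) (toVec g)) * inner ℂ ψ (prop (gen G M β f.1 g.1) s t φ)
  tendsto : ∀ g φ, Tendsto (fun N => euler G M β (grid s t N) g φ) atTop (𝓝 (V (coh g φ)))
  tendsto_star : ∀ g φ, Tendsto (fun N => euler (star G) (-M) β (grid s t N).reverse g φ) atTop
    (𝓝 (star V (coh g φ)))

theorem star_list_prod {R : Type*} [Monoid R] [StarMul R] (l : List R) :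
    star l.prod = (l.map star).reverse.prod := by
  induction l with
  | nil => simp
  | cons a l ih => simp [ih, List.prod_append]

variable {G M β}

/-- The coefficients `(G^*, -M)` satisfy the same condition, and the reversed grid orders the
adjoint kernels correctly. The two limiting isometries have mutually adjoint matrix elements on a
total set, and an isometry whose adjoint is an isometry is unitary. -/
theorem exists_isEvolution (hGM : G + star G + ∑ i, star (M i) * M i = 0) (hβ : Orthonormal ℂ β)
    {s t : ℝ} (hst : s ≤ t) : ∃ V, IsEvolution G M β s t V := by
  have hc : ∀ f g, (fun I => kernel G M β I f g - (1 + linPart G M β f g I)) =O[shortIntervals]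
      fun I => (I.2 - I.1) ^ 2 := fun f g => by
    obtain ⟨C, hf, hg⟩ := exists_bound₂ f g
    exact isBigO_kernel G M β (f := fun _ => f) (g := fun _ => g) (fun _ => hf) fun _ => hg
  obtain ⟨V, hV, hVe⟩ := exists_eulerLimit hGM hβ (isGrid_grid hst) (pairwise_grid hst)
    (kernel G M β) (fun I J hIJ f g i => kernel_add_kick_left G M β hIJ f g (β i)) hc
    (fun f g i => by
      obtain ⟨C, hf, hg⟩ := exists_bound_add_kick f g (β i)
      refine (isBigO_kernel G M β (f := fun I => f + kick (β i) I) (g := fun _ => g) hf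
        fun _ => hg).congr' ?_ EventuallyEq.rfl
      filter_upwards [eventually_le] with I hI
      rw [linPart_add_kick_left G M hβ hI, add_assoc])
    (fun f g => prop (gen G M β f.1 g.1) s t)
    (fun f g N hN => prod_kernel_grid G M β hst f g hN)
  have hGM' : star G + star (star G) + ∑ i, star ((-M) i) * (-M) i = 0 := by
    simpa [add_comm (star G)] using hGM
  obtain ⟨V', hV', hVe'⟩ := exists_eulerLimit hGM' hβ (isGrid_grid hst).reverse
    (fun N => List.pairwise_reverse.mpr ((pairwise_grid hst N).imp fun h' => h'.symm))
    (fun I f g => star (kernel G M β I g f))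
    (fun I J hIJ f g i => congrArg star (kernel_add_kick_right G M β hIJ g f (β i)))
    (fun f g => by
      refine (isBigO_star (hc g f)).congr_left fun I => ?_
      rw [star_sub, star_add, star_one, star_linPart])
    (fun f g i => by
      obtain ⟨C, hf, hg⟩ := exists_bound_add_kick f g (β i)
      refine (isBigO_star (isBigO_kernel G M β (f := fun _ => g) (g := fun I => f + kick (β i) I)
        (fun _ => hg) hf)).congr' ?_ EventuallyEq.rfl
      filter_upwards [eventually_le] with I hI
      rw [linPart_add_kick_right G M hβ hI, star_sub, star_add, star_sub, star_one, star_linPart,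
        star_smul, star_star, Complex.star_def, Complex.conj_ofReal, Pi.neg_apply, smul_neg,
        ← sub_eq_add_neg, add_sub_assoc])
    (fun f g => star (prop (gen G M β g.1 f.1) s t))
    (fun f g N hN => by
      rw [prod_kernel_grid G M β hst g f hN, star_list_prod, List.map_reverse, List.map_map,
        List.map_reverse]
      rfl)
  have hadj : star V.toContinuousLinearMap = V'.toContinuousLinearMap := by
    refine isTotal_coh.ext_clm fun p => isTotal_coh.ext_inner fun q => ?_
    rw [star_eq_adjoint, adjoint_inner_right]
    refine Eq.trans ?_ (hV' q.2 p.2 q.1 p.1).symm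
    rw [← inner_conj_symm]
    refine (congrArg (starRingEnd ℂ) (hV p.2 q.2 p.1 q.1)).trans ?_
    rw [map_mul, inner_conj_symm, ← Complex.exp_conj, inner_conj_symm, star_eq_adjoint,
      adjoint_inner_right]
  have hiso : ∀ W : BigSpace K h →ₗᵢ[ℂ] BigSpace K h,
      star W.toContinuousLinearMap * W.toContinuousLinearMap = 1 := fun W => by
    rw [star_eq_adjoint]
    exact (norm_map_iff_adjoint_comp_self _).mp W.norm_map
  refine ⟨V.toContinuousLinearMap, ⟨hiso V, ?_⟩, hV, hVe, ?_⟩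
  · have := hiso V'
    rw [← hadj] at this
    exact (congrArg (fun X => X * star V.toContinuousLinearMap)
      (star_star V.toContinuousLinearMap).symm).trans this
  · intro g φ
    rw [hadj]
    exact hVe' g φ

/-- Replace `V` by its Euler scheme and place the kernel of `V'` to the left of it. Kicks before
time `t` do not change that kernel, so the kernels multiply and the two propagators compose. -/
theorem IsEvolution.inner_comp {s t u : ℝ} (hst : s ≤ t) (htu : t ≤ u)
    {V V' : BigSpace K h →L[ℂ] BigSpace K h} (hV : IsEvolution G M β s t V)
    (hV' : IsEvolution G M β t u V') (f g : Label h) (ψ φ : K) :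
    inner ℂ (coh f ψ) (V' (V (coh g φ))) =
      Complex.exp (inner ℂ (toVec f) (toVec g)) * inner ℂ ψ (prop (gen G M β f.1 g.1) s u φ) := by
  obtain ⟨C, hf, hg⟩ := exists_bound₂ f g
  have hT := tendsto_weakStep (isGrid_grid hst) (isBigO_kernel G M β (f := fun _ => f)
    (g := fun _ => g) (fun _ => hf) fun _ => hg)
    fun N hN => prod_kernel_grid G M β hst f g hN
  have h1 : ∀ N, inner ℂ (coh f ψ) (V' (euler G M β (grid s t N) g φ)) =
      Complex.exp (inner ℂ (toVec f) (toVec g)) * inner ℂ ψ (prop (gen G M β f.1 g.1) t u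
        (((grid s t N).map (weakStep G M β f g)).reverse.prod φ)) := by
    intro N
    have h4 := weak_euler (G := G) (M := M) (β := β) f
      (adjoint (coh f : K →L[ℂ] BigSpace K h) ∘L V') (fun g => prop (gen G M β f.1 g.1) t u)
      (fun g => by
        ext φ
        refine ext_inner_left ℂ fun ψ => ?_
        rw [comp_apply, comp_apply, adjoint_inner_right, hV'.inner_coh, smul_apply,
          inner_smul_right]) (grid s t N) (pairwise_grid hst N)
      (fun J hJ g i => by
        have := kernel_add_kick_right G M β (I := (t, u)) (J := J) ?_ f g (β i)
        · rwa [kernel_of_le _ _ _ htu, kernel_of_le _ _ _ htu] at this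
        · rw [Disj, Set.disjoint_left]
          intro x hx hx'
          exact absurd hx.1 (not_lt.mpr (hx'.2.trans (grid_subset hst hJ).2))) g
    have h5 := congrArg (fun X : K →L[ℂ] K => inner ℂ ψ (X φ)) h4
    simp only [comp_apply, smul_apply, inner_smul_right] at h5
    rwa [adjoint_inner_right] at h5
  have h2 : Tendsto (fun N => inner ℂ (coh f ψ) (V' (euler G M β (grid s t N) g φ))) atTop
      (𝓝 (inner ℂ (coh f ψ) (V' (V (coh g φ))))) :=
    Tendsto.inner tendsto_const_nhds ((V'.continuous.tendsto _).comp (hV.tendsto g φ))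
  refine tendsto_nhds_unique h2 ?_
  simp only [h1]
  obtain ⟨C, hE⟩ := exists_isGenerator_gen G M β f g
  rw [← prop_mul_prop hE hst htu]
  refine Tendsto.const_mul _ (Tendsto.inner tendsto_const_nhds ?_)
  refine ((prop (gen G M β f.1 g.1) t u).continuous.tendsto _).comp ?_
  exact ((ContinuousLinearMap.apply ℂ K φ).continuous.tendsto _).comp hT

end Kernels

/-! ### From semigroups of unitaries to groups -/

section GroupExtension

/-- A one-parameter semigroup in a group extends to a one-parameter group. -/
theorem exists_group_extension {Γ : Type*} [Group Γ] (W : ℝ → Γ)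
    (hW : ∀ s t, 0 ≤ s → 0 ≤ t → W (s + t) = W s * W t) :
    ∃ U : ℝ → Γ, (∀ s t, U (s + t) = U s * U t) ∧ ∀ t, 0 ≤ t → U t = W t := by
  have hcomm : ∀ s t, 0 ≤ s → 0 ≤ t → Commute (W s) (W t) := fun s t hs ht => by
    rw [Commute, SemiconjBy, ← hW s t hs ht, add_comm, hW t s ht hs]
  have h0 : W 0 = 1 := by
    have := hW 0 0 le_rfl le_rfl
    rw [add_zero] at this
    exact left_eq_mul.mp this
  -- A time is split into positive and negative part; by `key` any other difference of nonnegative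
  -- times gives the same element, which makes additivity immediate.
  set U : ℝ → Γ := fun t => W (max t 0) * (W (max (-t) 0))⁻¹ with hU
  have key : ∀ t a b, 0 ≤ a → 0 ≤ b → t = a - b → U t = W a * (W b)⁻¹ := by
    intro t a b ha hb htab
    obtain ⟨c, hc, h1, h2⟩ : ∃ c, 0 ≤ c ∧ a = max t 0 + c ∧ b = max (-t) 0 + c := by
      rcases le_total a b with h' | h'
      · exact ⟨a, ha, by rw [max_eq_right (by linarith), zero_add],
          by rw [max_eq_left (by linarith)]; linarith⟩
      · exact ⟨b, hb, by rw [max_eq_left (by linarith)]; linarith,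
          by rw [max_eq_right (by linarith), zero_add]⟩
    rw [h1, h2, hW _ _ (le_max_right _ _) hc, hW _ _ (le_max_right _ _) hc, mul_inv_rev,
      mul_assoc, mul_inv_cancel_left]
  refine ⟨U, fun s t => ?_, fun t ht => ?_⟩
  · have h1 : ∀ s : ℝ, s = max s 0 - max (-s) 0 := fun s => by
      rcases le_total 0 s with h' | h'
      · rw [max_eq_left h', max_eq_right (by linarith), sub_zero]
      · rw [max_eq_right h', max_eq_left (by linarith)]; linarith
    have p : ∀ s : ℝ, 0 ≤ max s 0 := fun s => le_max_right _ _
    rw [key (s + t) (max s 0 + max t 0) (max (-s) 0 + max (-t) 0) (add_nonneg (p _) (p _))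
      (add_nonneg (p _) (p _)) (by linarith [h1 s, h1 t]), hW _ _ (p _) (p _), hW _ _ (p _) (p _),
      mul_inv_rev]
    have c1 := ((hcomm (max t 0) (max (-s) 0) (p _) (p _)).inv_right).eq
    have c2 := ((hcomm (max (-s) 0) (max (-t) 0) (p _) (p _)).inv_inv).eq
    rw [hU]
    simp only
    rw [mul_assoc, ← c2, ← mul_assoc (W (max t 0)), c1]
    simp only [mul_assoc]
  · rw [key t t 0 ht le_rfl (by ring), h0]
    simp

theorem exists_unitaryGroup_extension {Z : Type*} [NormedAddCommGroup Z] [InnerProductSpace ℂ Z]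
    [CompleteSpace Z] (W : ℝ → Z →L[ℂ] Z) (hu : ∀ t, 0 ≤ t → W t ∈ unitary (Z →L[ℂ] Z))
    (hW : ∀ s t, 0 ≤ s → 0 ≤ t → W (s + t) = W s * W t) :
    ∃ U : ℝ → Z →L[ℂ] Z, (∀ t, U t ∈ unitary (Z →L[ℂ] Z)) ∧ U 0 = 1 ∧
      (∀ s t, U (s + t) = U s ∘L U t) ∧ (∀ t, U (-t) = ContinuousLinearMap.adjoint (U t)) ∧
      ∀ t, 0 ≤ t → U t = W t := by
  have hpos : ∀ t : ℝ, 0 ≤ max t 0 := fun t => le_max_right _ _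
  obtain ⟨U, hUadd, hUW⟩ := exists_group_extension
    (fun t => (⟨W (max t 0), hu _ (hpos t)⟩ : unitary (Z →L[ℂ] Z))) fun s t hs ht => by
      refine Subtype.ext ?_
      simp only [max_eq_left hs, max_eq_left ht, max_eq_left (add_nonneg hs ht)]
      exact hW s t hs ht
  have hU0 : U 0 = 1 := by
    have := hUadd 0 0
    rw [add_zero] at this
    exact left_eq_mul.mp this
  refine ⟨fun t => (U t).1, fun t => (U t).2, congrArg Subtype.val hU0,
    fun s t => congrArg Subtype.val (hUadd s t), fun t => ?_, fun t ht => ?_⟩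
  · have h1 : U (-t) * U t = 1 := by rw [← hUadd, neg_add_cancel, hU0]
    exact congrArg Subtype.val (eq_inv_of_mul_eq_one_left h1)
  · simp only [hUW t ht, max_eq_left ht]

end GroupExtension

/-! ### Translations in time and the unitary group -/

section Group

open ContinuousLinearMap Asymptotics

variable {K h m : Type*} [NormedAddCommGroup K] [InnerProductSpace ℂ K] [CompleteSpace K]
  [NormedAddCommGroup h] [InnerProductSpace ℂ h] [CompleteSpace h] [Fintype m] [DecidableEq m]

/-- The translation of functions of time. -/
def shift (t : ℝ) (φ : Label h) : Label h :=
  ⟨fun s => φ.1 (s + t), φ.2.1.comp_measurePreserving (measurePreserving_add_right volume t),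
    φ.2.2.imp fun _ hC s => hC (s + t)⟩

theorem shift_apply (t : ℝ) (φ : Label h) (s : ℝ) : (shift t φ).1 s = φ.1 (s + t) := rfl

theorem shift_shift (s t : ℝ) (φ : Label h) : shift s (shift t φ) = shift (s + t) φ :=
  Subtype.ext (funext fun r => by rw [shift_apply, shift_apply, shift_apply, add_assoc])

theorem shift_zero_right (t : ℝ) : shift t (0 : Label h) = 0 := rfl

theorem shift_zero (φ : Label h) : shift 0 φ = φ :=
  Subtype.ext (funext fun r => by rw [shift_apply, add_zero])

theorem shift_timeLabel (t : ℝ) (f : intDomain h) :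
    shift (-t) (timeLabel f) = timeLabel (phase t f) :=
  Subtype.ext (funext fun s => by
    rw [shift_apply, timeLabel_apply, timeLabel_apply, timeFn_phase, sub_eq_add_neg])

theorem inner_shift_shift (t : ℝ) (φ χ : Label h) :
    inner ℂ (toVec (shift t φ)) (toVec (shift t χ)) = inner ℂ (toVec φ) (toVec χ) := by
  rw [inner_toVec, inner_toVec]
  exact integral_add_right_eq_self (fun s => inner ℂ (φ.1 s) (χ.1 s)) t

theorem inner_shift (t : ℝ) (φ χ : Label h) :
    inner ℂ (toVec (shift (-t) φ)) (toVec χ) = inner ℂ (toVec φ) (toVec (shift t χ)) := by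
  rw [← inner_shift_shift t, shift_shift, add_neg_cancel, shift_zero]

/-- The second quantization of the translations. -/
theorem exists_shiftOp (K : Type*) [NormedAddCommGroup K] [InnerProductSpace ℂ K]
    [CompleteSpace K] (h : Type*) [NormedAddCommGroup h] [InnerProductSpace ℂ h]
    [CompleteSpace h] : ∃ Γ : ℝ → BigSpace K h →L[ℂ] BigSpace K h,
    (∀ t, Γ t ∈ unitary (BigSpace K h →L[ℂ] BigSpace K h)) ∧
    (∀ s t, Γ (s + t) = Γ s * Γ t) ∧
    ∀ t φ ψ, Γ t (coh φ ψ) = coh (shift t φ) ψ := by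
  have h1 : ∀ t : ℝ, ∃ V : BigSpace K h →ₗᵢ[ℂ] BigSpace K h, ∀ p : K × Label h,
      V (coh p.2 p.1) = coh (shift t p.2) p.1 := fun t =>
    isTotal_coh.exists_isometry (w := fun p : K × Label h => (coh (shift t p.2) p.1 : BigSpace K h))
      fun p q => by rw [inner_coh, inner_coh, inner_shift_shift]
  choose V hV using h1
  have hadd : ∀ s t, (V (s + t)).toContinuousLinearMap =
      (V s).toContinuousLinearMap * (V t).toContinuousLinearMap := fun s t => by
    refine isTotal_coh.ext_clm fun p => ?_
    change V (s + t) (coh p.2 p.1) = V s (V t (coh p.2 p.1))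
    rw [hV, hV, hV s (p.1, shift t p.2), shift_shift]
  have h0 : (V 0).toContinuousLinearMap = 1 := by
    refine isTotal_coh.ext_clm fun p => ?_
    change V 0 (coh p.2 p.1) = coh p.2 p.1
    rw [hV, shift_zero]
  refine ⟨fun t => (V t).toContinuousLinearMap, fun t => ?_, hadd, fun t φ ψ => hV t (ψ, φ)⟩
  have hiso : star (V t).toContinuousLinearMap * (V t).toContinuousLinearMap = 1 :=
    (norm_map_iff_adjoint_comp_self _).mp (V t).norm_map
  have hinv : (V t).toContinuousLinearMap * (V (-t)).toContinuousLinearMap = 1 := by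
    rw [← hadd, add_neg_cancel, h0]
  refine ⟨hiso, ?_⟩
  have : star (V t).toContinuousLinearMap = (V (-t)).toContinuousLinearMap :=
    left_inv_eq_right_inv hiso hinv
  rw [this, hinv]

variable {G : K →L[ℂ] K} {M : m → K →L[ℂ] K} {β : m → h}

theorem gen_shift (t : ℝ) (f g : Label h) (r : ℝ) :
    gen G M β f.1 (shift t g).1 r = gen G M β (shift (-t) f).1 g.1 (r + t) := by
  rw [gen, gen, shift_apply, shift_apply, add_neg_cancel_right]

/-- For isometries `‖U v - v‖² = 2 ‖v‖² - 2 Re ⟪v, U v⟫`, so diagonal matrix elements decide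
continuity on the family. The convergent vectors form a closed set, negative times follow from
`‖U(-t) z - z‖ = ‖U(t) z - z‖`, and the group law moves continuity away from zero. -/
theorem continuous_of_group {Z : Type*} [NormedAddCommGroup Z] [InnerProductSpace ℂ Z]
    [CompleteSpace Z] {X : Type*} {v : X → Z} (hv : IsTotal v) {U : ℝ → Z →L[ℂ] Z}
    (hu : ∀ t z, ‖U t z‖ = ‖z‖) (hadd : ∀ s t z, U (s + t) z = U s (U t z)) (h0 : U 0 = 1)
    (h : ∀ i, Tendsto (fun t => inner ℂ (v i) (U t (v i))) (𝓝[≥] 0) (𝓝 (inner ℂ (v i) (v i))))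
    (z : Z) : Continuous fun t => U t z := by
  have hneg : ∀ t z, ‖U (-t) z - z‖ = ‖U t z - z‖ := fun t z => by
    rw [← hu t (U (-t) z - z), map_sub, ← hadd, add_neg_cancel, h0, ← norm_neg]
    simp
  have hset : IsClosed {z : Z | Tendsto (fun t => U t z) (𝓝[≥] 0) (𝓝 z)} := by
    refine isClosed_of_closure_subset fun z hz => ?_
    rw [Set.mem_ofPred_eq, Metric.tendsto_nhds]
    intro ε hε
    obtain ⟨y, hy, hyz⟩ := Metric.mem_closure_iff.mp hz (ε / 3) (by positivity)
    filter_upwards [(Metric.tendsto_nhds.mp hy) (ε / 3) (by positivity)] with t ht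
    have h1 : dist (U t z) (U t y) = dist z y := by
      rw [dist_eq_norm, dist_eq_norm, ← map_sub, hu]
    calc dist (U t z) z ≤ dist (U t z) (U t y) + dist (U t y) y + dist y z :=
          dist_triangle4 _ _ _ _
      _ < ε := by rw [h1, dist_comm y z]; linarith
  have hright : ∀ z, Tendsto (fun t => U t z) (𝓝[≥] 0) (𝓝 z) := by
    intro z
    refine hv.induction (P := fun z => Tendsto (fun t => U t z) (𝓝[≥] 0) (𝓝 z)) ?_ hset z
    intro z hz
    induction hz using Submodule.span_induction with
    | mem z hz =>
      obtain ⟨i, rfl⟩ := hz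
      rw [tendsto_iff_norm_sub_tendsto_zero]
      have h1 : ∀ t, ‖U t (v i) - v i‖ =
          Real.sqrt (2 * ‖v i‖ ^ 2 - 2 * (inner ℂ (v i) (U t (v i))).re) := by
        intro t
        rw [← Real.sqrt_sq (norm_nonneg (U t (v i) - v i)), @norm_sub_sq ℂ, hu, inner_re_symm]
        congr 1
        change ‖v i‖ ^ 2 - 2 * (inner ℂ (v i) (U t (v i))).re + ‖v i‖ ^ 2 = _
        ring
      simp only [h1]
      have h2 := (((Complex.continuous_re.tendsto _).comp (h i)).const_mul 2).const_sub
        (2 * ‖v i‖ ^ 2)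
      have h3 := h2.sqrt
      have h4 : 2 * ‖v i‖ ^ 2 - 2 * (inner ℂ (v i) (v i)).re = 0 := by
        rw [inner_self_eq_norm_sq_to_K]
        change 2 * ‖v i‖ ^ 2 - 2 * (((‖v i‖ : ℝ) : ℂ) ^ 2).re = 0
        rw [← Complex.ofReal_pow, Complex.ofReal_re, sub_self]
      rw [h4, Real.sqrt_zero] at h3
      exact h3
    | zero => simp
    | add x y _ _ hx hy => simpa using hx.add hy
    | smul c x _ hx => simpa using hx.const_smul c
  have hzero : ∀ z, Tendsto (fun t => U t z) (𝓝 0) (𝓝 z) := by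
    intro z
    rw [tendsto_iff_norm_sub_tendsto_zero]
    have h1 := tendsto_iff_norm_sub_tendsto_zero.mp (hright z)
    have h2 : ∀ t, ‖U t z - z‖ = ‖U |t| z - z‖ := fun t => by
      rcases abs_choice t with h' | h' <;> rw [h']
      rw [hneg]
    refine Tendsto.congr (fun t => (h2 t).symm) ?_
    refine h1.comp (tendsto_nhdsWithin_iff.mpr ⟨?_, Eventually.of_forall fun t => abs_nonneg t⟩)
    simpa using (continuous_abs.tendsto (0 : ℝ))
  rw [continuous_iff_continuousAt]
  intro t
  have h1 : (fun s => U s z) = fun s => U (s - t) (U t z) := by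
    ext s
    rw [← hadd, sub_add_cancel]
  rw [ContinuousAt, h1]
  refine (hzero (U t z)).comp ?_
  simpa using (continuous_sub_right t).tendsto t

theorem tendsto_inner_phase (f : intDomain h) :
    Tendsto (fun t : ℝ => inner ℂ (phase t f).1 f.1) (𝓝 0) (𝓝 (inner ℂ f.1 f.1)) := by
  have h1 : ∀ t, inner ℂ (phase t f).1 f.1 =
      ∫ x : ℝ, inner ℂ (Complex.exp (Complex.I * t * x) • f.1 x) (f.1 x) := by
    intro t
    rw [L2.inner_def]
    refine integral_congr_ae ?_
    filter_upwards [(memLp_phase t f.1).coeFn_toLp] with x hx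
    exact congrArg (fun y => inner ℂ y (f.1 x)) hx
  simp only [h1]
  rw [L2.inner_def]
  have hInt : Integrable (fun x => ‖f.1 x‖ ^ 2) volume := (Lp.memLp f.1).integrable_norm_pow (by norm_num)
  refine tendsto_integral_filter_of_dominated_convergence (fun x => ‖f.1 x‖ ^ 2) ?_ ?_ hInt ?_
  · exact Eventually.of_forall fun t =>
      ((continuous_phase t).aestronglyMeasurable.smul (Lp.aestronglyMeasurable f.1)).inner
        (Lp.aestronglyMeasurable f.1)
  · refine Eventually.of_forall fun t => Eventually.of_forall fun x => ?_
    refine (norm_inner_le_norm _ _).trans (le_of_eq ?_)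
    rw [norm_smul, norm_phase, one_mul, sq]
  · refine Eventually.of_forall fun x => ?_
    refine Tendsto.inner ?_ tendsto_const_nhds
    have : Continuous fun t : ℝ => Complex.exp (Complex.I * t * x) • f.1 x := by fun_prop
    simpa using this.tendsto 0

theorem isTotal_coh_timeLabel :
    IsTotal fun p : K × intDomain h => (coh (timeLabel p.2) p.1 : BigSpace K h) := by
  have := isTotal_expVec (K := K) (fun f : intDomain h => f.1) denseRange_intDomain
  simpa only [coh, toVec_timeLabel] using this

theorem tendsto_prop_shift (f : Label h) :
    Tendsto (fun t => prop (gen G M β (shift (-t) f).1 f.1) 0 t) (𝓝[≥] 0) (𝓝 1) := by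
  obtain ⟨C, hC⟩ := f.2.2
  have h1 : ∀ t : ℝ, 0 ≤ t → ‖prop (gen G M β (shift (-t) f).1 f.1) 0 t - 1‖ ≤
      genBound G M β C * Real.exp (genBound G M β C * (t - 0)) * (t - 0) := fun t ht =>
    norm_prop_sub_le ContinuousLinearMap.norm_id_le
      (isGenerator_gen G M β (f := shift (-t) f) (fun s => hC (s + -t)) hC) ht
  generalize genBound G M β C = B at h1
  rw [tendsto_iff_norm_sub_tendsto_zero]
  have h2 : Tendsto (fun t : ℝ => B * Real.exp (B * (t - 0)) * (t - 0)) (𝓝[≥] 0) (𝓝 0) := by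
    have : Continuous fun t : ℝ => B * Real.exp (B * (t - 0)) * (t - 0) := by fun_prop
    have := (this.tendsto 0).mono_left (nhdsWithin_le_nhds (s := Set.Ici 0))
    rwa [sub_zero, mul_zero] at this
  refine squeeze_zero' (Eventually.of_forall fun _ => norm_nonneg _) ?_ h2
  filter_upwards [eventually_mem_nhdsWithin] with t ht
  exact h1 t ht

-- With `Γ t` the second quantized translation and `V s t` the evolution, put `U t = Γ t V 0 t`. The
-- covariance `V 0 s Γ t = Γ t V t (s + t)` and the cocycle identity `V t (s + t) V 0 t = V 0 (s +
-- t)` give the semigroup law. The last clause holds because the vacuum is translation invariant, so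
-- `U (-t)` acts on it as the adjoint of `V 0 t`, the limit of the dual scheme.
set_option maxHeartbeats 1000000 in
theorem exists_unitaryGroup (hGM : G + star G + ∑ i, star (M i) * M i = 0)
    (hβ : Orthonormal ℂ β) : ∃ U : ℝ → BigSpace K h →L[ℂ] BigSpace K h,
    (∀ t, U t ∈ unitary (BigSpace K h →L[ℂ] BigSpace K h)) ∧
    U 0 = 1 ∧ (∀ s t, U (s + t) = U s ∘L U t) ∧ (∀ z, Continuous fun t => U t z) ∧
    (∀ t, U (-t) = adjoint (U t)) ∧
    (∀ t, 0 ≤ t → ∀ f g ψ φ, inner ℂ (coh f ψ) (U t (coh g φ)) =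
      Complex.exp (inner ℂ (toVec (shift (-t) f)) (toVec g)) *
        inner ℂ ψ (prop (gen G M β (shift (-t) f).1 g.1) 0 t φ)) ∧
    ∀ t, 0 ≤ t → ∀ φ, Tendsto (fun N => euler (star G) (-M) β (grid 0 t N).reverse 0 φ) atTop
      (𝓝 (U (-t) (coh 0 φ))) := by
  obtain ⟨Γ, hΓu, hΓadd, hΓ⟩ := exists_shiftOp K h
  -- For `s > t` the operator `1` is a filler; only ordered pairs are used.
  have hex : ∀ s t : ℝ, ∃ V, s ≤ t → IsEvolution G M β s t V := fun s t => by
    by_cases hst : s ≤ t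
    · obtain ⟨V, hV⟩ := exists_isEvolution hGM hβ hst
      exact ⟨V, fun _ => hV⟩
    · exact ⟨1, fun h' => absurd h' hst⟩
  choose V hV using hex
  have hΓ0 : Γ 0 = 1 := isTotal_coh.ext_clm fun p => by
    rw [hΓ, shift_zero]
    rfl
  have hΓinner : ∀ t f ψ z, inner ℂ (coh f ψ) (Γ t z) = inner ℂ (coh (shift (-t) f) ψ) z := by
    intro t f ψ z
    have h1 : coh f ψ = Γ t (coh (shift (-t) f) ψ) := by
      rw [hΓ, shift_shift, add_neg_cancel, shift_zero]
    rw [h1, ← adjoint_inner_right]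
    have := congrArg (fun X : BigSpace K h →L[ℂ] BigSpace K h => X z) (hΓu t).1
    exact congrArg _ this
  have hcov : ∀ s t, 0 ≤ s → V 0 s * Γ t = Γ t * V t (s + t) := by
    intro s t hs
    refine isTotal_coh.ext_clm fun p => isTotal_coh.ext_inner fun q => ?_
    change inner ℂ (coh q.2 q.1) (V 0 s (Γ t (coh p.2 p.1))) =
      inner ℂ (coh q.2 q.1) (Γ t (V t (s + t) (coh p.2 p.1)))
    rw [hΓ, (hV 0 s hs).inner_coh, hΓinner, (hV t (s + t) (by linarith)).inner_coh, inner_shift]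
    congr 2
    have h1 : gen G M β q.2.1 (shift t p.2).1 =
        fun r => gen G M β (shift (-t) q.2).1 p.2.1 (r + t) :=
      funext fun r => gen_shift t q.2 p.2 r
    obtain ⟨C, hC⟩ := exists_isGenerator_gen G M β (shift (-t) q.2) p.2
    rw [h1, prop_shift hC hs, zero_add]
  have hcoc : ∀ s t, 0 ≤ s → 0 ≤ t → V t (s + t) * V 0 t = V 0 (s + t) := by
    intro s t hs ht
    refine isTotal_coh.ext_clm fun p => isTotal_coh.ext_inner fun q => ?_
    rw [(hV 0 (s + t) (by linarith)).inner_coh]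
    exact (hV 0 t ht).inner_comp ht (by linarith) (hV t (s + t) (by linarith)) _ _ _ _
  obtain ⟨U, hUu, hU0, hUadd, hUneg, hU1⟩ := exists_unitaryGroup_extension (fun t => Γ t * V 0 t)
    (fun t ht => mul_mem (hΓu t) (hV 0 t ht).unitary) fun s t hs ht => by
      rw [← hcoc s t hs ht, hΓadd]
      calc Γ s * Γ t * (V t (s + t) * V 0 t) = Γ s * (Γ t * V t (s + t)) * V 0 t := by
            simp only [mul_assoc]
        _ = _ := by rw [← hcov s t hs]; simp only [mul_assoc]
  have hker : ∀ t, 0 ≤ t → ∀ f g ψ φ, inner ℂ (coh f ψ) (U t (coh g φ)) =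
      Complex.exp (inner ℂ (toVec (shift (-t) f)) (toVec g)) *
        inner ℂ ψ (prop (gen G M β (shift (-t) f).1 g.1) 0 t φ) := by
    intro t ht f g ψ φ
    rw [hU1 t ht]
    exact (hΓinner t f ψ _).trans ((hV 0 t ht).inner_coh _ _ _ _)
  refine ⟨U, hUu, hU0, hUadd, ?_, hUneg, hker, ?_⟩
  · refine continuous_of_group isTotal_coh_timeLabel (U := U) (fun t z => ?_)
      (fun s t z => ?_) hU0 ?_
    · exact (norm_map_iff_adjoint_comp_self _).mpr (hUu t).1 z
    · rw [hUadd]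
      rfl
    · rintro ⟨ψ, f⟩
      have hev : ∀ᶠ t in 𝓝[≥] (0 : ℝ), inner ℂ (coh (timeLabel f) ψ)
          (U t (coh (timeLabel f) ψ)) = Complex.exp (inner ℂ (phase t f).1 f.1) *
          inner ℂ ψ (prop (gen G M β (shift (-t) (timeLabel f)).1 (timeLabel f).1) 0 t ψ) := by
        filter_upwards [eventually_mem_nhdsWithin] with t ht
        rw [hker t ht, shift_timeLabel, toVec_timeLabel, toVec_timeLabel]
      refine Tendsto.congr' (hev.mono fun t ht => ht.symm) ?_
      change Tendsto _ _ (𝓝 (inner ℂ (coh (timeLabel f) ψ) (coh (timeLabel f) ψ)))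
      rw [inner_coh, toVec_timeLabel]
      refine Tendsto.mul ((Complex.continuous_exp.tendsto _).comp
        ((tendsto_inner_phase f).mono_left nhdsWithin_le_nhds)) ?_
      refine Tendsto.inner tendsto_const_nhds ?_
      exact ((ContinuousLinearMap.apply ℂ K ψ).continuous.tendsto 1).comp
        (tendsto_prop_shift _)
  · intro t ht φ
    have h1 : U (-t) (coh 0 φ) = star (V 0 t) (coh 0 φ) := by
      refine ext_inner_right ℂ fun z => ?_
      rw [hUneg, adjoint_inner_left, hU1 t ht]
      refine (hΓinner t 0 φ _).trans ?_
      rw [shift_zero_right, star_eq_adjoint, adjoint_inner_left]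
      rfl
    rw [h1]
    exact (hV 0 t ht).tendsto_star 0 φ

end Group

/-! ### Reduction to finitely many noise directions -/

section Noise

open ContinuousLinearMap

variable {K h m : Type*} [NormedAddCommGroup K] [InnerProductSpace ℂ K] [CompleteSpace K]
  [NormedAddCommGroup h] [InnerProductSpace ℂ h] [CompleteSpace h]

theorem adjoint_tmulRight_comp (b b' : h) :
    adjoint (tmulRight b : K →L[ℂ] HTensor K h) ∘L tmulRight b' =
      (inner ℂ b b' : ℂ) • (1 : K →L[ℂ] K) := by
  ext φ
  refine ext_inner_left ℂ fun ψ => ?_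
  rw [comp_apply, adjoint_inner_right, inner_tmulRight, smul_apply, inner_smul_right, mul_comm]
  rfl

/-- An operator from a finite dimensional space `K` to `K ⊗ h` has finitely many components. -/
theorem exists_noise_decomposition [FiniteDimensional ℂ K] (ν : K →L[ℂ] HTensor K h) :
    ∃ (n : ℕ) (β : Fin n → h), Orthonormal ℂ β ∧
      ν = ∑ i, (tmulRight (β i) : K →L[ℂ] HTensor K h) ∘L component ν (β i) := by
  set e := stdOrthonormalBasis ℂ K
  -- The partial inner product of `ψ` with `ν φ`. It is sesquilinear, so its values on a basis of
  -- `K` span all its values, and an orthonormal basis of this finite dimensional span serves as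
  -- `β`.
  set u : K → K → h := fun ψ φ => adjoint (tmulLeft ψ : h →L[ℂ] HTensor K h) (ν φ) with hu
  have hinner : ∀ f ψ φ, inner ℂ f (u ψ φ) = inner ℂ (tmulRight f ψ) (ν φ) := fun f ψ φ => by
    rw [hu]
    exact adjoint_inner_right _ _ _
  set S : Submodule ℂ h := Submodule.span ℂ (Set.range fun p : _ × _ => u (e p.1) (e p.2)) with hS
  have hfin : FiniteDimensional ℂ S := FiniteDimensional.span_of_finite ℂ (Set.finite_range _)
  have hmem : ∀ ψ φ, u ψ φ ∈ S := by
    intro ψ φ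
    have h1 : u ψ φ = ∑ k, ∑ l, (star (inner ℂ (e k) ψ) * inner ℂ (e l) φ) • u (e k) (e l) := by
      refine ext_inner_left ℂ fun f => ?_
      rw [hinner]
      conv_lhs => rw [← e.sum_repr' ψ, ← e.sum_repr' φ]
      simp only [map_sum, map_smul, sum_inner, inner_sum, inner_smul_left, inner_smul_right, hinner]
      rw [Finset.sum_comm]
      refine Finset.sum_congr rfl fun k _ => ?_
      simp only [Finset.mul_sum]
      refine Finset.sum_congr rfl fun l _ => ?_
      rw [mul_assoc, mul_left_comm]
      rfl
    rw [h1]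
    exact Submodule.sum_mem _ fun k _ => Submodule.sum_mem _ fun l _ =>
      Submodule.smul_mem _ _ (Submodule.subset_span ⟨(k, l), rfl⟩)
  set b := stdOrthonormalBasis ℂ S
  refine ⟨_, fun i => (b i : h), b.orthonormal.comp_linearIsometry S.subtypeₗᵢ, ?_⟩
  ext φ
  rw [← sub_eq_zero]
  refine htensor_ext_zero fun ψ f => ?_
  have h2 : u ψ φ = ∑ i, inner ℂ (b i : h) (u ψ φ) • (b i : h) := by
    have := congrArg (Subtype.val : S → h) (b.sum_repr' ⟨u ψ φ, hmem ψ φ⟩)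
    rw [AddSubmonoidClass.coe_finsetSum] at this
    exact this.symm
  rw [inner_sub_right, ← hinner, h2, inner_sum, sum_apply, inner_sum, sub_eq_zero]
  refine Finset.sum_congr rfl fun i _ => ?_
  rw [inner_smul_right, hinner, comp_apply, inner_tmulRight, component, comp_apply]
  congr 1
  exact (adjoint_inner_right _ _ _).symm

variable [Fintype m] [DecidableEq m] {β : m → h} {ν : K →L[ℂ] HTensor K h}

/-- Any component is a combination of the finitely many along `β`; sums over a whole basis thereby
become Parseval sums. -/
theorem component_eq_sum (hν : ν = ∑ i, (tmulRight (β i) : K →L[ℂ] HTensor K h) ∘L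
    component ν (β i)) (b : h) : component ν b = ∑ i, (inner ℂ b (β i) : ℂ) • component ν (β i) := by
  conv_lhs => rw [component, hν, comp_finsetSum]
  refine Finset.sum_congr rfl fun i _ => ?_
  rw [← comp_assoc, adjoint_tmulRight_comp, smul_comp]
  rfl

theorem adjoint_comp_tensorOne_comp
    (hν : ν = ∑ i, (tmulRight (β i) : K →L[ℂ] HTensor K h) ∘L component ν (β i)) (A : K →L[ℂ] K) :
    adjoint ν ∘L tensorOne A ∘L ν = ∑ i, star (component ν (β i)) * A * component ν (β i) := by
  have h1 : tensorOne A ∘L ν = ∑ i, (tmulRight (β i) : K →L[ℂ] HTensor K h) ∘L A ∘L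
      component ν (β i) := by
    conv_lhs => rw [hν, comp_finsetSum]
    refine Finset.sum_congr rfl fun i _ => ?_
    ext φ
    exact tensorOne_tmulRight A (β i) _
  have h2 : ∀ b, adjoint ν ∘L (tmulRight b : K →L[ℂ] HTensor K h) = star (component ν b) :=
    fun b => by
      rw [component, star_eq_adjoint, adjoint_comp, adjoint_adjoint]
  rw [h1, comp_finsetSum]
  refine Finset.sum_congr rfl fun i _ => ?_
  rw [← comp_assoc, h2]
  rfl

theorem adjoint_comp_self_eq_sum
    (hν : ν = ∑ i, (tmulRight (β i) : K →L[ℂ] HTensor K h) ∘L component ν (β i)) :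
    adjoint ν ∘L ν = ∑ i, star (component ν (β i)) * component ν (β i) := by
  have := adjoint_comp_tensorOne_comp hν 1
  rw [tensorOne_one] at this
  simp only [mul_one] at this
  exact this

end Noise

/-! ### Dilation of the completely positive semigroup -/

section Dilation

open ContinuousLinearMap Asymptotics

variable {K h m : Type*} [NormedAddCommGroup K] [InnerProductSpace ℂ K] [CompleteSpace K]
  [NormedAddCommGroup h] [InnerProductSpace ℂ h] [CompleteSpace h] [Fintype m] [DecidableEq m]
  {G : K →L[ℂ] K} {M : m → K →L[ℂ] K} {β : m → h}

theorem pairing_zero (b : h) (I : ℝ × ℝ) : pairing b I 0 = 0 := by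
  have : ∀ s, ((0 : Label h).1 s) = 0 := fun s => rfl
  simp [pairing, this]

theorem gramMapLin_zero (I : ℝ × ℝ) (A : K →L[ℂ] K) :
    gramMapLin G M β 0 0 I A =
      ((I.2 - I.1 : ℝ) : ℂ) • (star G * A + A * G + ∑ i, star (M i) * A * M i) := by
  simp only [gramMapLin, gramLin, add_apply, sum_apply, smul_apply, mulLeftRight_apply, drift,
    pairing_zero, star_zero, zero_smul, Finset.sum_const_zero, sub_zero, add_zero, one_mul, mul_one,
    smul_add, Finset.smul_sum, star_smul, smul_mul_assoc, mul_smul_comm, Complex.star_def,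
    Complex.conj_ofReal]

/-- At the vacuum each one-step map agrees to second order with `exp (|I| 𝓛)`, and these
exponentials multiply exactly to `exp (τ 𝓛)`. -/
theorem tendsto_gram_zero {𝓛 : (K →L[ℂ] K) →L[ℂ] (K →L[ℂ] K)}
    (h𝓛 : ∀ A, 𝓛 A = star G * A + A * G + ∑ i, star (M i) * A * M i) {τ : ℝ}
    {L : ℕ → List (ℝ × ℝ)} (hL : IsGrid τ L) :
    Tendsto (fun N => ((L N).map (gramMap G M β 0 0)).prod) atTop
      (𝓝 (NormedSpace.exp ((τ : ℂ) • 𝓛))) := by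
  have hlin : ∀ I, gramMapLin G M β (0 : Label h) 0 I = ((I.2 - I.1 : ℝ) : ℂ) • 𝓛 := fun I => by
    ext1 A
    rw [gramMapLin_zero, smul_apply, h𝓛]
  have hexp : (fun I : ℝ × ℝ => NormedSpace.exp (((I.2 - I.1 : ℝ) : ℂ) • 𝓛) -
      (1 + gramMapLin G M β (0 : Label h) 0 I)) =O[shortIntervals] fun I => (I.2 - I.1) ^ 2 := by
    simp only [hlin]
    refine IsBigO.of_bound (‖𝓛‖ ^ 2 * Real.exp ‖𝓛‖) ?_
    have h1 : ∀ᶠ I in shortIntervals, I.2 - I.1 ≤ 1 :=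
      tendsto_length.eventually (eventually_le_nhds one_pos)
    filter_upwards [eventually_le, h1] with I hI hI1
    have hE : IsGenerator (fun _ : ℝ => 𝓛) ‖𝓛‖ := ⟨aestronglyMeasurable_const, fun _ => le_rfl⟩
    have := norm_prop_sub_sub_le ContinuousLinearMap.norm_id_le hE hI
    rw [prop_const 𝓛 hI, intervalIntegral.integral_const] at this
    refine this.trans ?_
    rw [Real.norm_of_nonneg (sq_nonneg _)]
    gcongr
    exact mul_le_of_le_one_right (norm_nonneg _) hI1
  have h1 := hL.tendsto_prod_sub (𝔸 := (K →L[ℂ] K) →L[ℂ] (K →L[ℂ] K))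
    ContinuousLinearMap.norm_id_le (a := gramMap G M β (0 : Label h) 0)
    (b := fun I => NormedSpace.exp (((I.2 - I.1 : ℝ) : ℂ) • 𝓛))
    (isBigO_sub_one (isBigO_gramMap G M β 0 0) (isBigO_gramMapLin G M β 0 0))
    (((isBigO_gramMap G M β 0 0).sub hexp).congr_left fun I => by abel)
  rw [← tendsto_sub_nhds_zero_iff]
  refine h1.congr' ?_
  filter_upwards [eventually_gt_atTop 0] with N hN
  have hN' : (N : ℂ) ≠ 0 := by exact_mod_cast hN.ne'
  have h2 : (L N).map (fun I => NormedSpace.exp (((I.2 - I.1 : ℝ) : ℂ) • 𝓛)) =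
      List.replicate N (NormedSpace.exp (((τ / N : ℝ) : ℂ) • 𝓛)) := by
    rw [List.map_congr_left (g := fun _ => NormedSpace.exp (((τ / N : ℝ) : ℂ) • 𝓛))
      fun I hI => by rw [hL.width N I hI], List.map_const', hL.length]
  have h3 : (τ : ℂ) • 𝓛 = N • (((τ / N : ℝ) : ℂ) • 𝓛) := by
    rw [← Nat.cast_smul_eq_nsmul ℂ, smul_smul]
    congr 1
    push_cast
    field_simp
  let _ := NormedAlgebra.restrictScalars ℚ ℂ ((K →L[ℂ] K) →L[ℂ] (K →L[ℂ] K))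
  rw [h2, List.prod_replicate, h3, NormedSpace.exp_nsmul]

/-- The scheme stands on both sides of `A ⊗ 1`, so strong convergence is essential here. Since it is
the dual scheme, the limiting generator has `G` on the left of `A` and `G^*` on the right. -/
theorem dilation_of_tendsto (hβ : Orthonormal ℂ β) {𝓛 : (K →L[ℂ] K) →L[ℂ] (K →L[ℂ] K)}
    (h𝓛 : ∀ A, 𝓛 A = G * A + A * star G + ∑ i, star (M i) * A * M i) {t : ℝ} (ht : 0 ≤ t)
    {U : BigSpace K h →L[ℂ] BigSpace K h}
    (hU : ∀ φ, Tendsto (fun N => euler (star G) (-M) β (grid 0 t N).reverse 0 φ) atTop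
      (𝓝 (U (coh 0 φ)))) (A : K →L[ℂ] K) :
    adjoint (coh 0) ∘L adjoint U ∘L tensorOne A ∘L U ∘L coh 0 =
      NormedSpace.exp ((t : ℂ) • 𝓛) A := by
  have hL : IsGrid t fun N => (grid 0 t N).reverse := by
    simpa using (isGrid_grid ht).reverse
  have hT := tendsto_gram_zero (G := star G) (M := -M) (β := β) (𝓛 := 𝓛)
    (fun A => by simp [h𝓛]) hL
  ext φ
  refine ext_inner_left ℂ fun ψ => ?_
  simp only [comp_apply]
  rw [adjoint_inner_right, adjoint_inner_right]
  have h1 : Tendsto (fun N => inner ℂ (euler (star G) (-M) β (grid 0 t N).reverse 0 ψ)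
      (tensorOne A (euler (star G) (-M) β (grid 0 t N).reverse 0 φ))) atTop
      (𝓝 (inner ℂ (U (coh 0 ψ)) (tensorOne A (U (coh 0 φ))))) :=
    (hU ψ).inner (((tensorOne A).continuous.tendsto _).comp (hU φ))
  refine tendsto_nhds_unique h1 ?_
  have h2 : ∀ N, inner ℂ (euler (star G) (-M) β (grid 0 t N).reverse 0 ψ)
      (tensorOne A (euler (star G) (-M) β (grid 0 t N).reverse 0 φ)) =
      inner ℂ ψ (((grid 0 t N).reverse.map (gramMap (star G) (-M) β 0 0)).prod A φ) := by
    intro N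
    have h3 := adjoint_euler_comp_tensorOne_comp_euler (G := star G) (M := -M) hβ A
      (grid 0 t N).reverse
      (List.pairwise_reverse.mpr ((pairwise_grid ht N).imp fun h' => h'.symm))
      (fun I hI => by
        have := hL.width N I hI
        have h0 : 0 ≤ t / N := div_nonneg ht N.cast_nonneg
        linarith) 0 0
    have h4 : Complex.exp (inner ℂ (toVec (0 : Label h)) (toVec (0 : Label h))) = 1 := by simp
    rw [h4, one_smul] at h3
    rw [← h3, comp_apply, adjoint_inner_right, comp_apply]
  simp only [h2]
  refine Tendsto.inner tendsto_const_nhds ?_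
  have h5 := ((ContinuousLinearMap.apply ℂ (K →L[ℂ] K) A).continuous.tendsto _).comp hT
  exact ((ContinuousLinearMap.apply ℂ K φ).continuous.tendsto _).comp h5

theorem coh_zero : (coh 0 : K →L[ℂ] BigSpace K h) = vacuumEmbedding K h := by
  rw [coh, map_zero, expVec_zero]
  rfl

end Dilation

/-! ### Perturbation series of the propagator and its generating function -/

section DysonSeries

variable {𝔸 : Type*} [NormedRing 𝔸] [NormedAlgebra ℂ 𝔸] [CompleteSpace 𝔸]

/-- The semigroup with generator `G`. -/
def semi (G : 𝔸) (r : ℝ) : 𝔸 := NormedSpace.exp ((r : ℂ) • G)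

theorem hasDerivAt_semi (G : 𝔸) (r : ℝ) : HasDerivAt (semi G) (G * semi G r) r := by
  have h1 := hasDerivAt_exp_smul_const' (𝕂 := ℂ) G (r : ℂ)
  have h2 := h1.scomp r (Complex.ofRealCLM.hasDerivAt (x := r))
  rw [Complex.ofRealCLM_apply, Complex.ofReal_one, one_smul] at h2
  exact h2

theorem continuous_semi (G : 𝔸) : Continuous (semi G) :=
  continuous_iff_continuousAt.mpr fun r => (hasDerivAt_semi G r).continuousAt

theorem semi_zero (G : 𝔸) : semi G 0 = 1 := by simp [semi]

theorem semi_add (G : 𝔸) (r s : ℝ) : semi G (r + s) = semi G r * semi G s := by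
  let _ := NormedAlgebra.restrictScalars ℚ ℂ 𝔸
  rw [semi, semi, semi, ← NormedSpace.exp_add_of_commute]
  · rw [← add_smul]
    push_cast
    rfl
  · exact ((Commute.refl G).smul_left _).smul_right _

theorem semi_neg_mul (G : 𝔸) (r : ℝ) : semi G r * semi G (-r) = 1 := by
  rw [← semi_add, add_neg_cancel, semi_zero]

/-- Lowering of the first index of a double sequence. -/
def lowerL {E : Type*} [Zero E] (q : ℕ → ℕ → E) : ℕ → ℕ → E
  | 0, _ => 0
  | m + 1, k => q m k

/-- Lowering of the second index of a double sequence. -/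
def lowerR {E : Type*} [Zero E] (q : ℕ → ℕ → E) : ℕ → ℕ → E
  | _, 0 => 0
  | m, k + 1 => q m k

theorem lowerL_zero {E : Type*} [Zero E] (q : ℕ → ℕ → E) (k : ℕ) : lowerL q 0 k = 0 := rfl

theorem lowerL_succ {E : Type*} [Zero E] (q : ℕ → ℕ → E) (m k : ℕ) :
    lowerL q (m + 1) k = q m k := rfl

theorem lowerR_zero {E : Type*} [Zero E] (q : ℕ → ℕ → E) (m : ℕ) : lowerR q m 0 = 0 := by
  cases m <;> rfl

theorem lowerR_succ {E : Type*} [Zero E] (q : ℕ → ℕ → E) (m k : ℕ) :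
    lowerR q m (k + 1) = q m k := by
  cases m <;> rfl

/-- The terms of the Dyson series of the evolution with generator `G + x a + y b`, sorted by powers
of `x` and `y` and convolved with the coefficients `c`. -/
def seriesTerm (G : 𝔸) (a b : ℝ → 𝔸) (c : ℕ → ℕ → ℂ) : ℕ → ℝ → ℕ → ℕ → 𝔸
  | 0, r, m, k => c m k • semi G r
  | n + 1, r, m, k => semi G r * ∫ u in (0 : ℝ)..r, semi G (-u) *
      (a u * lowerL (seriesTerm G a b c n u) m k + b u * lowerR (seriesTerm G a b c n u) m k)

/-- The sum of all terms of the Dyson series of given powers of `x` and `y`. -/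
def seriesSum (G : 𝔸) (a b : ℝ → 𝔸) (c : ℕ → ℕ → ℂ) (r : ℝ) (m k : ℕ) : 𝔸 :=
  ∑ n ∈ Finset.range (m + k + 1), seriesTerm G a b c n r m k

variable {G : 𝔸} {a b : ℝ → 𝔸} {c : ℕ → ℕ → ℂ}

theorem continuous_lowerL {X : Type*} [TopologicalSpace X] {q : X → ℕ → ℕ → 𝔸}
    (hq : ∀ m k, Continuous fun r => q r m k) (m k : ℕ) :
    Continuous fun r => lowerL (q r) m k := by
  cases m with
  | zero => exact continuous_const
  | succ m => exact hq m k

theorem continuous_lowerR {X : Type*} [TopologicalSpace X] {q : X → ℕ → ℕ → 𝔸}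
    (hq : ∀ m k, Continuous fun r => q r m k) (m k : ℕ) :
    Continuous fun r => lowerR (q r) m k := by
  cases k with
  | zero => simpa only [lowerR_zero] using continuous_const
  | succ k => simpa only [lowerR_succ] using hq m k

theorem continuous_seriesTerm (ha : Continuous a) (hb : Continuous b) (n m k : ℕ) :
    Continuous fun r => seriesTerm G a b c n r m k := by
  induction n generalizing m k with
  | zero => exact (continuous_semi G).const_smul _
  | succ n ih =>
    refine (continuous_semi G).mul ?_
    refine intervalIntegral.continuous_primitive (fun s t => Continuous.intervalIntegrable ?_ s t) 0
    exact ((continuous_semi G).comp continuous_neg).mul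
      ((ha.mul (continuous_lowerL ih m k)).add (hb.mul (continuous_lowerR ih m k)))

/-- Each vertex lowers one of the two indices, so there is no term with more than `m + k` vertices.
-/
theorem seriesTerm_eq_zero {n m k : ℕ} (h : m + k < n) (r : ℝ) : seriesTerm G a b c n r m k = 0 := by
  induction n generalizing m k r with
  | zero => exact absurd h (Nat.not_lt_zero _)
  | succ n ih =>
    have h1 : ∀ u, lowerL (seriesTerm G a b c n u) m k = 0 := fun u => by
      cases m with
      | zero => rfl
      | succ m => exact ih (by omega) u
    have h2 : ∀ u, lowerR (seriesTerm G a b c n u) m k = 0 := fun u => by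
      cases k with
      | zero => exact lowerR_zero _ _
      | succ k => rw [lowerR_succ]; exact ih (by omega) u
    simp [seriesTerm, h1, h2]

theorem continuous_seriesSum (ha : Continuous a) (hb : Continuous b) (m k : ℕ) :
    Continuous fun r => seriesSum G a b c r m k :=
  continuous_finsetSum _ fun n _ => continuous_seriesTerm ha hb n m k

theorem sum_lowerL (r : ℝ) (m k : ℕ) :
    ∑ n ∈ Finset.range (m + k), lowerL (seriesTerm G a b c n r) m k =
      lowerL (seriesSum G a b c r) m k := by
  cases m with
  | zero => simp [lowerL_zero]
  | succ m => rw [lowerL_succ, seriesSum, Nat.add_right_comm]; rfl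

theorem sum_lowerR (r : ℝ) (m k : ℕ) :
    ∑ n ∈ Finset.range (m + k), lowerR (seriesTerm G a b c n r) m k =
      lowerR (seriesSum G a b c r) m k := by
  cases k with
  | zero => simp [lowerR_zero]
  | succ k => simp only [lowerR_succ, seriesSum, Nat.add_assoc]

theorem seriesSum_eq (ha : Continuous a) (hb : Continuous b) (r : ℝ) (m k : ℕ) :
    seriesSum G a b c r m k = semi G r * (c m k • (1 : 𝔸) + ∫ u in (0 : ℝ)..r, semi G (-u) *
      (a u * lowerL (seriesSum G a b c u) m k + b u * lowerR (seriesSum G a b c u) m k)) := by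
  rw [seriesSum, Finset.sum_range_succ', mul_add, add_comm]
  congr 1
  · rw [mul_smul_comm, mul_one]
    rfl
  · simp only [seriesTerm]
    rw [← Finset.mul_sum, ← intervalIntegral.integral_finsetSum]
    · congr 1
      refine intervalIntegral.integral_congr fun u _ => ?_
      rw [← Finset.mul_sum, Finset.sum_add_distrib, ← Finset.mul_sum, ← Finset.mul_sum, sum_lowerL,
        sum_lowerR]
    · intro n _
      refine Continuous.intervalIntegrable ?_ _ _
      exact ((continuous_semi G).comp continuous_neg).mul
        ((ha.mul (continuous_lowerL (continuous_seriesTerm ha hb n) m k)).add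
          (hb.mul (continuous_lowerR (continuous_seriesTerm ha hb n) m k)))

/-- Variation of constants. Time-ordered integrals come in the mild form, whereas the uniqueness
result `eq_prop_mul` needs the integrated differential equation. -/
theorem mild_integral {q k : ℝ → 𝔸} {c : 𝔸} (hq : Continuous q) (hk : Continuous k)
    (h : ∀ r, q r = semi G r * (c + ∫ u in (0 : ℝ)..r, semi G (-u) * k u)) (r : ℝ) :
    q r = c + ∫ u in (0 : ℝ)..r, (G * q u + k u) := by
  have hInt : Continuous fun u => semi G (-u) * k u :=
    ((continuous_semi G).comp continuous_neg).mul hk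
  have hd : ∀ r, HasDerivAt q (G * q r + k r) r := by
    intro r
    have h1 := (intervalIntegral.integral_hasDerivAt_right (hInt.intervalIntegrable 0 r)
      (hInt.stronglyMeasurableAtFilter _ _) hInt.continuousAt).const_add c
    have h2 := (hasDerivAt_semi G r).mul h1
    have h3 : q = fun r => semi G r * (c + ∫ u in (0 : ℝ)..r, semi G (-u) * k u) := funext h
    have h4 := h2.congr_of_eventuallyEq (EventuallyEq.of_eq h3)
    have h5 : G * q r + k r = G * semi G r * (c + ∫ u in (0 : ℝ)..r, semi G (-u) * k u) +
        semi G r * (semi G (-r) * k r) := by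
      rw [h r, mul_assoc, ← mul_assoc (semi G r) (semi G (-r)), semi_neg_mul, one_mul]
    rw [h5]
    exact h4
  have h4 := intervalIntegral.integral_eq_sub_of_hasDerivAt (fun u _ => hd u)
    (((continuous_const.mul hq).add hk).intervalIntegrable 0 r)
  have h5 : q 0 = c := by rw [h 0]; simp [semi_zero]
  rw [h4, h5, add_sub_cancel]

theorem seriesSum_integral (ha : Continuous a) (hb : Continuous b) (r : ℝ) (m k : ℕ) :
    seriesSum G a b c r m k = c m k • (1 : 𝔸) + ∫ u in (0 : ℝ)..r,
      (G * seriesSum G a b c u m k + (a u * lowerL (seriesSum G a b c u) m k +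
        b u * lowerR (seriesSum G a b c u) m k)) :=
  mild_integral (continuous_seriesSum ha hb m k)
    ((ha.mul (continuous_lowerL (continuous_seriesSum ha hb) m k)).add
      (hb.mul (continuous_lowerR (continuous_seriesSum ha hb) m k)))
    (fun r => seriesSum_eq ha hb r m k) r

/-- Induction on `m + k`: lowering an index gains a factor `1 / ρ`, and a large `ρ` makes the
integral at most half of the bound, the free term being the other half. Geometric growth gives the
generating function a positive radius of convergence. -/
theorem norm_seriesSum_le (ha : Continuous a) (hb : Continuous b) {C : ℝ}
    (hac : ∀ u, ‖a u‖ ≤ C) (hbc : ∀ u, ‖b u‖ ≤ C) {σ : ℝ} (hσ : ∀ m k, ‖c m k‖ ≤ σ ^ (m + k))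
    (T : ℝ) : ∃ κ ρ : ℝ, 0 ≤ κ ∧ 0 < ρ ∧ ∀ r ∈ Set.Icc 0 T, ∀ m k,
      ‖seriesSum G a b c r m k‖ ≤ κ * ρ ^ (m + k) := by
  rcases lt_or_ge T 0 with hT | hT
  · exact ⟨0, 1, le_rfl, one_pos, fun r hr => absurd (hr.1.trans hr.2) (not_le.mpr hT)⟩
  have hC : 0 ≤ C := (norm_nonneg _).trans (hac 0)
  obtain ⟨B, hB⟩ := (isCompact_Icc (a := -T) (b := T)).exists_bound_of_continuousOn
    (continuous_semi G).continuousOn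
  have hB0 : 0 ≤ B := (norm_nonneg _).trans (hB 0 ⟨by linarith, hT⟩)
  -- Two integrands and the required half give the factor 4; the semigroup at `r` and at `-u` gives
  -- the two factors `B`.
  set ρ := max (max 1 |σ|) (4 * B * B * C * T) with hρ
  have hρ1 : 1 ≤ ρ := (le_max_left _ _).trans (le_max_left _ _)
  have hρσ : |σ| ≤ ρ := (le_max_right _ _).trans (le_max_left _ _)
  have hρB : 4 * B * B * C * T ≤ ρ := le_max_right _ _
  have hρ0 : 0 < ρ := one_pos.trans_le hρ1
  set κ := 2 * B * (1 + ‖(1 : 𝔸)‖) with hκ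
  have hκ0 : 0 ≤ κ := by positivity
  refine ⟨κ, ρ, hκ0, hρ0, ?_⟩
  have key : ∀ N m k, m + k = N → ∀ r ∈ Set.Icc 0 T,
      ‖seriesSum G a b c r m k‖ ≤ κ * ρ ^ (m + k) := by
    intro N
    induction N using Nat.strong_induction_on with
    | _ N ih =>
      intro m k hmk r hr
      have hl : ∀ u ∈ Set.Icc 0 T, ρ * ‖lowerL (seriesSum G a b c u) m k‖ ≤ κ * ρ ^ (m + k) := by
        intro u hu
        cases m with
        | zero => rw [lowerL_zero, norm_zero, mul_zero]; positivity
        | succ m =>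
          rw [lowerL_succ, Nat.add_right_comm, pow_succ']
          have := mul_le_mul_of_nonneg_left (ih (m + k) (by omega) m k rfl u hu) hρ0.le
          linarith
      have hr' : ∀ u ∈ Set.Icc 0 T, ρ * ‖lowerR (seriesSum G a b c u) m k‖ ≤ κ * ρ ^ (m + k) := by
        intro u hu
        cases k with
        | zero => rw [lowerR_zero, norm_zero, mul_zero]; positivity
        | succ k =>
          rw [lowerR_succ, ← Nat.add_assoc, pow_succ']
          have := mul_le_mul_of_nonneg_left (ih (m + k) (by omega) m k rfl u hu) hρ0.le
          linarith
      rw [seriesSum_eq ha hb, mul_add]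
      set P := κ * ρ ^ (m + k) with hP
      have hP0 : 0 ≤ P := by positivity
      have h1 : ‖semi G r * c m k • (1 : 𝔸)‖ ≤ P / 2 := by
        have e1 : ‖c m k • (1 : 𝔸)‖ ≤ ρ ^ (m + k) * (1 + ‖(1 : 𝔸)‖) := by
          rw [norm_smul]
          refine mul_le_mul ((hσ m k).trans ?_) (by linarith) (norm_nonneg _) (by positivity)
          exact (le_abs_self _).trans ((abs_pow σ (m + k)).le.trans
            (pow_le_pow_left₀ (abs_nonneg _) hρσ _))
        calc _ ≤ ‖semi G r‖ * ‖c m k • (1 : 𝔸)‖ := norm_mul_le _ _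
          _ ≤ B * (ρ ^ (m + k) * (1 + ‖(1 : 𝔸)‖)) :=
            mul_le_mul (hB r ⟨by linarith [hr.1], hr.2⟩) e1 (norm_nonneg _) hB0
          _ = P / 2 := by rw [hP, hκ]; ring
      have h2 : ‖∫ u in (0 : ℝ)..r, semi G (-u) * (a u * lowerL (seriesSum G a b c u) m k +
          b u * lowerR (seriesSum G a b c u) m k)‖ ≤ B * (C * (P / ρ) + C * (P / ρ)) * |r - 0| := by
        refine intervalIntegral.norm_integral_le_of_norm_le_const fun u hu => ?_
        rw [Set.uIoc_of_le hr.1] at hu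
        have hu' : u ∈ Set.Icc 0 T := ⟨hu.1.le, hu.2.trans hr.2⟩
        refine (norm_mul_le _ _).trans (mul_le_mul (hB _ ⟨by linarith [hu'.2], by linarith [hu'.1]⟩)
          ?_ (norm_nonneg _) hB0)
        refine (norm_add_le _ _).trans (add_le_add ?_ ?_)
        · refine (norm_mul_le _ _).trans (mul_le_mul (hac u) ?_ (norm_nonneg _) hC)
          rw [le_div_iff₀ hρ0, mul_comm]
          exact hl u hu'
        · refine (norm_mul_le _ _).trans (mul_le_mul (hbc u) ?_ (norm_nonneg _) hC)
          rw [le_div_iff₀ hρ0, mul_comm]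
          exact hr' u hu'
      have h3 : B * (B * (C * (P / ρ) + C * (P / ρ)) * |r - 0|) ≤ P / 2 := by
        rw [sub_zero, abs_of_nonneg hr.1]
        calc B * (B * (C * (P / ρ) + C * (P / ρ)) * r)
            ≤ B * (B * (C * (P / ρ) + C * (P / ρ)) * T) := by gcongr; exact hr.2
          _ = (4 * B * B * C * T) * (P / ρ) / 2 := by ring
          _ ≤ ρ * (P / ρ) / 2 := by gcongr
          _ = P / 2 := by field_simp
      have h4 := (norm_mul_le (semi G r) _).trans (mul_le_mul (hB r ⟨by linarith [hr.1], hr.2⟩) h2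
        (norm_nonneg _) hB0)
      linarith [norm_add_le (semi G r * c m k • (1 : 𝔸)) (semi G r * ∫ u in (0 : ℝ)..r,
        semi G (-u) * (a u * lowerL (seriesSum G a b c u) m k +
          b u * lowerR (seriesSum G a b c u) m k))]
  exact fun r hr m k => key _ m k rfl r hr

/-- The coefficients of `exp (w x y)`. -/
def expCoeff (w : ℂ) (m k : ℕ) : ℂ := if m = k then w ^ m / m.factorial else 0

theorem norm_expCoeff_le (w : ℂ) (m k : ℕ) : ‖expCoeff w m k‖ ≤ (1 + ‖w‖) ^ (m + k) := by
  rw [expCoeff]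
  have h1 : (1 : ℝ) ≤ 1 + ‖w‖ := by linarith [norm_nonneg w]
  split_ifs with h
  · rw [norm_div, norm_pow, Complex.norm_natCast]
    refine (div_le_self (by positivity) (by exact_mod_cast m.factorial_pos)).trans ?_
    exact (pow_le_pow_left₀ (norm_nonneg _) (by linarith) m).trans
      (pow_le_pow_right₀ h1 (Nat.le_add_right _ _))
  · rw [norm_zero]; positivity

theorem hasSum_expCoeff (w : ℂ) (x y : ℂ) :
    HasSum (fun p : ℕ × ℕ => x ^ p.1 * y ^ p.2 * expCoeff w p.1 p.2) (Complex.exp (x * y * w)) := by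
  have hinj : Function.Injective fun n : ℕ => (n, n) := fun m n h => (Prod.ext_iff.mp h).1
  have h1 : HasSum (fun n : ℕ => (x * y * w) ^ n / n.factorial) (Complex.exp (x * y * w)) := by
    rw [Complex.exp_eq_exp_ℂ]
    exact NormedSpace.expSeries_div_hasSum_exp _
  refine (hinj.hasSum_iff ?_).mp (h1.congr_fun ?_)
  · rintro ⟨m, k⟩ hp
    have : m ≠ k := fun h => hp ⟨m, by rw [h]⟩
    simp [expCoeff, this]
  · intro n
    simp only [Function.comp, expCoeff, if_true]
    rw [mul_pow, mul_pow]
    ring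

theorem hasSum_lowerL {x y : ℂ} {q : ℕ → ℕ → 𝔸} {Q : 𝔸}
    (h : HasSum (fun p : ℕ × ℕ => (x ^ p.1 * y ^ p.2) • q p.1 p.2) Q) :
    HasSum (fun p : ℕ × ℕ => (x ^ p.1 * y ^ p.2) • lowerL q p.1 p.2) (x • Q) := by
  have hinj : Function.Injective fun p : ℕ × ℕ => (p.1 + 1, p.2) := fun p p' h => by
    simpa [Prod.ext_iff] using h
  refine (hinj.hasSum_iff ?_).mp ((h.const_smul x).congr_fun ?_)
  · rintro ⟨m, k⟩ hp
    cases m with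
    | zero => simp [lowerL_zero]
    | succ m => exact absurd ⟨(m, k), rfl⟩ hp
  · rintro ⟨m, k⟩
    simp only [Function.comp, lowerL_succ, smul_smul]
    ring_nf

theorem hasSum_lowerR {x y : ℂ} {q : ℕ → ℕ → 𝔸} {Q : 𝔸}
    (h : HasSum (fun p : ℕ × ℕ => (x ^ p.1 * y ^ p.2) • q p.1 p.2) Q) :
    HasSum (fun p : ℕ × ℕ => (x ^ p.1 * y ^ p.2) • lowerR q p.1 p.2) (y • Q) := by
  have hinj : Function.Injective fun p : ℕ × ℕ => (p.1, p.2 + 1) := fun p p' h => by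
    simpa [Prod.ext_iff] using h
  refine (hinj.hasSum_iff ?_).mp ((h.const_smul y).congr_fun ?_)
  · rintro ⟨m, k⟩ hp
    cases k with
    | zero => simp [lowerR_zero]
    | succ k => exact absurd ⟨(m, k), rfl⟩ hp
  · rintro ⟨m, k⟩
    simp only [Function.comp, lowerR_succ, smul_smul]
    ring_nf

theorem norm_lowerL_le {q : ℕ → ℕ → 𝔸} {κ ρ : ℝ} (hκ : 0 ≤ κ) (hρ : 0 < ρ)
    (h : ∀ m k, ‖q m k‖ ≤ κ * ρ ^ (m + k)) (m k : ℕ) :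
    ‖lowerL q m k‖ ≤ κ * ρ ^ (m + k) / ρ := by
  cases m with
  | zero => rw [lowerL_zero, norm_zero]; positivity
  | succ m =>
    rw [lowerL_succ, Nat.add_right_comm, pow_succ, ← mul_assoc, mul_div_cancel_right₀ _ hρ.ne']
    exact h m k

theorem norm_lowerR_le {q : ℕ → ℕ → 𝔸} {κ ρ : ℝ} (hκ : 0 ≤ κ) (hρ : 0 < ρ)
    (h : ∀ m k, ‖q m k‖ ≤ κ * ρ ^ (m + k)) (m k : ℕ) :
    ‖lowerR q m k‖ ≤ κ * ρ ^ (m + k) / ρ := by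
  cases k with
  | zero => rw [lowerR_zero, norm_zero]; positivity
  | succ k =>
    rw [lowerR_succ, ← Nat.add_assoc, pow_succ, ← mul_assoc, mul_div_cancel_right₀ _ hρ.ne']
    exact h m k

/-- Lowering an index corresponds to multiplication by `x` or `y`, so the generating function solves
the integral equation of `G + x a + y b` with initial value `exp (x y w)`, and uniqueness identifies
it. -/
theorem hasSum_seriesSum (ha : Continuous a) (hb : Continuous b) {C : ℝ}
    (hac : ∀ u, ‖a u‖ ≤ C) (hbc : ∀ u, ‖b u‖ ≤ C) (w : ℂ) {T : ℝ} (hT : 0 ≤ T) :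
    ∃ ρ : ℝ, 0 < ρ ∧ ∀ x y : ℝ, 0 < x → x < ρ → 0 < y → y < ρ →
      HasSum (fun p : ℕ × ℕ => ((x : ℂ) ^ p.1 * (y : ℂ) ^ p.2) •
        seriesSum G a b (expCoeff w) T p.1 p.2)
        (Complex.exp (x * y * w) • prop (fun u => G + (x : ℂ) • a u + (y : ℂ) • b u) 0 T) := by
  have hC : 0 ≤ C := (norm_nonneg _).trans (hac 0)
  obtain ⟨κ, ρ, hκ, hρ, hbd⟩ := norm_seriesSum_le (G := G) ha hb hac hbc (norm_expCoeff_le w) T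
  -- Below this radius the double series is dominated by a product of geometric series of ratio
  -- `1/2`.
  refine ⟨(2 * ρ)⁻¹, by positivity, fun x y hx hx' hy hy' => ?_⟩
  have hxρ : ∀ {x : ℝ}, 0 < x → x < (2 * ρ)⁻¹ → x * ρ ≤ 1 / 2 := fun {x} _ h' => by
    have := mul_le_mul_of_nonneg_right h'.le hρ.le
    rwa [mul_inv, mul_assoc, inv_mul_cancel₀ hρ.ne', mul_one, ← one_div] at this
  have hs : Summable fun p : ℕ × ℕ => κ * ((1 / 2 : ℝ) ^ p.1 * (1 / 2 : ℝ) ^ p.2) :=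
    ((summable_geometric_two).mul_of_nonneg summable_geometric_two (fun _ => by positivity)
      fun _ => by positivity).mul_left κ
  have hpow : ∀ p : ℕ × ℕ, x ^ p.1 * y ^ p.2 * (κ * ρ ^ (p.1 + p.2)) ≤
      κ * ((1 / 2 : ℝ) ^ p.1 * (1 / 2 : ℝ) ^ p.2) := by
    intro p
    calc x ^ p.1 * y ^ p.2 * (κ * ρ ^ (p.1 + p.2))
        = κ * ((x * ρ) ^ p.1 * (y * ρ) ^ p.2) := by rw [mul_pow, mul_pow, pow_add]; ring
      _ ≤ _ := by
        have h1 := hxρ hx hx'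
        have h2 := hxρ hy hy'
        gcongr
  have hnorm : ∀ p : ℕ × ℕ, ‖(x : ℂ) ^ p.1 * (y : ℂ) ^ p.2‖ = x ^ p.1 * y ^ p.2 := fun p => by
    rw [norm_mul, norm_pow, norm_pow, Complex.norm_of_nonneg hx.le, Complex.norm_of_nonneg hy.le]
  have hterm : ∀ r ∈ Set.Icc 0 T, ∀ p : ℕ × ℕ, ‖((x : ℂ) ^ p.1 * (y : ℂ) ^ p.2) •
      seriesSum G a b (expCoeff w) r p.1 p.2‖ ≤ κ * ((1 / 2 : ℝ) ^ p.1 * (1 / 2 : ℝ) ^ p.2) :=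
    fun r hr p => by
      rw [norm_smul, hnorm]
      exact (mul_le_mul_of_nonneg_left (hbd r hr p.1 p.2) (by positivity)).trans (hpow p)
  set q : ℝ → ℕ → ℕ → 𝔸 := seriesSum G a b (expCoeff w) with hq
  set Q : ℝ → 𝔸 := fun r => ∑' p : ℕ × ℕ, ((x : ℂ) ^ p.1 * (y : ℂ) ^ p.2) • q r p.1 p.2 with hQ
  have hsum : ∀ r ∈ Set.Icc 0 T, HasSum (fun p : ℕ × ℕ => ((x : ℂ) ^ p.1 * (y : ℂ) ^ p.2) •
      q r p.1 p.2) (Q r) := fun r hr =>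
    (Summable.of_norm_bounded hs (hterm r hr)).hasSum
  have hcont : ContinuousOn Q (Set.Icc 0 T) :=
    continuousOn_tsum (fun p => ((continuous_seriesSum ha hb _ _).const_smul _).continuousOn) hs
      fun p r hr => hterm r hr p
  set E : ℝ → 𝔸 := fun u => G + (x : ℂ) • a u + (y : ℂ) • b u with hE
  have hEg : IsGenerator E (‖G‖ + x * C + y * C) := by
    refine ⟨((continuous_const.add (ha.const_smul _)).add
      (hb.const_smul _)).aestronglyMeasurable, fun u => ?_⟩
    refine (norm_add_le _ _).trans (add_le_add ((norm_add_le _ _).trans (add_le_add le_rfl ?_)) ?_)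
    · rw [norm_smul, Complex.norm_of_nonneg hx.le]
      exact mul_le_mul_of_nonneg_left (hac u) hx.le
    · rw [norm_smul, Complex.norm_of_nonneg hy.le]
      exact mul_le_mul_of_nonneg_left (hbc u) hy.le
  have hEQ : ∀ u ∈ Set.Icc 0 T, HasSum (fun p : ℕ × ℕ => ((x : ℂ) ^ p.1 * (y : ℂ) ^ p.2) •
      (G * q u p.1 p.2 + (a u * lowerL (q u) p.1 p.2 + b u * lowerR (q u) p.1 p.2)))
      (E u * Q u) := by
    intro u hu
    have h1 := (((hsum u hu).mul_left G).add (((hasSum_lowerL (hsum u hu)).mul_left (a u)).add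
      ((hasSum_lowerR (hsum u hu)).mul_left (b u))))
    have h2 : E u * Q u = G * Q u + (a u * (x : ℂ) • Q u + b u * (y : ℂ) • Q u) := by
      simp only [hE, add_mul, smul_mul_assoc, mul_smul_comm, add_assoc]
    rw [h2]
    refine h1.congr_fun fun p => ?_
    simp only [smul_add, mul_smul_comm]
  have hvol : ∀ r ∈ Set.Icc 0 T, Q r = Complex.exp (x * y * w) • (1 : 𝔸) +
      ∫ u in (0 : ℝ)..r, E u * Q u := by
    intro r hr
    have h1 : HasSum (fun p : ℕ × ℕ => ∫ u in (0 : ℝ)..r, ((x : ℂ) ^ p.1 * (y : ℂ) ^ p.2) •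
        (G * q u p.1 p.2 + (a u * lowerL (q u) p.1 p.2 + b u * lowerR (q u) p.1 p.2)))
        (∫ u in (0 : ℝ)..r, E u * Q u) := by
      have hI : ∀ u ∈ Set.uIoc 0 r, u ∈ Set.Icc 0 T := fun u hu => by
        rw [Set.uIoc_of_le hr.1] at hu
        exact ⟨hu.1.le, hu.2.trans hr.2⟩
      refine intervalIntegral.hasSum_integral_of_dominated_convergence
        (fun p _ => (‖G‖ + (C / ρ + C / ρ)) * (κ * ((1 / 2 : ℝ) ^ p.1 * (1 / 2 : ℝ) ^ p.2)))
        (fun p => ?_) (fun p => ?_) ?_ ?_ ?_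
      · refine Continuous.aestronglyMeasurable (Continuous.const_smul ?_ _)
        exact (continuous_const.mul (continuous_seriesSum ha hb _ _)).add
          ((ha.mul (continuous_lowerL (continuous_seriesSum ha hb) _ _)).add
            (hb.mul (continuous_lowerR (continuous_seriesSum ha hb) _ _)))
      · refine Eventually.of_forall fun u hu => ?_
        have hl := norm_lowerL_le hκ hρ (hbd u (hI u hu)) p.1 p.2
        have hr' := norm_lowerR_le hκ hρ (hbd u (hI u hu)) p.1 p.2
        have h2 : ‖G * q u p.1 p.2 + (a u * lowerL (q u) p.1 p.2 + b u * lowerR (q u) p.1 p.2)‖ ≤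
            (‖G‖ + (C / ρ + C / ρ)) * (κ * ρ ^ (p.1 + p.2)) := by
          rw [add_mul, add_mul]
          refine (norm_add_le _ _).trans (add_le_add ?_ ((norm_add_le _ _).trans
            (add_le_add ?_ ?_)))
          · exact (norm_mul_le _ _).trans
              (mul_le_mul_of_nonneg_left (hbd u (hI u hu) _ _) (norm_nonneg _))
          · refine (norm_mul_le _ _).trans ((mul_le_mul (hac u) hl (norm_nonneg _) hC).trans ?_)
            exact le_of_eq (by ring)
          · refine (norm_mul_le _ _).trans ((mul_le_mul (hbc u) hr' (norm_nonneg _) hC).trans ?_)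
            exact le_of_eq (by ring)
        rw [norm_smul, hnorm]
        calc _ ≤ x ^ p.1 * y ^ p.2 * ((‖G‖ + (C / ρ + C / ρ)) * (κ * ρ ^ (p.1 + p.2))) :=
              mul_le_mul_of_nonneg_left h2 (by positivity)
          _ = (‖G‖ + (C / ρ + C / ρ)) * (x ^ p.1 * y ^ p.2 * (κ * ρ ^ (p.1 + p.2))) := by ring
          _ ≤ _ := mul_le_mul_of_nonneg_left (hpow p) (by positivity)
      · exact Eventually.of_forall fun u _ => hs.mul_left _
      · exact intervalIntegrable_const
      · exact Eventually.of_forall fun u hu => hEQ u (hI u hu)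
    have h2 : HasSum (fun p : ℕ × ℕ => ((x : ℂ) ^ p.1 * (y : ℂ) ^ p.2 *
        expCoeff w p.1 p.2) • (1 : 𝔸)) (Complex.exp (x * y * w) • (1 : 𝔸)) :=
      (hasSum_expCoeff w x y).smul_const _
    refine (hsum r hr).unique ((h2.add h1).congr_fun fun p => ?_)
    rw [hq, seriesSum_integral ha hb, smul_add, smul_smul, intervalIntegral.integral_smul]
  have hfin := eq_prop_mul hEg hcont hvol T ⟨hT, le_rfl⟩
  rw [mul_smul_comm, mul_one] at hfin
  rw [← hfin]
  exact hsum T ⟨hT, le_rfl⟩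

end DysonSeries

/-! ### Iterated integrals over the time simplex -/

section Simplex

variable {𝔸 : Type*} [NormedRing 𝔸] [NormedAlgebra ℂ 𝔸] [CompleteSpace 𝔸]

theorem isCompact_timeSimplex (n : ℕ) (t : ℝ) : IsCompact (timeSimplex n t) := by
  have h1 : IsCompact (Set.univ.pi fun _ : Fin n => Set.Icc (0 : ℝ) t) :=
    isCompact_univ_pi fun _ => isCompact_Icc
  refine h1.of_isClosed_subset ?_ fun s hs k _ => hs.2 k
  have h2 : timeSimplex n t = {s | Monotone s} ∩ ⋂ k, {s | 0 ≤ s k ∧ s k ≤ t} := by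
    ext s
    simp [timeSimplex]
  rw [h2]
  refine isClosed_monotone.inter (isClosed_iInter fun k => ?_)
  exact (isClosed_le continuous_const (continuous_apply k)).inter
    (isClosed_le (continuous_apply k) continuous_const)

theorem mem_timeSimplex_succ {n : ℕ} {t : ℝ} {s : Fin (n + 1) → ℝ} :
    s ∈ timeSimplex (n + 1) t ↔ s (Fin.last n) ∈ Set.Icc 0 t ∧
      (fun k : Fin n => s k.castSucc) ∈ timeSimplex n (s (Fin.last n)) := by
  constructor
  · rintro ⟨hm, hb⟩
    exact ⟨hb _, fun i j hij => hm (by simpa using hij), fun k => ⟨(hb _).1, hm (Fin.le_last _)⟩⟩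
  · rintro ⟨hl, hm, hb⟩
    refine ⟨fun i j hij => ?_, fun k => ?_⟩
    · induction j using Fin.lastCases with
      | last =>
        induction i using Fin.lastCases with
        | last => exact le_rfl
        | cast i => exact (hb i).2
      | cast j =>
        induction i using Fin.lastCases with
        | last => exact absurd hij (not_le.mpr (Fin.castSucc_lt_last j))
        | cast i => exact hm (by simpa using hij)
    · induction k using Fin.lastCases with
      | last => exact hl
      | cast k => exact ⟨(hb k).1, (hb k).2.trans hl.2⟩

/-- The integrals over the simplex of dimension `n + 1` as iterated integrals, the largest time
being integrated last. -/
theorem integral_timeSimplex_succ {E : Type*} [NormedAddCommGroup E] [NormedSpace ℝ E]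
    {n : ℕ} {t : ℝ} (ht : 0 ≤ t) {H : ℝ → (Fin n → ℝ) → E}
    (hH : Continuous fun p : ℝ × (Fin n → ℝ) => H p.1 p.2) :
    ∫ s in timeSimplex (n + 1) t, H (s (Fin.last n)) (fun k => s k.castSucc) =
      ∫ u in (0 : ℝ)..t, ∫ s in timeSimplex n u, H u s := by
  set e := MeasurableEquiv.piFinSuccAbove (fun _ : Fin (n + 1) => ℝ) (Fin.last n) with he
  have hes : ∀ s, e s = (s (Fin.last n), fun k => s k.castSucc) := fun s => by
    refine Prod.ext rfl (funext fun k => ?_)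
    exact congrArg s (Fin.succAbove_last_apply k)
  have hmp := volume_preserving_piFinSuccAbove (fun _ : Fin (n + 1) => ℝ) (Fin.last n)
  set S : Set (ℝ × (Fin n → ℝ)) := {p | p.1 ∈ Set.Icc 0 t ∧ p.2 ∈ timeSimplex n p.1} with hS
  have hpre : e ⁻¹' S = timeSimplex (n + 1) t := by
    ext s
    rw [Set.mem_preimage, hes, mem_timeSimplex_succ]
    rfl
  have hSm : MeasurableSet S := by
    rw [← e.measurableSet_preimage, hpre]
    exact (isCompact_timeSimplex _ _).measurableSet
  set g : ℝ × (Fin n → ℝ) → E := S.indicator fun p => H p.1 p.2 with hg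
  have h1 : ∫ s in timeSimplex (n + 1) t, H (s (Fin.last n)) (fun k => s k.castSucc) =
      ∫ p, g p := by
    rw [← hmp.integral_comp' g, ← integral_indicator (isCompact_timeSimplex _ _).measurableSet]
    refine integral_congr_ae (Eventually.of_forall fun s => ?_)
    change _ = S.indicator (fun p => H p.1 p.2) (e s)
    by_cases hs : s ∈ timeSimplex (n + 1) t
    · have : e s ∈ S := by rwa [← hpre] at hs
      rw [Set.indicator_of_mem hs, Set.indicator_of_mem this, hes]
    · have : e s ∉ S := by rwa [← hpre] at hs
      rw [Set.indicator_of_notMem hs, Set.indicator_of_notMem this]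
  have hInt : Integrable g := by
    rw [hg, integrable_indicator_iff hSm]
    have h2 := hmp.integrableOn_comp_preimage e.measurableEmbedding (f := fun p => H p.1 p.2) (s := S)
    rw [← h2, ← he, hpre]
    refine ContinuousOn.integrableOn_compact (isCompact_timeSimplex _ _)
      (Continuous.continuousOn (hH.comp ?_))
    have : (e : (Fin (n + 1) → ℝ) → ℝ × (Fin n → ℝ)) =
        fun s => (s (Fin.last n), fun k => s k.castSucc) := funext hes
    rw [this]
    fun_prop
  rw [h1, Measure.volume_eq_prod, integral_prod _ hInt, intervalIntegral.integral_of_le ht,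
    ← integral_Icc_eq_integral_Ioc, ← integral_indicator measurableSet_Icc]
  refine integral_congr_ae (Eventually.of_forall fun u => ?_)
  simp only
  by_cases hu : u ∈ Set.Icc 0 t
  · rw [Set.indicator_of_mem hu, ← integral_indicator (isCompact_timeSimplex _ _).measurableSet]
    refine integral_congr_ae (Eventually.of_forall fun s => ?_)
    simp only [hg]
    by_cases hs : s ∈ timeSimplex n u
    · rw [Set.indicator_of_mem hs, Set.indicator_of_mem (show (u, s) ∈ S from ⟨hu, hs⟩)]
    · rw [Set.indicator_of_notMem hs, Set.indicator_of_notMem fun h' => hs h'.2]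
  · rw [Set.indicator_of_notMem hu]
    refine (integral_congr_ae (Eventually.of_forall fun s => ?_)).trans (integral_zero _ _)
    exact Set.indicator_of_notMem (fun h' => hu h'.1) _

/-- The integrand over the simplex of the terms of the Dyson series. -/
def seriesIntegrand (G : 𝔸) (a b : ℝ → 𝔸) (c : ℕ → ℕ → ℂ) :
    (n : ℕ) → (Fin n → ℝ) → ℝ → ℕ → ℕ → 𝔸
  | 0, _, r, m, k => c m k • semi G r
  | n + 1, s, r, m, k => semi G (r - s (Fin.last n)) *
      (a (s (Fin.last n)) * lowerL (seriesIntegrand G a b c n (fun i => s i.castSucc)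
        (s (Fin.last n))) m k +
      b (s (Fin.last n)) * lowerR (seriesIntegrand G a b c n (fun i => s i.castSucc)
        (s (Fin.last n))) m k)

variable {G : 𝔸} {a b : ℝ → 𝔸} {c : ℕ → ℕ → ℂ}

theorem continuous_seriesIntegrand (ha : Continuous a) (hb : Continuous b) (n m k : ℕ) :
    Continuous fun p : (Fin n → ℝ) × ℝ => seriesIntegrand G a b c n p.1 p.2 m k := by
  induction n generalizing m k with
  | zero => exact ((continuous_semi G).comp continuous_snd).const_smul _
  | succ n ih =>
    have hl : Continuous fun p : (Fin (n + 1) → ℝ) × ℝ => p.1 (Fin.last n) := by fun_prop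
    have hq : ∀ m k, Continuous fun p : (Fin (n + 1) → ℝ) × ℝ =>
        seriesIntegrand G a b c n (fun i => p.1 i.castSucc) (p.1 (Fin.last n)) m k := fun m k =>
      (ih m k).comp (f := fun p : (Fin (n + 1) → ℝ) × ℝ =>
        ((fun i : Fin n => p.1 i.castSucc), p.1 (Fin.last n))) (by fun_prop)
    exact ((continuous_semi G).comp (continuous_snd.sub hl)).mul
      (((ha.comp hl).mul (continuous_lowerL hq m k)).add
        ((hb.comp hl).mul (continuous_lowerR hq m k)))

theorem integral_timeSimplex_zero {E : Type*} [NormedAddCommGroup E] [NormedSpace ℝ E]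
    [CompleteSpace E] (t : ℝ) (H : (Fin 0 → ℝ) → E) :
    ∫ s in timeSimplex 0 t, H s = H Fin.elim0 := by
  have h1 : timeSimplex 0 t = Set.univ := by
    ext s
    simp [timeSimplex, Subsingleton.monotone]
  rw [h1, Measure.restrict_univ, Measure.volume_pi_eq_dirac Fin.elim0, integral_dirac]

/-- Both sides peel off the largest time `u`; the factor `semi G (r - u)` splits into `semi G r *
semi G (-u)`. -/
theorem integral_seriesIntegrand (ha : Continuous a) (hb : Continuous b) (n : ℕ) {r : ℝ}
    (hr : 0 ≤ r) (m k : ℕ) :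
    ∫ s in timeSimplex n r, seriesIntegrand G a b c n s r m k = seriesTerm G a b c n r m k := by
  induction n generalizing r m k with
  | zero => exact integral_timeSimplex_zero r _
  | succ n ih =>
    have hq : ∀ m k, Continuous fun p : ℝ × (Fin n → ℝ) =>
        seriesIntegrand G a b c n p.2 p.1 m k := fun m k =>
      (continuous_seriesIntegrand ha hb n m k).comp continuous_swap
    have hH : Continuous fun p : ℝ × (Fin n → ℝ) => semi G (r - p.1) *
        (a p.1 * lowerL (seriesIntegrand G a b c n p.2 p.1) m k +
        b p.1 * lowerR (seriesIntegrand G a b c n p.2 p.1) m k) :=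
      ((continuous_semi G).comp (continuous_const.sub continuous_fst)).mul
        (((ha.comp continuous_fst).mul (continuous_lowerL hq m k)).add
          ((hb.comp continuous_fst).mul (continuous_lowerR hq m k)))
    refine (integral_timeSimplex_succ hr (H := fun u s => semi G (r - u) *
      (a u * lowerL (seriesIntegrand G a b c n s u) m k +
      b u * lowerR (seriesIntegrand G a b c n s u) m k)) hH).trans ?_
    have hi : IntervalIntegrable (fun u => semi G (-u) * (a u * lowerL (seriesTerm G a b c n u) m k +
        b u * lowerR (seriesTerm G a b c n u) m k)) volume 0 r :=
      Continuous.intervalIntegrable (((continuous_semi G).comp continuous_neg).mul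
        ((ha.mul (continuous_lowerL (continuous_seriesTerm ha hb n) m k)).add
          (hb.mul (continuous_lowerR (continuous_seriesTerm ha hb n) m k)))) _ _
    have hmul : ∀ d : 𝔸, d * ∫ u in (0 : ℝ)..r, semi G (-u) *
        (a u * lowerL (seriesTerm G a b c n u) m k + b u * lowerR (seriesTerm G a b c n u) m k) =
        ∫ u in (0 : ℝ)..r, d * (semi G (-u) * (a u * lowerL (seriesTerm G a b c n u) m k +
          b u * lowerR (seriesTerm G a b c n u) m k)) := fun d => by
      rw [intervalIntegral.integral_of_le hr, intervalIntegral.integral_of_le hr,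
        integral_const_mul_of_integrable hi.1]
    rw [seriesTerm, hmul]
    refine intervalIntegral.integral_congr fun u hu => ?_
    rw [Set.uIcc_of_le hr] at hu
    have hq' : ∀ m k, Continuous fun s : Fin n → ℝ => seriesIntegrand G a b c n s u m k :=
      fun m k => (hq m k).comp (by fun_prop : Continuous fun s : Fin n → ℝ => (u, s))
    have hil : IntegrableOn (fun s => lowerL (seriesIntegrand G a b c n s u) m k)
        (timeSimplex n u) :=
      (continuous_lowerL hq' m k).continuousOn.integrableOn_compact (isCompact_timeSimplex _ _)
    have hir : IntegrableOn (fun s => lowerR (seriesIntegrand G a b c n s u) m k)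
        (timeSimplex n u) :=
      (continuous_lowerR hq' m k).continuousOn.integrableOn_compact (isCompact_timeSimplex _ _)
    have hl : ∫ s in timeSimplex n u, lowerL (seriesIntegrand G a b c n s u) m k =
        lowerL (seriesTerm G a b c n u) m k := by
      cases m with
      | zero => simp [lowerL_zero]
      | succ m => exact ih hu.1 m k
    have hr' : ∫ s in timeSimplex n u, lowerR (seriesIntegrand G a b c n s u) m k =
        lowerR (seriesTerm G a b c n u) m k := by
      cases k with
      | zero => simp [lowerR_zero]
      | succ k => simp only [lowerR_succ]; exact ih hu.1 m k
    have hadd : IntegrableOn (fun s => a u * lowerL (seriesIntegrand G a b c n s u) m k +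
        b u * lowerR (seriesIntegrand G a b c n s u) m k) (timeSimplex n u) :=
      (hil.const_mul _).add (hir.const_mul _)
    change (∫ s in timeSimplex n u, semi G (r - u) *
      (a u * lowerL (seriesIntegrand G a b c n s u) m k +
        b u * lowerR (seriesIntegrand G a b c n s u) m k)) = semi G r * (semi G (-u) *
      (a u * lowerL (seriesTerm G a b c n u) m k + b u * lowerR (seriesTerm G a b c n u) m k))
    rw [integral_const_mul_of_integrable hadd,
      integral_add (hil.const_mul _) (hir.const_mul _), integral_const_mul_of_integrable hil,
      integral_const_mul_of_integrable hir, hl, hr', sub_eq_add_neg, semi_add, mul_assoc]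

end Simplex

/-! ### Normalized powers in the algebraic Fock space -/

section ExponentialTerms

variable {V W : Type*} [AddCommGroup V] [Module ℂ V] [AddCommGroup W] [Module ℂ W]

/-- The vector `(m!)^(-1/2) f ⊗ ⋯ ⊗ f`, the `m`-particle part of an exponential vector. -/
def normPow (f : V) (m : ℕ) : AlgFock V :=
  (((Real.sqrt m.factorial)⁻¹ : ℝ) : ℂ) •
    DirectSum.lof ℂ ℕ (fun n => SymTensor V n) m (SymTensor.pow f m)

theorem SymTensor.contract_pow (ℓ : V →ₗ[ℂ] ℂ) (f : V) (n : ℕ) :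
    SymTensor.contract ℓ n (SymTensor.pow f (n + 1)) = ℓ f • SymTensor.pow f n :=
  Subtype.ext (TPow.contract_tprod ℓ n fun _ => f)

theorem SymTensor.map_pow (q : V →ₗ[ℂ] W) (f : V) (n : ℕ) :
    SymTensor.map q n (SymTensor.pow f n) = SymTensor.pow (q f) n :=
  Subtype.ext (TPow.map_tprod q n fun _ => f)

theorem annih_normPow_zero (ℓ : V →ₗ[ℂ] ℂ) (f : V) : annih ℓ (normPow f 0) = 0 := by
  rw [normPow, map_smul, annih, DirectSum.toModule_lof]
  simp

/-- The normalization absorbs the factor `√(m + 1)`, so annihilation merely lowers the index, as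
differentiation in `x` does for the exponential vector of `x f`. -/
theorem annih_normPow_succ (ℓ : V →ₗ[ℂ] ℂ) (f : V) (m : ℕ) :
    annih ℓ (normPow f (m + 1)) = ℓ f • normPow f m := by
  rw [normPow, map_smul, annih, DirectSum.toModule_lof]
  simp only [LinearMap.smul_apply, LinearMap.comp_apply, SymTensor.contract_pow, map_smul, normPow]
  rw [smul_smul, smul_smul, smul_smul]
  congr 1
  rw [mul_comm (ℓ f), Nat.factorial_succ]
  congr 1
  rw [← Complex.ofReal_mul]
  congr 1
  push_cast
  rw [Real.sqrt_mul (by positivity), mul_inv, mul_right_comm,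
    inv_mul_cancel₀ (by positivity), one_mul]

theorem secondQuant_normPow (q : V →ₗ[ℂ] W) (f : V) (m : ℕ) :
    secondQuant q (normPow f m) = normPow (q f) m := by
  rw [normPow, map_smul, secondQuant, DirectSum.toModule_lof, LinearMap.comp_apply,
    SymTensor.map_pow]
  rfl

theorem span_normPow :
    Submodule.span ℂ (Set.range fun p : V × ℕ => normPow p.1 p.2) = ⊤ := by
  rw [eq_top_iff]
  rintro x -
  induction x using DirectSum.induction_on with
  | zero => exact Submodule.zero_mem _
  | add x y hx hy => exact Submodule.add_mem _ hx hy
  | of n x =>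
    have hx : x ∈ Submodule.span ℂ (Set.range fun f : V => SymTensor.pow f n) := by
      rw [SymTensor.span_pow]; trivial
    change DirectSum.lof ℂ ℕ (fun n => SymTensor V n) n x ∈ _
    induction hx using Submodule.span_induction with
    | mem x hx =>
      obtain ⟨f, rfl⟩ := hx
      have h1 : DirectSum.lof ℂ ℕ (fun n => SymTensor V n) n (SymTensor.pow f n) =
          ((Real.sqrt n.factorial : ℝ) : ℂ) • normPow f n := by
        rw [normPow, smul_smul, ← Complex.ofReal_mul, mul_inv_cancel₀ (by positivity),
          Complex.ofReal_one, one_smul]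
      rw [h1]
      exact Submodule.smul_mem _ _ (Submodule.subset_span ⟨(f, n), rfl⟩)
    | zero => rw [map_zero]; exact Submodule.zero_mem _
    | add x y _ _ hx hy => rw [map_add]; exact Submodule.add_mem _ hx hy
    | smul c x _ hx => rw [map_smul]; exact Submodule.smul_mem _ _ hx

end ExponentialTerms

/-! ### The form domain inside the Fock space -/

section Domain

variable {K h : Type*} [NormedAddCommGroup K] [InnerProductSpace ℂ K]
  [NormedAddCommGroup h] [InnerProductSpace ℂ h]

variable (h) in
/-- The map of the algebraic Fock space over the integrable functions to the Fock space. -/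
def toFock : AlgFock (intDomain h) →ₗ[ℂ] Fock (OneParticle h) :=
  algFockToFock (OneParticle h) ∘ₗ secondQuant (intDomain h).subtype

theorem embed_tmul (ψ : K) (F : AlgFock (intDomain h)) :
    embed (ψ ⊗ₜ[ℂ] F) = (tmulRight (toFock h F) : K →L[ℂ] BigSpace K h) ψ := rfl

theorem toFock_normPow (f : intDomain h) (m : ℕ) :
    toFock h (normPow f m) = (((Real.sqrt m.factorial)⁻¹ : ℝ) : ℂ) • powVec f.1 m := by
  rw [toFock, LinearMap.comp_apply, secondQuant_normPow, normPow, map_smul, algFockToFock,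
    DirectSum.toModule_lof]
  rfl

theorem inner_powVec {H : Type*} [NormedAddCommGroup H] [InnerProductSpace ℂ H] (f g : H)
    (m k : ℕ) : inner ℂ (powVec f m) (powVec g k) = if m = k then inner ℂ f g ^ m else 0 := by
  have h1 : inner ℂ (powVec f m) (powVec g k) =
      inner ℂ ((SymTensor.pow f m : SymTensor H m) : Completion (SymTensor H m))
        (((powVec g k).1 : ∀ n, Completion (SymTensor H n)) m) :=
    lp.inner_single_left (G := fun n : ℕ => Completion (SymTensor H n)) m _ _
  rw [h1]
  split_ifs with hmk
  · subst hmk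
    have h2 : ((powVec g m).1 : ∀ n, Completion (SymTensor H n)) m =
        ((SymTensor.pow g m : SymTensor H m) : Completion (SymTensor H m)) :=
      lp.single_apply_self (E := fun n : ℕ => Completion (SymTensor H n)) 2 m _
    rw [h2, Completion.inner_coe, SymTensor.inner_pow]
  · have h2 : ((powVec g k).1 : ∀ n, Completion (SymTensor H n)) m = 0 :=
      lp.single_apply_ne (E := fun n : ℕ => Completion (SymTensor H n)) 2 k _ hmk
    rw [h2]
    exact inner_zero_right (𝕜 := ℂ) (E := Completion (SymTensor H m)) _

theorem inner_toFock_normPow (f g : intDomain h) (m k : ℕ) :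
    inner ℂ (toFock h (normPow f m)) (toFock h (normPow g k)) = expCoeff (inner ℂ f.1 g.1) m k := by
  rw [toFock_normPow, toFock_normPow, inner_smul_left, inner_smul_right, inner_powVec, expCoeff]
  split_ifs with hmk
  · subst hmk
    rw [Complex.conj_ofReal, ← mul_assoc, ← Complex.ofReal_mul, ← mul_inv,
      Real.mul_self_sqrt (by positivity), div_eq_inv_mul]
    push_cast
    rfl
  · simp

/-- The factor of the largest time is the rightmost of the product and acts first, so it can be
removed together with the outermost factors of `dysonOp`. -/
theorem annihProd_succ {n : ℕ} (s : Fin (n + 1) → ℝ) (b : Fin (n + 1) → h) (ε : Fin (n + 1) → Bool)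
    (ε₀ : Bool) (F : AlgFock (intDomain h)) :
    annihProd s b ε ε₀ F = annihProd (fun i => s i.castSucc) (fun i => b i.castSucc)
      (fun i => ε i.castSucc) ε₀
        (if ε (Fin.last n) = ε₀ then annih (noiseBra (s (Fin.last n)) (b (Fin.last n))) F else F) := by
  rw [annihProd, List.finRange_succ_last, List.map_append, List.prod_append, List.map_map]
  split_ifs with h1 <;> simp [h1, annihProd, Function.comp_def]

end Domain

/-! ### Terms of the Dyson series as operators on the small space -/

section OperatorTerms

variable {K h : Type*} [NormedAddCommGroup K] [InnerProductSpace ℂ K] [CompleteSpace K]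
  [NormedAddCommGroup h] [InnerProductSpace ℂ h]

theorem contrSemigroup_eq (Υ : K →L[ℂ] K) (t : ℝ) :
    contrSemigroup Υ t = semi (-(Complex.I • Υ)) t := by
  rw [contrSemigroup, semi, smul_neg, smul_smul, neg_smul, mul_comm]

/-- The summand of the Dyson series as an operator on `K`, for fixed vectors of the Fock space. -/
def dysonTermOp (Υ : K →L[ℂ] K) (ν : K →L[ℂ] HTensor K h) {n : ℕ} (s : Fin n → ℝ)
    (b : Fin n → h) (r : ℝ) (F F' : AlgFock (intDomain h)) : K →L[ℂ] K :=
  ∑ ε : Fin n → Bool, ((((2 * Real.pi) ^ (-(n : ℝ) / 2) : ℝ) : ℂ) * (-Complex.I) ^ n *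
    inner ℂ (toFock h (annihProd s b ε true F)) (toFock h (annihProd s b ε false F'))) •
      dysonOp Υ n (fun k => signedComponent ν (b k) (ε k)) s r

theorem dysonTerm_tmul (Υ : K →L[ℂ] K) (ν : K →L[ℂ] HTensor K h) (t : ℝ) {n : ℕ} (s : Fin n → ℝ)
    (b : Fin n → h) (ψ φ : K) (F F' : AlgFock (intDomain h)) :
    dysonTerm Υ ν t s b (ψ ⊗ₜ F) (φ ⊗ₜ F') =
      inner ℂ ψ (dysonTermOp Υ ν s b t (secondQuant (phase t) F) F' φ) := by
  rw [dysonTerm, dysonTermOp, _root_.sum_apply, inner_sum]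
  refine Finset.sum_congr rfl fun ε _ => ?_
  rw [TensorProduct.map_tmul, TensorProduct.map_tmul, embed_tmul, embed_tmul, inner_tmulRight,
    _root_.smul_apply, inner_smul_right, mul_assoc, mul_assoc, mul_assoc,
    mul_comm (inner ℂ _ _)]
  rfl

theorem dysonTermOp_zero_left (Υ : K →L[ℂ] K) (ν : K →L[ℂ] HTensor K h) {n : ℕ} (s : Fin n → ℝ)
    (b : Fin n → h) (r : ℝ) (F' : AlgFock (intDomain h)) : dysonTermOp Υ ν s b r 0 F' = 0 := by
  simp [dysonTermOp]

theorem dysonTermOp_zero_right (Υ : K →L[ℂ] K) (ν : K →L[ℂ] HTensor K h) {n : ℕ} (s : Fin n → ℝ)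
    (b : Fin n → h) (r : ℝ) (F : AlgFock (intDomain h)) : dysonTermOp Υ ν s b r F 0 = 0 := by
  simp [dysonTermOp]

theorem dysonTermOp_smul_left (Υ : K →L[ℂ] K) (ν : K →L[ℂ] HTensor K h) {n : ℕ} (s : Fin n → ℝ)
    (b : Fin n → h) (r : ℝ) (c : ℂ) (F F' : AlgFock (intDomain h)) :
    dysonTermOp Υ ν s b r (c • F) F' = starRingEnd ℂ c • dysonTermOp Υ ν s b r F F' := by
  rw [dysonTermOp, dysonTermOp, Finset.smul_sum]
  refine Finset.sum_congr rfl fun ε _ => ?_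
  rw [map_smul, map_smul, inner_smul_left, smul_smul, mul_left_comm]

theorem dysonTermOp_smul_right (Υ : K →L[ℂ] K) (ν : K →L[ℂ] HTensor K h) {n : ℕ} (s : Fin n → ℝ)
    (b : Fin n → h) (r : ℝ) (c : ℂ) (F F' : AlgFock (intDomain h)) :
    dysonTermOp Υ ν s b r F (c • F') = c • dysonTermOp Υ ν s b r F F' := by
  rw [dysonTermOp, dysonTermOp, Finset.smul_sum]
  refine Finset.sum_congr rfl fun ε _ => ?_
  rw [map_smul, map_smul, inner_smul_right, smul_smul, mul_left_comm]

/-- The factor `(2π)^(-1/2)` of each vertex. -/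
def vertexFactor : ℂ := (((Real.sqrt (2 * Real.pi))⁻¹ : ℝ) : ℂ) * -Complex.I

theorem prefactor_succ (n : ℕ) :
    (((2 * Real.pi) ^ (-((n + 1 : ℕ) : ℝ) / 2) : ℝ) : ℂ) * (-Complex.I) ^ (n + 1) =
      vertexFactor * ((((2 * Real.pi) ^ (-(n : ℝ) / 2) : ℝ) : ℂ) * (-Complex.I) ^ n) := by
  have h1 : (2 * Real.pi) ^ (-((n + 1 : ℕ) : ℝ) / 2) =
      (Real.sqrt (2 * Real.pi))⁻¹ * (2 * Real.pi) ^ (-(n : ℝ) / 2) := by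
    rw [Real.sqrt_eq_rpow, ← Real.rpow_neg (by positivity), ← Real.rpow_add (by positivity)]
    congr 1
    push_cast
    ring
  rw [h1, vertexFactor, pow_succ]
  push_cast
  ring

/-- Split the sum over signs at the last vertex: a creation operator acts as an annihilation
operator on the left vector, an annihilation operator on the right one. -/
theorem dysonTermOp_succ (Υ : K →L[ℂ] K) (ν : K →L[ℂ] HTensor K h) {n : ℕ} (s : Fin (n + 1) → ℝ)
    (b : Fin (n + 1) → h) (r : ℝ) (F F' : AlgFock (intDomain h)) :
    dysonTermOp Υ ν s b r F F' = semi (-(Complex.I • Υ)) (r - s (Fin.last n)) *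
      ((vertexFactor • component ν (b (Fin.last n))) *
        dysonTermOp Υ ν (fun i => s i.castSucc) (fun i => b i.castSucc) (s (Fin.last n))
          (annih (noiseBra (s (Fin.last n)) (b (Fin.last n))) F) F' +
      (vertexFactor • star (component ν (b (Fin.last n)))) *
        dysonTermOp Υ ν (fun i => s i.castSucc) (fun i => b i.castSucc) (s (Fin.last n))
          F (annih (noiseBra (s (Fin.last n)) (b (Fin.last n))) F')) := by
  rw [dysonTermOp, ← (Fin.snocEquiv fun _ => Bool).sum_comp, Fintype.sum_prod_type,
    Fintype.sum_bool, mul_add]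
  simp only [prefactor_succ, annihProd_succ, dysonOp, Fin.snocEquiv_apply, Fin.snoc_last, Fin.snoc_castSucc]
  congr 1
  · rw [dysonTermOp, Finset.mul_sum, Finset.mul_sum]
    refine Finset.sum_congr rfl fun ε _ => ?_
    rw [contrSemigroup_eq, signedComponent]
    simp only [if_true, if_false, Bool.true_eq_false]
    rw [mul_smul_comm, mul_smul_comm, smul_mul_assoc, mul_smul_comm, smul_smul]
    congr 1
    ring
  · rw [dysonTermOp, Finset.mul_sum, Finset.mul_sum]
    refine Finset.sum_congr rfl fun ε _ => ?_
    rw [contrSemigroup_eq, signedComponent]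
    simp only [if_true, if_false, Bool.false_eq_true]
    rw [mul_smul_comm, mul_smul_comm, smul_mul_assoc, mul_smul_comm, smul_smul]
    congr 1
    ring

end OperatorTerms

/-! ### Families summable in norm -/

section AbsoluteSums

variable {α α' E 𝔸 : Type*} [NormedAddCommGroup E] [NormedSpace ℂ E]
  [NormedRing 𝔸] [NormedAlgebra ℂ 𝔸] [CompleteSpace 𝔸]

/-- The family is summable in norm with the given sum. -/
def HasNormSum (F : α → E) (z : E) : Prop := (Summable fun i => ‖F i‖) ∧ HasSum F z

theorem HasNormSum.add {F F' : α → E} {z z' : E} (hF : HasNormSum F z) (hF' : HasNormSum F' z') :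
    HasNormSum (fun i => F i + F' i) (z + z') :=
  ⟨(hF.1.add hF'.1).of_nonneg_of_le (fun _ => norm_nonneg _) fun _ => norm_add_le _ _,
    hF.2.add hF'.2⟩

theorem HasNormSum.sum {m : Type*} {S : Finset m} {F : m → α → E} {z : m → E}
    (hF : ∀ i, HasNormSum (F i) (z i)) :
    HasNormSum (fun j => ∑ i ∈ S, F i j) (∑ i ∈ S, z i) :=
  ⟨(summable_sum fun i _ => (hF i).1).of_nonneg_of_le (fun _ => norm_nonneg _)
    fun _ => norm_sum_le _ _, hasSum_sum fun i _ => (hF i).2⟩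

theorem HasNormSum.smul_const {F : α → ℂ} {z : ℂ} (hF : HasNormSum F z) (x : E) :
    HasNormSum (fun i => F i • x) (z • x) :=
  ⟨by simpa only [norm_smul] using hF.1.mul_right ‖x‖, hF.2.smul_const x⟩

theorem HasNormSum.const_mul {F : α → 𝔸} {z : 𝔸} (hF : HasNormSum F z) (x : 𝔸) :
    HasNormSum (fun i => x * F i) (x * z) :=
  ⟨(hF.1.mul_left ‖x‖).of_nonneg_of_le (fun _ => norm_nonneg _) fun _ => norm_mul_le _ _,
    hF.2.mul_left x⟩

/-- Summability in norm makes the family of products summable over pairs of indices; this is the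
reason for carrying norms through the whole recursion. -/
theorem HasNormSum.mul {F : α → 𝔸} {F' : α' → 𝔸} {z z' : 𝔸} (hF : HasNormSum F z)
    (hF' : HasNormSum F' z') :
    HasNormSum (fun p : α × α' => F p.1 * F' p.2) (z * z') := by
  have h1 := hF.1.mul_norm hF'.1
  refine ⟨h1, ?_⟩
  rw [← hF.2.tsum_eq, ← hF'.2.tsum_eq, tsum_mul_tsum_of_summable_norm hF.1 hF'.1]
  exact h1.of_norm.hasSum

theorem HasNormSum.of_equiv {F : α → E} {z : E} (e : α' ≃ α) (hF : HasNormSum (F ∘ e) z) :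
    HasNormSum F z :=
  ⟨e.summable_iff.mp hF.1, e.hasSum_iff.mp hF.2⟩

theorem HasNormSum.congr {F F' : α → E} {z : E} (hF : HasNormSum F z) (h : ∀ i, F' i = F i) :
    HasNormSum F' z :=
  funext h ▸ hF

theorem hasNormSum_zero : HasNormSum (fun _ : α => (0 : E)) 0 :=
  ⟨by simp, hasSum_zero⟩

theorem hasNormSum_unique [Unique α] (F : α → E) : HasNormSum F (F default) :=
  ⟨(hasSum_unique _).summable, hasSum_unique _⟩

end AbsoluteSums

/-! ### Summation over the orthonormal basis -/

section BasisSums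

variable {K h ι m : Type*} [NormedAddCommGroup K] [InnerProductSpace ℂ K] [CompleteSpace K]
  [NormedAddCommGroup h] [InnerProductSpace ℂ h] [CompleteSpace h] [Fintype m] [DecidableEq m]

/-- The operator of a creation vertex on exponential vectors. -/
def creationVertex (ν : K →L[ℂ] HTensor K h) (f : intDomain h) (s : ℝ) (b : h) : K →L[ℂ] K :=
  (vertexFactor * starRingEnd ℂ (noiseBra s b f)) • component ν b

/-- The operator of an annihilation vertex on exponential vectors. -/
def annihilationVertex (ν : K →L[ℂ] HTensor K h) (g : intDomain h) (s : ℝ) (b : h) : K →L[ℂ] K :=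
  (vertexFactor * noiseBra s b g) • star (component ν b)

theorem creationVertex_eq (ν : K →L[ℂ] HTensor K h) (f : intDomain h) (s : ℝ) (b : h) :
    creationVertex ν f s b = inner ℂ (timeFn f s) b • (-Complex.I) • component ν b := by
  rw [creationVertex, inner_timeFn, vertexFactor, smul_smul, map_mul, Complex.conj_ofReal,
    inner_conj_symm]
  congr 1
  have h1 : (((Real.sqrt (2 * Real.pi))⁻¹ : ℝ) : ℂ) * ((Real.sqrt (2 * Real.pi) : ℝ) : ℂ) = 1 := by
    rw [← Complex.ofReal_mul, inv_mul_cancel₀ (by positivity), Complex.ofReal_one]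
  linear_combination (-Complex.I * inner ℂ (timeFn f s) b) * h1

theorem annihilationVertex_eq (ν : K →L[ℂ] HTensor K h) (g : intDomain h) (s : ℝ) (b : h) :
    annihilationVertex ν g s b = inner ℂ b (timeFn g s) • (-Complex.I) • star (component ν b) := by
  rw [annihilationVertex, inner_timeFn, vertexFactor, smul_smul]
  congr 1
  have h1 : (((Real.sqrt (2 * Real.pi))⁻¹ : ℝ) : ℂ) * ((Real.sqrt (2 * Real.pi) : ℝ) : ℂ) = 1 := by
    rw [← Complex.ofReal_mul, inv_mul_cancel₀ (by positivity), Complex.ofReal_one]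
  linear_combination (-Complex.I * inner ℂ b (timeFn g s)) * h1

/-- The creation part of the generator on exponential vectors. -/
def creationGen (M : m → K →L[ℂ] K) (β : m → h) (f : intDomain h) (s : ℝ) : K →L[ℂ] K :=
  ∑ i, star (inner ℂ (β i) (timeFn f s)) • M i

/-- The annihilation part of the generator on exponential vectors. -/
def annihilationGen (M : m → K →L[ℂ] K) (β : m → h) (g : intDomain h) (s : ℝ) : K →L[ℂ] K :=
  -∑ i, inner ℂ (β i) (timeFn g s) • star (M i)

theorem continuous_creationGen (M : m → K →L[ℂ] K) (β : m → h) (f : intDomain h) :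
    Continuous (creationGen M β f) := by
  have h1 := continuous_timeFn f
  unfold creationGen
  fun_prop

theorem continuous_annihilationGen (M : m → K →L[ℂ] K) (β : m → h) (g : intDomain h) :
    Continuous (annihilationGen M β g) := by
  have h1 := continuous_timeFn g
  unfold annihilationGen
  fun_prop

theorem exists_bound_creationGen (M : m → K →L[ℂ] K) (β : m → h) (f : intDomain h) :
    ∃ C, ∀ s, ‖creationGen M β f s‖ ≤ C := by
  obtain ⟨C, hC⟩ := (timeLabel f).2.2
  refine ⟨∑ i, ‖β i‖ * C * ‖M i‖, fun s => (norm_sum_le _ _).trans (Finset.sum_le_sum fun i _ => ?_)⟩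
  rw [norm_smul, norm_star]
  exact mul_le_mul_of_nonneg_right (norm_inner_le_of_norm_le (hC s)) (norm_nonneg _)

theorem exists_bound_annihilationGen (M : m → K →L[ℂ] K) (β : m → h) (g : intDomain h) :
    ∃ C, ∀ s, ‖annihilationGen M β g s‖ ≤ C := by
  obtain ⟨C, hC⟩ := (timeLabel g).2.2
  refine ⟨∑ i, ‖β i‖ * C * ‖M i‖, fun s => ?_⟩
  rw [annihilationGen, norm_neg]
  refine (norm_sum_le _ _).trans (Finset.sum_le_sum fun i _ => ?_)
  rw [norm_smul, norm_star]
  exact mul_le_mul_of_nonneg_right (norm_inner_le_of_norm_le (hC s)) (norm_nonneg _)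

variable {ν : K →L[ℂ] HTensor K h} {β : m → h}

theorem hasNormSum_inner_mul_inner (b : HilbertBasis ι ℂ h) (x y : h) :
    HasNormSum (fun j => inner ℂ x (b j) * inner ℂ (b j) y) (inner ℂ x y) :=
  ⟨(b.summable_inner_mul_inner x y).norm, b.hasSum_inner_mul_inner x y⟩

/-- Parseval: the sum over `j` of `⟪f(s), b_j⟫ ⟪b_j, β_i⟫` converges absolutely to `⟪f(s), β_i⟫`,
and there are finitely many `i`. The basis disappears from the result. -/
theorem hasNormSum_creationVertex (hν : ν = ∑ i, (tmulRight (β i) : K →L[ℂ] HTensor K h) ∘L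
    component ν (β i)) (b : HilbertBasis ι ℂ h) (f : intDomain h) (s : ℝ) :
    HasNormSum (fun j => creationVertex ν f s (b j))
      (creationGen (fun i => (-Complex.I) • component ν (β i)) β f s) := by
  have h1 := HasNormSum.sum (S := Finset.univ) fun i : m =>
    (hasNormSum_inner_mul_inner b (timeFn f s) (β i)).smul_const ((-Complex.I) • component ν (β i))
  convert h1 using 1
  · funext j
    rw [creationVertex_eq, component_eq_sum hν, Finset.smul_sum, Finset.smul_sum]
    refine Finset.sum_congr rfl fun i _ => ?_
    rw [smul_smul, smul_smul, smul_smul]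
    congr 1
    ring
  · refine Finset.sum_congr rfl fun i _ => ?_
    congr 1
    exact inner_conj_symm _ _

/-- Parseval as for creation. The minus sign in `annihilationGen` arises because the adjoint of `-i
ν_i` is `i ν_i^*`, while the vertex carries `-i ν_i^*`. -/
theorem hasNormSum_annihilationVertex (hν : ν = ∑ i, (tmulRight (β i) : K →L[ℂ] HTensor K h) ∘L
    component ν (β i)) (b : HilbertBasis ι ℂ h) (g : intDomain h) (s : ℝ) :
    HasNormSum (fun j => annihilationVertex ν g s (b j))
      (annihilationGen (fun i => (-Complex.I) • component ν (β i)) β g s) := by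
  have h1 := HasNormSum.sum (S := Finset.univ) fun i : m =>
    (hasNormSum_inner_mul_inner b (β i) (timeFn g s)).smul_const
      ((-Complex.I) • star (component ν (β i)))
  convert h1 using 1
  · funext j
    rw [annihilationVertex_eq, component_eq_sum hν, star_sum, Finset.smul_sum, Finset.smul_sum]
    refine Finset.sum_congr rfl fun i _ => ?_
    have h2 : star (inner ℂ (b j) (β i)) = inner ℂ (β i) (b j) := inner_conj_symm _ _
    rw [star_smul, h2, smul_smul, smul_smul, smul_smul]
    congr 1
    ring
  · rw [annihilationGen, ← Finset.sum_neg_distrib]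
    refine Finset.sum_congr rfl fun i _ => ?_
    have h2 : star (-Complex.I) = Complex.I := by simp
    rw [star_smul, h2, neg_smul, smul_neg]

theorem dysonTermOp_normPow_succ (Υ : K →L[ℂ] K) (f g : intDomain h) {n : ℕ}
    (s : Fin (n + 1) → ℝ) (b : Fin (n + 1) → h) (r : ℝ) (p k : ℕ) :
    dysonTermOp Υ ν s b r (normPow f p) (normPow g k) =
      semi (-(Complex.I • Υ)) (r - s (Fin.last n)) *
      (creationVertex ν f (s (Fin.last n)) (b (Fin.last n)) *
        lowerL (fun p k => dysonTermOp Υ ν (fun i => s i.castSucc) (fun i => b i.castSucc)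
          (s (Fin.last n)) (normPow f p) (normPow g k)) p k +
      annihilationVertex ν g (s (Fin.last n)) (b (Fin.last n)) *
        lowerR (fun p k => dysonTermOp Υ ν (fun i => s i.castSucc) (fun i => b i.castSucc)
          (s (Fin.last n)) (normPow f p) (normPow g k)) p k) := by
  rw [dysonTermOp_succ]
  congr 2
  · cases p with
    | zero => rw [annih_normPow_zero, dysonTermOp_zero_left, lowerL_zero, mul_zero, mul_zero]
    | succ p =>
      rw [annih_normPow_succ, dysonTermOp_smul_left, lowerL_succ, creationVertex, mul_smul_comm,
        smul_mul_assoc, smul_smul, smul_mul_assoc, mul_comm vertexFactor]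
  · cases k with
    | zero => rw [annih_normPow_zero, dysonTermOp_zero_right, lowerR_zero, mul_zero, mul_zero]
    | succ k =>
      rw [annih_normPow_succ, dysonTermOp_smul_right, lowerR_succ, annihilationVertex,
        mul_smul_comm, smul_mul_assoc, smul_smul, smul_mul_assoc, mul_comm vertexFactor]

/-- The indices of different vertices are summed independently, the one of the largest time being
split off, and both sides obey the same recursion. The base case is the inner product of two
normalized powers. -/
theorem hasNormSum_dysonTermOp (hν : ν = ∑ i, (tmulRight (β i) : K →L[ℂ] HTensor K h) ∘L
    component ν (β i)) (Υ : K →L[ℂ] K) (b : HilbertBasis ι ℂ h) (f g : intDomain h) {n : ℕ}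
    (s : Fin n → ℝ) (r : ℝ) (p k : ℕ) :
    HasNormSum (fun j : Fin n → ι =>
        dysonTermOp Υ ν s (fun i => b (j i)) r (normPow f p) (normPow g k))
      (seriesIntegrand (-(Complex.I • Υ))
        (creationGen (fun i => (-Complex.I) • component ν (β i)) β f)
        (annihilationGen (fun i => (-Complex.I) • component ν (β i)) β g)
        (expCoeff (inner ℂ f.1 g.1)) n s r p k) := by
  induction n generalizing r p k with
  | zero =>
    have h1 := hasNormSum_unique (fun j : Fin 0 → ι =>
        dysonTermOp Υ ν s (fun i => b (j i)) r (normPow f p) (normPow g k))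
    convert h1 using 1
    rw [dysonTermOp, Fintype.sum_unique]
    simp [annihProd, inner_toFock_normPow, dysonOp, contrSemigroup_eq, seriesIntegrand]
  | succ n ih =>
    refine HasNormSum.of_equiv (Fin.snocEquiv fun _ => ι) ?_
    have hl : HasNormSum (fun j : Fin n → ι => lowerL (fun p k => dysonTermOp Υ ν
        (fun i => s i.castSucc) (fun i => b (j i)) (s (Fin.last n)) (normPow f p) (normPow g k)) p k)
        (lowerL (seriesIntegrand (-(Complex.I • Υ))
        (creationGen (fun i => (-Complex.I) • component ν (β i)) β f)
        (annihilationGen (fun i => (-Complex.I) • component ν (β i)) β g)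
        (expCoeff (inner ℂ f.1 g.1)) n (fun i => s i.castSucc) (s (Fin.last n))) p k) := by
      cases p with
      | zero => exact hasNormSum_zero
      | succ p => exact ih _ _ _ _
    have hr : HasNormSum (fun j : Fin n → ι => lowerR (fun p k => dysonTermOp Υ ν
        (fun i => s i.castSucc) (fun i => b (j i)) (s (Fin.last n)) (normPow f p) (normPow g k)) p k)
        (lowerR (seriesIntegrand (-(Complex.I • Υ))
        (creationGen (fun i => (-Complex.I) • component ν (β i)) β f)
        (annihilationGen (fun i => (-Complex.I) • component ν (β i)) β g)
        (expCoeff (inner ℂ f.1 g.1)) n (fun i => s i.castSucc) (s (Fin.last n))) p k) := by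
      cases k with
      | zero => simpa only [lowerR_zero] using hasNormSum_zero
      | succ k => simpa only [lowerR_succ] using ih _ _ _ _
    have h1 := (((hasNormSum_creationVertex hν b f (s (Fin.last n))).mul hl).add
      ((hasNormSum_annihilationVertex hν b g (s (Fin.last n))).mul hr)).const_mul
        (semi (-(Complex.I • Υ)) (r - s (Fin.last n)))
    refine HasNormSum.congr h1 fun j => ?_
    simp only [Function.comp_apply, dysonTermOp_normPow_succ, Fin.snocEquiv_apply, Fin.snoc_last,
      Fin.snoc_castSucc]

end BasisSums

/-! ### Matrix elements of the group between powers -/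

section MatrixElements

theorem HasNormSum.hasSum_inner {α α' E : Type*} [NormedAddCommGroup E] [InnerProductSpace ℂ E]
    {F : α → E} {F' : α' → E} {z z' : E} (hF : HasNormSum F z) (hF' : HasNormSum F' z') :
    HasSum (fun p : α × α' => inner ℂ (F p.1) (F' p.2)) (inner ℂ z z') := by
  have h1 : Summable fun p : α × α' => inner ℂ (F p.1) (F' p.2) :=
    Summable.of_norm_bounded
      (hF.1.mul_of_nonneg hF'.1 (fun _ => norm_nonneg _) fun _ => norm_nonneg _)
      fun _ => norm_inner_le_norm _ _
  have h2 : HasSum (fun i => inner ℂ (F i) z') (inner ℂ z z') := by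
    have h3 := ((innerSL ℂ z').hasSum hF.2).star
    simpa using h3
  have h4 := h1.hasSum.prod_fiberwise fun i => (innerSL ℂ (F i)).hasSum hF'.2
  rw [← HasSum.unique h4 h2]
  exact h1.hasSum

variable {K h m : Type*} [NormedAddCommGroup K] [InnerProductSpace ℂ K] [CompleteSpace K]
  [NormedAddCommGroup h] [InnerProductSpace ℂ h] [CompleteSpace h] [Fintype m] [DecidableEq m]

/-- The factors `1 / √(n!)` are estimated by one, which leaves a geometric series; this is why `x
‖f‖ < 1` is assumed, although the vector series converges without it. -/
theorem hasNormSum_coh (f : intDomain h) (ψ : K) {x : ℝ} (hx : 0 < x) (hxf : x * ‖f.1‖ < 1) :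
    HasNormSum (fun n => (x : ℂ) ^ n • embed (ψ ⊗ₜ[ℂ] normPow f n))
      (coh ((x : ℂ) • timeLabel f) ψ : BigSpace K h) := by
  have h1 : ∀ n, (x : ℂ) ^ n • embed (ψ ⊗ₜ[ℂ] normPow f n) =
      (tmulLeft ψ : Fock (OneParticle h) →L[ℂ] BigSpace K h)
        (((x : ℂ) ^ n * (((Real.sqrt n.factorial)⁻¹ : ℝ) : ℂ)) • powVec f.1 n) := fun n => by
    rw [embed_tmul, toFock_normPow, ← tmulLeft_apply, ← map_smul, smul_smul]
  have h2 : (coh ((x : ℂ) • timeLabel f) ψ : BigSpace K h) =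
      (tmulLeft ψ : Fock (OneParticle h) →L[ℂ] BigSpace K h) (expVec ((x : ℂ) • f.1)) := by
    rw [tmulLeft_apply, coh, map_smul, toVec_timeLabel]
  rw [h2]
  refine HasNormSum.congr ⟨?_, (tmulLeft ψ).hasSum (hasSum_expVec (x : ℂ) f.1)⟩ h1
  refine Summable.of_nonneg_of_le (fun _ => norm_nonneg _) (fun n => ?_)
    ((summable_geometric_of_lt_one (by positivity) hxf).mul_left
      ‖(tmulLeft ψ : Fock (OneParticle h) →L[ℂ] BigSpace K h)‖)
  refine (ContinuousLinearMap.le_opNorm _ _).trans (mul_le_mul_of_nonneg_left ?_ (norm_nonneg _))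
  have h3 : ‖powVec f.1 n‖ = ‖f.1‖ ^ n := by
    have h4 : ‖powVec f.1 n‖ ^ 2 = (‖f.1‖ ^ n) ^ 2 := by
      have h5 := inner_powVec f.1 f.1 n n
      rw [if_pos rfl, inner_self_eq_norm_sq_to_K, inner_self_eq_norm_sq_to_K] at h5
      have h6 : ‖powVec f.1 n‖ ^ 2 = (‖f.1‖ ^ 2) ^ n := by exact_mod_cast h5
      rw [h6]
      ring
    exact (pow_left_inj₀ (norm_nonneg _) (by positivity) two_ne_zero).mp h4
  rw [norm_smul, norm_mul, norm_pow, Complex.norm_real, Complex.norm_real,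
    Real.norm_of_nonneg hx.le, Real.norm_of_nonneg (by positivity), h3, mul_pow]
  have h7 : (Real.sqrt n.factorial)⁻¹ ≤ 1 := by
    refine inv_le_one_of_one_le₀ (Real.one_le_sqrt.mpr ?_)
    exact_mod_cast Nat.one_le_iff_ne_zero.mpr n.factorial_ne_zero
  calc x ^ n * (Real.sqrt n.factorial)⁻¹ * ‖f.1‖ ^ n ≤ x ^ n * 1 * ‖f.1‖ ^ n := by gcongr
    _ = x ^ n * ‖f.1‖ ^ n := by rw [mul_one]

theorem timeFn_smul (c : ℂ) (f : intDomain h) (s : ℝ) : timeFn (c • f) s = c • timeFn f s :=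
  congrFun (congrArg Subtype.val (map_smul timeLabel c f)) s

theorem gen_smul_timeLabel (G : K →L[ℂ] K) (M : m → K →L[ℂ] K) (β : m → h) (f g : intDomain h)
    (x y : ℝ) :
    gen G M β (timeLabel ((x : ℂ) • f)).1 (timeLabel ((y : ℂ) • g)).1 =
      fun s => G + (x : ℂ) • creationGen M β f s + (y : ℂ) • annihilationGen M β g s := by
  funext s
  rw [gen, timeLabel_apply, timeLabel_apply, timeFn_smul, timeFn_smul, creationGen,
    annihilationGen, smul_neg, Finset.smul_sum, Finset.smul_sum, sub_eq_add_neg, add_right_comm]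
  congr 1
  · congr 1
    refine Finset.sum_congr rfl fun i _ => ?_
    rw [inner_smul_right, star_mul', smul_smul]
    congr 2
    exact Complex.conj_ofReal x
  · refine congrArg Neg.neg (Finset.sum_congr rfl fun i _ => ?_)
    rw [inner_smul_right, smul_smul]

/-- The matrix elements of an operator on `K`. -/
def matrixElement (ψ φ : K) : (K →L[ℂ] K) →L[ℂ] ℂ :=
  innerSL ℂ ψ ∘L ContinuousLinearMap.apply ℂ K φ

theorem matrixElement_apply (ψ φ : K) (A : K →L[ℂ] K) : matrixElement ψ φ A = inner ℂ ψ (A φ) := rfl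

/-- Both sides are the coefficients of `x^p y^k` of the same function, the matrix element of `U`
between the exponential vectors of `x f` and `y g`: the left by expanding the vectors, the right by
expanding the propagator. -/
theorem inner_embed_normPow {G : K →L[ℂ] K} {M : m → K →L[ℂ] K} {β : m → h} {t : ℝ} (ht : 0 ≤ t)
    {U : BigSpace K h →L[ℂ] BigSpace K h}
    (hU : ∀ (f g : Label h) (ψ φ : K), inner ℂ (coh f ψ) (U (coh g φ)) =
      Complex.exp (inner ℂ (toVec (shift (-t) f)) (toVec g)) *
        inner ℂ ψ (prop (gen G M β (shift (-t) f).1 g.1) 0 t φ))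
    (f g : intDomain h) (ψ φ : K) (p k : ℕ) :
    inner ℂ (embed (ψ ⊗ₜ[ℂ] normPow f p)) (U (embed (φ ⊗ₜ[ℂ] normPow g k))) =
      inner ℂ ψ (seriesSum G (creationGen M β (phase t f)) (annihilationGen M β g)
        (expCoeff (inner ℂ (phase t f).1 g.1)) t p k φ) := by
  obtain ⟨C, hC⟩ := exists_bound_creationGen M β (phase t f)
  obtain ⟨C', hC'⟩ := exists_bound_annihilationGen M β g
  obtain ⟨ρ, hρ, hs⟩ := hasSum_seriesSum (G := G) (continuous_creationGen M β (phase t f))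
    (continuous_annihilationGen M β g) (fun u => (hC u).trans (le_max_left C C'))
    (fun u => (hC' u).trans (le_max_right C C')) (inner ℂ (phase t f).1 g.1) ht
  -- Small enough for the series of the propagator and for norm convergence of both exponential
  -- vectors.
  set R : ℝ := min ρ (min (1 + ‖f.1‖)⁻¹ (1 + ‖g.1‖)⁻¹) with hR
  have hR0 : 0 < R := lt_min hρ (lt_min (by positivity) (by positivity))
  have hlt : ∀ (f : intDomain h) (x : ℝ), x < (1 + ‖f.1‖)⁻¹ → x * ‖f.1‖ < 1 := fun f x hx => by
    have h0 : 0 < 1 + ‖f.1‖ := by positivity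
    have h1 : x * (1 + ‖f.1‖) < 1 := by
      rwa [← lt_div_iff₀ h0, one_div]
    by_cases h2 : 0 ≤ x
    · linarith
    · exact (mul_nonpos_of_nonpos_of_nonneg (not_le.mp h2).le (norm_nonneg _)).trans_lt one_pos
  have key := doublePowerSeries_coeff_eq_zero (c := fun q : ℕ × ℕ =>
    inner ℂ (embed (ψ ⊗ₜ[ℂ] normPow f q.1)) (U (embed (φ ⊗ₜ[ℂ] normPow g q.2))) -
      inner ℂ ψ (seriesSum G (creationGen M β (phase t f)) (annihilationGen M β g)
        (expCoeff (inner ℂ (phase t f).1 g.1)) t q.1 q.2 φ)) hR0 ?_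
  · exact sub_eq_zero.mp (congrFun key (p, k))
  intro x y hx hxR hy hyR
  have h1 := hasNormSum_coh f ψ hx
    (hlt f x (hxR.trans_le ((min_le_right _ _).trans (min_le_left _ _))))
  have h2 := hasNormSum_coh g φ hy
    (hlt g y (hyR.trans_le ((min_le_right _ _).trans (min_le_right _ _))))
  have h2' : HasNormSum (fun n => U ((y : ℂ) ^ n • embed (φ ⊗ₜ[ℂ] normPow g n)))
      (U (coh ((y : ℂ) • timeLabel g) φ)) :=
    ⟨(h2.1.mul_left ‖U‖).of_nonneg_of_le (fun _ => norm_nonneg _)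
      fun _ => ContinuousLinearMap.le_opNorm _ _, U.hasSum h2.2⟩
  have h3 := h1.hasSum_inner h2'
  have h4 := (matrixElement ψ φ).hasSum
    (hs x y hx (hxR.trans_le (min_le_left _ _)) hy (hyR.trans_le (min_le_left _ _)))
  have h5 : inner ℂ (coh ((x : ℂ) • timeLabel f) ψ) (U (coh ((y : ℂ) • timeLabel g) φ)) =
      matrixElement ψ φ (Complex.exp (x * y * inner ℂ (phase t f).1 g.1) •
        prop (fun u => G + (x : ℂ) • creationGen M β (phase t f) u +
          (y : ℂ) • annihilationGen M β g u) 0 t) := by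
    rw [hU, ← map_smul, ← map_smul, shift_timeLabel, toVec_timeLabel, toVec_timeLabel, map_smul,
      gen_smul_timeLabel, map_smul, matrixElement_apply, smul_eq_mul]
    congr 2
    have h6 : inner ℂ ((x : ℂ) • (phase t f).1) ((y : ℂ) • g.1) =
        (x : ℂ) * y * inner ℂ (phase t f).1 g.1 := by
      rw [inner_smul_left, inner_smul_right, Complex.conj_ofReal, mul_assoc]
    exact h6
  rw [h5] at h3
  have h7 := h3.sub h4
  rw [sub_self] at h7
  refine h7.congr_fun fun q => ?_
  simp only [map_smul, inner_smul_left, inner_smul_right, smul_eq_mul,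
    matrixElement_apply, map_pow, Complex.conj_ofReal]
  ring

end MatrixElements

/-! ### Bookkeeping of absolute convergence -/

section Total

variable {ι : Type*}

/-- The sums and integrals of a family of terms converge absolutely, with the given total. -/
def HasTotal (t : ℝ) (T : ∀ n, (Fin n → ℝ) → (Fin n → ι) → ℂ) (z : ℂ) : Prop :=
  (∀ n, ∀ s ∈ timeSimplex n t, Summable (T n s)) ∧
  (∀ n, IntegrableOn (fun s => ∑' j, T n s j) (timeSimplex n t)) ∧
  HasSum (fun n => ∫ s in timeSimplex n t, ∑' j, T n s j) z

variable {t : ℝ} {T T' : ∀ n, (Fin n → ℝ) → (Fin n → ι) → ℂ} {z z' : ℂ}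

theorem HasTotal.add (h : HasTotal t T z) (h' : HasTotal t T' z') :
    HasTotal t (fun n s j => T n s j + T' n s j) (z + z') := by
  have h1 : ∀ n, ∀ s ∈ timeSimplex n t, ∑' j, (T n s j + T' n s j) =
      ∑' j, T n s j + ∑' j, T' n s j := fun n s hs => (h.1 n s hs).tsum_add (h'.1 n s hs)
  refine ⟨fun n s hs => (h.1 n s hs).add (h'.1 n s hs), fun n => ?_, ?_⟩
  · exact ((h.2.1 n).add (h'.2.1 n)).congr_fun (fun s hs => (h1 n s hs).symm)
      (isCompact_timeSimplex n t).measurableSet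
  · refine (h.2.2.add h'.2.2).congr_fun fun n => ?_
    rw [setIntegral_congr_fun (isCompact_timeSimplex n t).measurableSet (h1 n)]
    exact integral_add (h.2.1 n) (h'.2.1 n)

theorem HasTotal.const_mul (h : HasTotal t T z) (c : ℂ) :
    HasTotal t (fun n s j => c * T n s j) (c * z) := by
  refine ⟨fun n s hs => (h.1 n s hs).mul_left c, fun n => ?_, ?_⟩
  · simp only [tsum_mul_left]
    exact (h.2.1 n).const_mul c
  · simp only [tsum_mul_left, integral_const_mul]
    exact h.2.2.mul_left c

theorem hasTotal_zero : HasTotal t (fun n _ (_ : Fin n → ι) => (0 : ℂ)) 0 := by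
  refine ⟨fun n s hs => summable_zero, fun n => ?_, ?_⟩
  · simp
  · simp

end Total

/-! ### The Dyson series as a form on the whole domain -/

section Forms

variable {K h m ι : Type*} [NormedAddCommGroup K] [InnerProductSpace ℂ K] [CompleteSpace K]
  [NormedAddCommGroup h] [InnerProductSpace ℂ h] [CompleteSpace h] [Fintype m] [DecidableEq m]

theorem span_tmul_normPow : Submodule.span ℂ (Set.range fun p : K × intDomain h × ℕ =>
    (p.1 ⊗ₜ[ℂ] normPow p.2.1 p.2.2 : FormDomain K h)) = ⊤ := by
  rw [eq_top_iff]
  rintro x -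
  induction x using TensorProduct.induction_on with
  | zero => exact Submodule.zero_mem _
  | add x y hx hy => exact Submodule.add_mem _ hx hy
  | tmul ψ F =>
    have hF : F ∈ Submodule.span ℂ (Set.range fun p : intDomain h × ℕ => normPow p.1 p.2) := by
      rw [span_normPow]; trivial
    induction hF using Submodule.span_induction with
    | mem F hF =>
      obtain ⟨p, rfl⟩ := hF
      exact Submodule.subset_span ⟨(ψ, p), rfl⟩
    | zero => rw [TensorProduct.tmul_zero]; exact Submodule.zero_mem _
    | add x y _ _ hx hy => rw [TensorProduct.tmul_add]; exact Submodule.add_mem _ hx hy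
    | smul c x _ hx => rw [TensorProduct.tmul_smul]; exact Submodule.smul_mem _ _ hx

variable (Υ : K →L[ℂ] K) (ν : K →L[ℂ] HTensor K h)

theorem dysonTerm_add_left (t : ℝ) {n : ℕ} (s : Fin n → ℝ) (b : Fin n → h)
    (Φ Φ' Ψ : FormDomain K h) : dysonTerm Υ ν t s b (Φ + Φ') Ψ =
      dysonTerm Υ ν t s b Φ Ψ + dysonTerm Υ ν t s b Φ' Ψ := by
  simp only [dysonTerm, map_add, inner_add_left, mul_add, Finset.sum_add_distrib]

theorem dysonTerm_add_right (t : ℝ) {n : ℕ} (s : Fin n → ℝ) (b : Fin n → h)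
    (Φ Ψ Ψ' : FormDomain K h) : dysonTerm Υ ν t s b Φ (Ψ + Ψ') =
      dysonTerm Υ ν t s b Φ Ψ + dysonTerm Υ ν t s b Φ Ψ' := by
  simp only [dysonTerm, map_add, inner_add_right, mul_add, Finset.sum_add_distrib]

theorem dysonTerm_smul_left (t : ℝ) {n : ℕ} (s : Fin n → ℝ) (b : Fin n → h) (c : ℂ)
    (Φ Ψ : FormDomain K h) : dysonTerm Υ ν t s b (c • Φ) Ψ =
      starRingEnd ℂ c * dysonTerm Υ ν t s b Φ Ψ := by
  simp only [dysonTerm, map_smul, inner_smul_left, Finset.mul_sum]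
  exact Finset.sum_congr rfl fun _ _ => by ring

theorem dysonTerm_smul_right (t : ℝ) {n : ℕ} (s : Fin n → ℝ) (b : Fin n → h) (c : ℂ)
    (Φ Ψ : FormDomain K h) : dysonTerm Υ ν t s b Φ (c • Ψ) =
      c * dysonTerm Υ ν t s b Φ Ψ := by
  simp only [dysonTerm, map_smul, inner_smul_right, Finset.mul_sum]
  exact Finset.sum_congr rfl fun _ _ => by ring

variable {Υ ν} {β : m → h}

/-- For fixed times the basis sum is a continuous function, integrable over the compact simplex; the
sum over `n` has only the terms with `n ≤ p + k`. -/
theorem hasTotal_normPow (hν : ν = ∑ i, (tmulRight (β i) : K →L[ℂ] HTensor K h) ∘L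
    component ν (β i)) (b : HilbertBasis ι ℂ h) {t : ℝ} (ht : 0 ≤ t) (f g : intDomain h) (ψ φ : K)
    (p k : ℕ) :
    HasTotal t (fun n s j => dysonTerm Υ ν t s (fun i : Fin n => b (j i)) (ψ ⊗ₜ[ℂ] normPow f p)
        (φ ⊗ₜ[ℂ] normPow g k))
      (inner ℂ ψ (seriesSum (-(Complex.I • Υ))
        (creationGen (fun i => (-Complex.I) • component ν (β i)) β (phase t f))
        (annihilationGen (fun i => (-Complex.I) • component ν (β i)) β g)
        (expCoeff (inner ℂ (phase t f).1 g.1)) t p k φ)) := by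
  set a := creationGen (fun i => (-Complex.I) • component ν (β i)) β (phase t f) with ha'
  set a' := annihilationGen (fun i => (-Complex.I) • component ν (β i)) β g with hb'
  have ha : Continuous a := continuous_creationGen _ _ _
  have hb : Continuous a' := continuous_annihilationGen _ _ _
  have h1 : ∀ n (s : Fin n → ℝ), HasSum (fun j : Fin n → ι => dysonTerm Υ ν t s
      (fun i : Fin n => b (j i)) (ψ ⊗ₜ[ℂ] normPow f p) (φ ⊗ₜ[ℂ] normPow g k))
      (matrixElement ψ φ (seriesIntegrand (-(Complex.I • Υ)) a a'
        (expCoeff (inner ℂ (phase t f).1 g.1)) n s t p k)) := fun n s => by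
    refine ((matrixElement ψ φ).hasSum
      (hasNormSum_dysonTermOp hν Υ b (phase t f) g s t p k).2).congr_fun fun j => ?_
    rw [dysonTerm_tmul, secondQuant_normPow, matrixElement_apply]
  have h2 : ∀ n, IntegrableOn (fun s => seriesIntegrand (-(Complex.I • Υ)) a a'
      (expCoeff (inner ℂ (phase t f).1 g.1)) n s t p k) (timeSimplex n t) := fun n => by
    refine ContinuousOn.integrableOn_compact (isCompact_timeSimplex n t) (Continuous.continuousOn ?_)
    exact (continuous_seriesIntegrand ha hb n p k).comp
      (by fun_prop : Continuous fun s : Fin n → ℝ => (s, t))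
  refine ⟨fun n s _ => (h1 n s).summable, fun n => ?_, ?_⟩
  · simp only [(h1 n _).tsum_eq]
    exact (matrixElement ψ φ).integrable_comp (h2 n)
  · have h3 : ∀ n, ∫ s in timeSimplex n t, ∑' j : Fin n → ι, dysonTerm Υ ν t s
        (fun i : Fin n => b (j i)) (ψ ⊗ₜ[ℂ] normPow f p) (φ ⊗ₜ[ℂ] normPow g k) =
        matrixElement ψ φ (seriesTerm (-(Complex.I • Υ)) a a'
          (expCoeff (inner ℂ (phase t f).1 g.1)) n t p k) := fun n => by
      simp only [(h1 n _).tsum_eq]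
      rw [(matrixElement ψ φ).integral_comp_comm (h2 n), integral_seriesIntegrand ha hb n ht]
    simp only [h3]
    rw [← matrixElement_apply, seriesSum, map_sum]
    refine hasSum_sum_of_ne_finset_zero fun n hn => ?_
    rw [seriesTerm_eq_zero (by simpa using hn), map_zero]

/-- Convergence and value are compatible with sesquilinear combinations, and the normalized powers
span the form domain. -/
theorem hasTotal_dysonTerm (hν : ν = ∑ i, (tmulRight (β i) : K →L[ℂ] HTensor K h) ∘L
    component ν (β i)) (b : HilbertBasis ι ℂ h) {t : ℝ} (ht : 0 ≤ t)
    {U : BigSpace K h →L[ℂ] BigSpace K h}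
    (hU : ∀ (f g : Label h) (ψ φ : K), inner ℂ (coh f ψ) (U (coh g φ)) =
      Complex.exp (inner ℂ (toVec (shift (-t) f)) (toVec g)) *
        inner ℂ ψ (prop (gen (-(Complex.I • Υ)) (fun i => (-Complex.I) • component ν (β i)) β
          (shift (-t) f).1 g.1) 0 t φ)) (Φ Ψ : FormDomain K h) :
    HasTotal t (fun n s j => dysonTerm Υ ν t s (fun i : Fin n => b (j i)) Φ Ψ)
      (inner ℂ (embed Φ) (U (embed Ψ))) := by
  have hΦ : Φ ∈ Submodule.span ℂ (Set.range fun p : K × intDomain h × ℕ =>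
      (p.1 ⊗ₜ[ℂ] normPow p.2.1 p.2.2 : FormDomain K h)) := by
    rw [span_tmul_normPow]; trivial
  have hΨ : Ψ ∈ Submodule.span ℂ (Set.range fun p : K × intDomain h × ℕ =>
      (p.1 ⊗ₜ[ℂ] normPow p.2.1 p.2.2 : FormDomain K h)) := by
    rw [span_tmul_normPow]; trivial
  induction hΦ, hΨ using Submodule.span_induction₂ with
  | mem_mem Φ Ψ hΦ hΨ =>
    obtain ⟨⟨ψ, f, p⟩, rfl⟩ := hΦ
    obtain ⟨⟨φ, g, k⟩, rfl⟩ := hΨ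
    rw [inner_embed_normPow ht hU]
    exact hasTotal_normPow hν b ht f g ψ φ p k
  | zero_left Ψ hΨ =>
    have h1 : ∀ {n : ℕ} (s : Fin n → ℝ) (b : Fin n → h), dysonTerm Υ ν t s b 0 Ψ = 0 :=
      fun s b => by simpa using dysonTerm_smul_left Υ ν t s b 0 0 Ψ
    simp only [h1, map_zero, inner_zero_left]
    exact hasTotal_zero
  | zero_right Φ hΦ =>
    have h1 : ∀ {n : ℕ} (s : Fin n → ℝ) (b : Fin n → h), dysonTerm Υ ν t s b Φ 0 = 0 :=
      fun s b => by simpa using dysonTerm_smul_right Υ ν t s b 0 Φ 0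
    simp only [h1, map_zero, inner_zero_right]
    exact hasTotal_zero
  | add_left Φ Φ' Ψ _ _ _ h1 h2 =>
    simp only [dysonTerm_add_left, map_add, inner_add_left]
    exact h1.add h2
  | add_right Φ Ψ Ψ' _ _ _ h1 h2 =>
    simp only [dysonTerm_add_right, map_add, inner_add_right]
    exact h1.add h2
  | smul_left c Φ Ψ _ _ h1 =>
    simp only [dysonTerm_smul_left, map_smul, inner_smul_left]
    exact h1.const_mul _
  | smul_right c Φ Ψ _ _ h1 =>
    simp only [dysonTerm_smul_right, map_smul, inner_smul_right]
    exact h1.const_mul _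

theorem HasTotal.dysonConverges {b : HilbertBasis ι ℂ h} {t : ℝ} {Φ Ψ : FormDomain K h} {z : ℂ}
    (H : HasTotal t (fun n s j => dysonTerm Υ ν t s (fun i : Fin n => b (j i)) Φ Ψ) z) :
    DysonConverges Υ ν b t Φ Ψ :=
  ⟨H.1, H.2.1, H.2.2.summable⟩

theorem HasTotal.dysonForm_eq {b : HilbertBasis ι ℂ h} {t : ℝ} {Φ Ψ : FormDomain K h} {z : ℂ}
    (H : HasTotal t (fun n s j => dysonTerm Υ ν t s (fun i : Fin n => b (j i)) Φ Ψ) z) :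
    dysonForm Υ ν b t Φ Ψ = z :=
  H.2.2.tsum_eq

/-- For zero labels the generator of the kernel is the constant `G`, and the vacuum label is
translation invariant. -/
theorem vacuum_compression {G : K →L[ℂ] K} {M : m → K →L[ℂ] K} {t : ℝ} (ht : 0 ≤ t)
    {U : BigSpace K h →L[ℂ] BigSpace K h}
    (hU : ∀ (f g : Label h) (ψ φ : K), inner ℂ (coh f ψ) (U (coh g φ)) =
      Complex.exp (inner ℂ (toVec (shift (-t) f)) (toVec g)) *
        inner ℂ ψ (prop (gen G M β (shift (-t) f).1 g.1) 0 t φ)) :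
    ContinuousLinearMap.adjoint (coh 0) ∘L U ∘L coh 0 = NormedSpace.exp ((t : ℂ) • G) := by
  refine ContinuousLinearMap.ext fun φ => ext_inner_left ℂ fun ψ => ?_
  have h2 : gen G M β (shift (-t) (0 : Label h)).1 (0 : Label h).1 = fun _ => G := by
    funext s
    rw [shift_zero_right, gen]
    simp
  simp only [ContinuousLinearMap.comp_apply]
  rw [ContinuousLinearMap.adjoint_inner_right, hU, h2, prop_const G ht, shift_zero_right, map_zero,
    inner_zero_left, Complex.exp_zero, one_mul, sub_zero]

end Forms

end Langevin

end

/-! ### Assembly -/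

theorem mainTheorem5 {K h : Type*}
    [NormedAddCommGroup K] [InnerProductSpace ℂ K] [FiniteDimensional ℂ K] [CompleteSpace K]
    [NormedAddCommGroup h] [InnerProductSpace ℂ h] [CompleteSpace h] {ι : Type*}
    (M : (K →L[ℂ] K) →L[ℂ] (K →L[ℂ] K)) (Υ : K →L[ℂ] K) (ν : K →L[ℂ] HTensor K h)
    (hΥ : -(Complex.I • Υ) + Complex.I • ContinuousLinearMap.adjoint Υ =
      -(ContinuousLinearMap.adjoint ν ∘L ν))
    (hM : ∀ A : K →L[ℂ] K, M A =
      -(Complex.I • (Υ ∘L A - A ∘L ContinuousLinearMap.adjoint Υ)) +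
        ContinuousLinearMap.adjoint ν ∘L tensorOne A ∘L ν) :
    ∃ U : ℝ → (BigSpace K h →L[ℂ] BigSpace K h),
      (∀ t, U t ∈ unitary (BigSpace K h →L[ℂ] BigSpace K h)) ∧
      U 0 = 1 ∧
      (∀ s t, U (s + t) = U s ∘L U t) ∧
      (∀ z, Continuous fun t => U t z) ∧
      (∀ (b : HilbertBasis ι ℂ h) (Φ Ψ : FormDomain K h),
        (∀ t, 0 ≤ t → DysonConverges Υ ν b t Φ Ψ) ∧
        ∀ t, inner ℂ (embed Φ) (U t (embed Ψ)) = langevinForm Υ ν b t Φ Ψ) ∧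
      (∀ t : ℝ, 0 ≤ t →
        ContinuousLinearMap.adjoint (vacuumEmbedding K h) ∘L U t ∘L vacuumEmbedding K h =
          NormedSpace.exp ((-(Complex.I * t)) • Υ)) ∧
      (∀ t : ℝ, 0 ≤ t → ∀ A : K →L[ℂ] K,
        ContinuousLinearMap.adjoint (vacuumEmbedding K h) ∘L U t ∘L tensorOne A ∘L U (-t) ∘L
            vacuumEmbedding K h =
          NormedSpace.exp ((t : ℂ) • M) A) := by
  classical
  obtain ⟨n, β, hβ, hν⟩ := exists_noise_decomposition ν
  set G : K →L[ℂ] K := -(Complex.I • Υ) with hG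
  -- With the factor `-i` absorbed in `L`, the annihilation coefficient `-star (L i)` is `-i ν_i^*`,
  -- as in the Dyson series, and the phases cancel in `star (L i) * A * L i`.
  set L : Fin n → K →L[ℂ] K := fun i => (-Complex.I) • component ν (β i) with hL
  have hstarG : star G = Complex.I • ContinuousLinearMap.adjoint Υ := by
    rw [hG, star_neg, star_smul, ContinuousLinearMap.star_eq_adjoint]
    simp
  have hLL : ∀ (A : K →L[ℂ] K) i, star (L i) * A * L i =
      star (component ν (β i)) * A * component ν (β i) := fun A i => by
    simp only [hL]
    rw [star_smul, smul_mul_assoc, smul_mul_assoc, mul_smul_comm, smul_smul]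
    simp
  have hGL : G + star G + ∑ i, star (L i) * L i = 0 := by
    have h1 := adjoint_comp_self_eq_sum hν
    have h2 : ∑ i, star (L i) * L i = ContinuousLinearMap.adjoint ν ∘L ν := by
      rw [h1]
      refine Finset.sum_congr rfl fun i _ => ?_
      simpa using hLL 1 i
    rw [hstarG, h2, hG, hΥ, neg_add_cancel]
  have hML : ∀ A, M A = G * A + A * star G + ∑ i, star (L i) * A * L i := fun A => by
    have h1 : ∑ i, star (L i) * A * L i =
        ContinuousLinearMap.adjoint ν ∘L tensorOne A ∘L ν := by
      rw [adjoint_comp_tensorOne_comp hν]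
      exact Finset.sum_congr rfl fun i _ => hLL A i
    rw [hM, h1, hstarG, hG, mul_smul_comm, neg_mul, smul_mul_assoc, smul_sub, neg_sub]
    congr 1
    rw [sub_eq_neg_add]
    rfl
  obtain ⟨U, hunit, hzero, hadd, hcont, hneg, hker, hlim⟩ := exists_unitaryGroup hGL hβ
  have htot : ∀ (b : HilbertBasis ι ℂ h) (t : ℝ), 0 ≤ t → ∀ Φ Ψ : FormDomain K h,
      HasTotal t (fun n s j => dysonTerm Υ ν t s (fun i : Fin n => b (j i)) Φ Ψ)
        (inner ℂ (embed Φ) (U t (embed Ψ))) := fun b t ht Φ Ψ =>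
    hasTotal_dysonTerm hν b ht (hker t ht) Φ Ψ
  refine ⟨U, hunit, hzero, hadd, hcont, fun b Φ Ψ => ⟨fun t ht => (htot b t ht Φ Ψ).dysonConverges,
    fun t => ?_⟩, fun t ht => ?_, fun t ht A => ?_⟩
  · rw [langevinForm]
    split_ifs with ht
    · exact (htot b t ht Φ Ψ).dysonForm_eq.symm
    -- At negative times both the form and the group are given by the adjoint of the positive time.
    · have h1 := hneg (-t)
      rw [neg_neg] at h1
      rw [(htot b (-t) (by linarith) Ψ Φ).dysonForm_eq, h1,
        ContinuousLinearMap.adjoint_inner_right, inner_conj_symm]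
  · have h1 := vacuum_compression ht (hker t ht)
    rw [coh_zero, hG, smul_neg, smul_smul, ← neg_smul, mul_comm (t : ℂ)] at h1
    exact h1
  -- The limit of the dual scheme is `U (-t)`, and its adjoint is `U t`.
  · have h1 := dilation_of_tendsto hβ hML ht (hlim t ht) A
    rw [hneg t] at h1 ⊢
    rw [ContinuousLinearMap.adjoint_adjoint, coh_zero] at h1
    exact h1
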